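/- Let $X$ be a smooth projective geometrically connected curve over a field $k$, let $D$ be a divisor on $X$ of degree $l\in\mathbb Z$, and let $n\ge 1$. A $D$-twisted quiver sheaf is a tuple $\overline E=(E_i,\theta_i)_{i\in\mathbb Z/n}$ of coherent sheaves $E_i$ on $X$ and morphisms $\theta_i\colon E_i\to E_{i+1}(D)$; a quiver subsheaf consists of subsheaves $F_i\subseteq E_i$ with $\theta_i(F_i)\subseteq F_{i+1}(D)$. Put $\operatorname{rk}\overline E=\sum_i\operatorname{rk}E_i$, $\deg\overline E=\sum_i\deg E_i$ and $\mu(\overline E)=\deg\overline E/\operatorname{rk}\overline E\in\mathbb Q\cup\{\infty\}$ for $\overline E\neq0$, and use the same notation for graded coherent sheaves $(E_i)_{i\in\mathbb Z/n}$ without maps. A quiver sheaf $\overline E$ is semistable if $\mu(\overline F)\le\mu(\overline E)$ for every nonzero quiver subsheaf $\overline F\subseteq\overline E$; semistability of graded coherent sheaves is defined in the same way with graded subsheaves. A quiver sheaf $\overline E$ is positive if all factors of the Harder--Narasimhan filtration of its underlying graded sheaf $(E_i)_i$ have slope $\ge 0$. A positive quiver sheaf $\overline E$ is semistable in the positive subcategory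 if $\mu(\overline F)\le\mu(\overline E)$ for every nonzero positive quiver subsheaf $\overline F\subseteq\overline E$. Let $r\ge1$ be an integer and let $\nu\in\mathbb Q\cup\{\infty\}$ satisfy $\nu\ge l\,\frac{r-1}{2}$. Then every positive quiver sheaf of rank $r$ and slope $\nu$ that is semistable in the positive subcategory is a semistable quiver sheaf of slope $\nu$. -/

import Mathlib

open CategoryTheory CategoryTheory.Limits AlgebraicGeometry TopologicalSpace Opposite

universe u

noncomputable section

namespace QuiverSheaves

variable {X : Scheme.{u}}

/-! ### Stalks, coherence, rank -/

/-- The stalk `M_x` of an `𝒪_X`-module, as an abelian group. -/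
abbrev stalk (M : X.Modules) (x : X) : Ab.{u} :=
  TopCat.Presheaf.stalk (C := Ab.{u}) M.presheaf x

/-- The `𝒪_{X,x}`-module structure of the stalk of a presheaf of `𝒪_X`-modules. -/
instance presheafStalkModule
    (M : PresheafOfModules.{u} (X.presheaf ⋙ forget₂ CommRingCat RingCat)) (x : X) :
    Module (X.presheaf.stalk x) (TopCat.Presheaf.stalk (C := Ab.{u}) M.presheaf x) :=
  inferInstance

/-- The `𝒪_{X,x}`-module structure of the stalk `M_x`. -/
instance stalkModule (M : X.Modules) (x : X) : Module (X.presheaf.stalk x) (stalk M x) :=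
  presheafStalkModule M.val x

/-- Coherent sheaves on a locally noetherian scheme: quasi-coherent `𝒪_X`-modules whose module of
sections over every affine open set is finitely generated. -/
structure IsCoherent (M : X.Modules) : Prop where
  quasicoherent : SheafOfModules.IsQuasicoherent (R := X.ringCatSheaf) M
  finite : ∀ U : X.Opens, IsAffineOpen U → Module.Finite Γ(X, U) Γ(M, U)

section Integral

variable [IsIntegral X]

/-- The stalk of `M` at the generic point, a vector space over the function field. -/
abbrev genericStalk (M : X.Modules) : Ab.{u} := stalk M (genericPoint X)

/-- The rank of `M`: the dimension of its generic stalk over the function field. -/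
def rank (M : X.Modules) : ℕ :=
  Module.finrank X.functionField (genericStalk M)

/-- The generic stalk as an `𝒪_{X,x}`-module, through `𝒪_{X,x} → K(X)`. -/
abbrev genericStalkModule (M : X.Modules) (x : X) :
    Module (X.presheaf.stalk x) (genericStalk M) :=
  Module.compHom (genericStalk M) (algebraMap (X.presheaf.stalk x) X.functionField)

/-- The cospecialization map `M_x → M_η` to the generic stalk. -/
def toGenericStalk (M : X.Modules) (x : X) : stalk M x → genericStalk M :=
  fun s => (TopCat.Presheaf.stalkSpecializes (C := Ab.{u}) M.presheaf
    ((genericPoint_spec X).specializes trivial)).hom s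

/-- For a module `V` over a ring `R` and submodules `P`, `Q` of `V`, the relative index
`[P : Q] = length (P / P ∩ Q) - length (Q / P ∩ Q)`. -/
def relIndex {R V : Type*} [CommRing R] [AddCommGroup V] [Module R V] (P Q : Submodule R V) : ℤ :=
  ((Module.length R (P ⧸ Q.submoduleOf P)).toNat : ℤ) -
    ((Module.length R (Q ⧸ P.submoduleOf Q)).toNat : ℤ)

/-- The local degree at `x` of `M` with respect to a basis `b` of the generic stalk: the length of
the torsion of `M_x` plus the relative index of the lattice `im (M_x → M_η)` (that is, `M_x` modulo
torsion) and the lattice spanned over `𝒪_{X,x}` by `b`. For a line bundle with rational section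
`b`, this is the order of vanishing of `b` at `x`. -/
def localDegree (M : X.Modules) {ι : Type*} (b : ι → genericStalk M) (x : X) : ℤ :=
  letI := genericStalkModule M x
  ((Module.length (X.presheaf.stalk x)
      (Submodule.torsion (X.presheaf.stalk x) (stalk M x))).toNat : ℤ) +
    relIndex (Submodule.span (X.presheaf.stalk x) (Set.range (toGenericStalk M x)))
      (Submodule.span (X.presheaf.stalk x) (Set.range b))

/-- The type of closed points of `X`. -/
abbrev ClosedPoint (X : Scheme.{u}) : Type u := {x : X // IsClosed ({x} : Set X)}

variable {k : Type u} [Field k] (f : X ⟶ Spec (.of k))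

/-- The degree of a coherent sheaf `M` on a curve `X` over `k`: the degree over `k` of its torsion
plus the degree of `det` of its torsion-free part, the latter being the degree of the divisor of a
nonzero rational section `b₁ ∧ ⋯ ∧ bᵣ`, where `b` is a basis of the generic stalk. On a proper
curve, principal divisors have degree zero, so the choice of the basis is immaterial. -/
def degree (M : X.Modules) : ℤ :=
  ∑ᶠ x : ClosedPoint X, (f.residueDegree x.1 : ℤ) *
    localDegree M (Module.Basis.ofVectorSpace X.functionField (genericStalk M)) x.1

/-! ### Divisors and twisting -/

/-- Divisors on a curve: finite formal sums of closed points. -/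
abbrev CurveDivisor (X : Scheme.{u}) : Type u := ClosedPoint X →₀ ℤ

/-- The degree over `k` of a divisor. -/
def divisorDegree (D : CurveDivisor X) : ℤ := D.sum fun x m => m * (f.residueDegree x.1 : ℤ)

/-- The fractional ideal `𝔪_x ^ (-d)` of `𝒪_{X,x}` (a discrete valuation ring, in the
situation of interest), written as the quotient `𝔪_x ^ d⁻ / 𝔪_x ^ d⁺`. It consists of
the rational functions `g` with `ord_x g + d ≥ 0`. -/
def localPoles (x : X) (d : ℤ) : Submodule (X.presheaf.stalk x) X.functionField :=
  IsLocalization.coeSubmodule X.functionField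
      (IsLocalRing.maximalIdeal (X.presheaf.stalk x) ^ (-d).toNat) /
    IsLocalization.coeSubmodule X.functionField
      (IsLocalRing.maximalIdeal (X.presheaf.stalk x) ^ d.toNat)

/-- Families of rational functions indexed by the points of `U`. -/
def RatFamily (U : X.Opens) : Type u := U → X.functionField

instance (U : X.Opens) : AddCommGroup (RatFamily U) :=
  inferInstanceAs (AddCommGroup (U → X.functionField))

/-- `Γ(X, U)` acts on families of rational functions through its germs. -/
instance (U : X.Opens) : Module Γ(X, U) (RatFamily U) :=
  Module.compHom (R := U → X.functionField) (U → X.functionField)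
    (RingHom.pi fun x : U =>
      (algebraMap (X.presheaf.stalk x.1) X.functionField).comp (X.presheaf.germ U x.1 x.2).hom)

theorem RatFamily.smul_apply {U : X.Opens} (r : Γ(X, U)) (s : RatFamily U) (x : U) :
    (r • s) x = (X.presheaf.germ U x.1 x.2 r) • (s x) := by
  rw [Algebra.smul_def]; rfl

/-- The sections of `𝒪_X(D)` over `U`: a rational function `g` (a constant family over the points of
`U`, so that there is only one section over the empty set) with `ord_x g + D(x) ≥ 0` at all closed
points `x` of `U`. -/
def divisorSections (D : CurveDivisor X) (U : X.Opens) : Submodule Γ(X, U) (RatFamily U) where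
  carrier := {s | (∀ x y : U, s x = s y) ∧
    ∀ (x : ClosedPoint X) (hx : x.1 ∈ U), s ⟨x.1, hx⟩ ∈ localPoles x.1 (D x)}
  add_mem' := by
    rintro s t ⟨hs, hs'⟩ ⟨ht, ht'⟩
    refine ⟨fun x y => ?_, fun x hx => ?_⟩
    · change s x + t x = s y + t y
      rw [hs x y, ht x y]
    · exact (localPoles x.1 (D x)).add_mem (hs' x hx) (ht' x hx)
  zero_mem' := ⟨fun _ _ => rfl, fun x _ => (localPoles x.1 (D x)).zero_mem⟩
  smul_mem' := by
    rintro r s ⟨hs, hs'⟩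
    refine ⟨fun x y => ?_, fun x hx => ?_⟩
    · have : Nonempty U := ⟨x⟩
      rw [RatFamily.smul_apply, RatFamily.smul_apply, hs x y, Algebra.smul_def, Algebra.smul_def,
        Scheme.algebraMap_germ_eq_germToFunctionField X x.2,
        Scheme.algebraMap_germ_eq_germToFunctionField X y.2]
    · rw [RatFamily.smul_apply]
      exact (localPoles x.1 (D x)).smul_mem _ (hs' x hx)

/-- Restriction of sections of `𝒪_X(D)`. -/
def divisorRes (D : CurveDivisor X) {U V : X.Opens} (h : V ≤ U) :
    divisorSections D U →+ divisorSections D V where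
  toFun s := ⟨fun x => s.1 ⟨x.1, h x.2⟩, fun _ _ => s.2.1 _ _, fun x hx => s.2.2 x (h hx)⟩
  map_zero' := rfl
  map_add' _ _ := rfl

theorem divisorRes_smul (D : CurveDivisor X) {U V : X.Opens} (i : V ⟶ U) (r : Γ(X, U))
    (m : divisorSections D U) :
    divisorRes D i.le (r • m) = X.presheaf.map i.op r • divisorRes D i.le m := by
  refine Subtype.ext (funext fun x => ?_)
  change (r • m.1) ⟨x.1, i.le x.2⟩ = (X.presheaf.map i.op r • (divisorRes D i.le m).1) x
  rw [RatFamily.smul_apply, RatFamily.smul_apply, X.presheaf.germ_res_apply i]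
  rfl

/-- `𝒪_X(D)` as a presheaf of abelian groups. -/
def divisorAb (D : CurveDivisor X) : (Opens X)ᵒᵖ ⥤ Ab.{u} where
  obj U := AddCommGrpCat.of (divisorSections D U.unop)
  map i := AddCommGrpCat.ofHom (divisorRes D i.unop.le)

instance (D : CurveDivisor X) (U : (Opens X)ᵒᵖ) :
    Module ((X.presheaf ⋙ forget₂ CommRingCat RingCat).obj U) ((divisorAb D).obj U) :=
  inferInstanceAs (Module Γ(X, U.unop) (divisorSections D U.unop))

/-- `𝒪_X(D)` as a presheaf of `𝒪_X`-modules (it is a sheaf). -/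
def divisorModule (D : CurveDivisor X) :
    PresheafOfModules.{u} (X.presheaf ⋙ forget₂ CommRingCat RingCat) :=
  PresheafOfModules.ofPresheaf (divisorAb D) (by
    intro U V i r m
    exact divisorRes_smul D i.unop r m)

/-- The presheaf tensor product `U ↦ M(U) ⊗ 𝒪_X(D)(U)`, as a functor of `M`. -/
def presheafTwist (D : CurveDivisor X) : X.Modules ⥤ X.PresheafOfModules :=
  Scheme.Modules.toPresheafOfModules X ⋙
    MonoidalCategory.tensorRight
      (C := PresheafOfModules.{u} (X.presheaf ⋙ forget₂ CommRingCat RingCat)) (divisorModule D)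

/-- The functor `M ↦ M(D) = M ⊗ 𝒪_X(D)`: the sheaf associated with the presheaf tensor product. -/
def twist (D : CurveDivisor X) : X.Modules ⥤ X.Modules :=
  presheafTwist D ⋙ (PresheafOfModules.sheafification (R := X.ringCatSheaf) (𝟙 X.ringCatSheaf.obj) :
    X.PresheafOfModules ⥤ SheafOfModules.{u} X.ringCatSheaf)

/-! ### Graded sheaves: slope, semistability, Harder-Narasimhan filtrations -/

variable {I : Type} [Fintype I]

/-- The slope `deg E / rk E ∈ ℚ ∪ {∞}` of a graded coherent sheaf `E = (E_i)_i`, where rank and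
degree are summed over the components. -/
def slope (E : I → X.Modules) : WithTop ℚ :=
  if ∑ i, rank (E i) = 0 then ⊤
  else (((∑ i, degree f (E i) : ℤ) / (∑ i, rank (E i) : ℕ) : ℚ) : WithTop ℚ)

/-- A graded coherent sheaf `E` is semistable if `μ(F) ≤ μ(E)` for all nonzero graded coherent
subsheaves `F ⊆ E`. -/
def IsSemistableGraded (E : I → X.Modules) : Prop :=
  ∀ (F : I → X.Modules) (j : ∀ i, F i ⟶ E i), (∀ i, IsCoherent (F i)) → (∀ i, Mono (j i)) →
    (∃ i, ¬ IsZero (F i)) → slope f F ≤ slope f E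

/-- A Harder-Narasimhan filtration `E = E₀ ⊋ E₁ ⊋ ⋯ ⊋ E_s = 0` of a graded coherent sheaf `E`: the
factors `E_j / E_{j+1}` are semistable, and their slopes are strictly increasing. -/
structure HNFiltration (E : I → X.Modules) where
  /-- the number of factors -/
  length : ℕ
  /-- the steps of the filtration -/
  step : Fin (length + 1) → ∀ i, Subobject (E i)
  step_zero : ∀ i, step 0 i = ⊤
  step_last : ∀ i, step (Fin.last length) i = ⊥
  step_coherent : ∀ j i, IsCoherent (step j i : X.Modules)
  step_lt : ∀ j : Fin length, step j.succ < step j.castSucc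
  factor_semistable : ∀ j : Fin length, IsSemistableGraded f fun i =>
    cokernel (Subobject.ofLE (step j.succ i) (step j.castSucc i) ((step_lt j).le i))
  slope_strictMono : StrictMono fun j : Fin length => slope f fun i =>
    cokernel (Subobject.ofLE (step j.succ i) (step j.castSucc i) ((step_lt j).le i))

/-- The `j`-th factor `E_j / E_{j+1}` of a Harder-Narasimhan filtration. -/
def HNFiltration.factor {f : X ⟶ Spec (.of k)} {E : I → X.Modules} (h : HNFiltration f E)
    (j : Fin h.length) : I → X.Modules := fun i =>
  cokernel (Subobject.ofLE (h.step j.succ i) (h.step j.castSucc i) ((h.step_lt j).le i))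

/-- A graded coherent sheaf is positive if the factors of its Harder-Narasimhan filtration have
slopes `≥ 0`, that is, if `μ_min(E) ≥ 0`. The zero sheaf, with no factors, is positive. -/
def IsPositive (E : I → X.Modules) : Prop :=
  ∃ h : HNFiltration f E, ∀ j, 0 ≤ slope f (h.factor j)

/-! ### Twisted quiver sheaves -/

/-- A `D`-twisted quiver sheaf for the cyclic quiver with vertices `ℤ/n` and arrows `i → i + 1`:
coherent sheaves `E_i` and morphisms `θ_i : E_i ⟶ E_{i+1}(D)`. -/
structure QuiverSheaf (D : CurveDivisor X) (n : ℕ) where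
  /-- the component sheaves -/
  obj : ZMod n → X.Modules
  coherent : ∀ i, IsCoherent (obj i)
  /-- the twisted maps along the arrows -/
  θ : ∀ i, obj i ⟶ (twist D).obj (obj (i + 1))

/-- Quiver subsheaves of `E`: quiver sheaves `F` with monomorphisms `F_i ⟶ E_i` compatible with the
maps `θ_i`. -/
structure QuiverSubsheaf {D : CurveDivisor X} {n : ℕ} (E : QuiverSheaf D n) where
  /-- the underlying quiver sheaf -/
  sheaf : QuiverSheaf D n
  /-- the inclusion -/
  incl : ∀ i, sheaf.obj i ⟶ E.obj i
  mono : ∀ i, Mono (incl i)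
  comm : ∀ i, sheaf.θ i ≫ (twist D).map (incl (i + 1)) = incl i ≫ E.θ i

namespace QuiverSheaf

variable {D : CurveDivisor X} {n : ℕ}

/-- A quiver sheaf is nonzero if some component is. -/
def IsNonzero (E : QuiverSheaf D n) : Prop := ∃ i, ¬ IsZero (E.obj i)

variable [NeZero n]

/-- The rank of a quiver sheaf: the sum of the ranks of its components. -/
def totalRank (E : QuiverSheaf D n) : ℕ := ∑ i, rank (E.obj i)

/-- The slope of a quiver sheaf. -/
def μ (E : QuiverSheaf D n) : WithTop ℚ := slope f E.obj

/-- Membership in the subcategory of semistable quiver sheaves of slope `ν`: every nonzero quiver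
subsheaf has slope at most that of `E`, which is `ν`. -/
def IsSemistableOfSlope (ν : WithTop ℚ) (E : QuiverSheaf D n) : Prop :=
  E.μ f = ν ∧ ∀ F : QuiverSubsheaf E, F.sheaf.IsNonzero → F.sheaf.μ f ≤ E.μ f

/-- Membership in the positive subcategory: the underlying graded sheaf is positive. -/
def IsPositive (E : QuiverSheaf D n) : Prop := QuiverSheaves.IsPositive f E.obj

/-- Membership in the subcategory of the positive quiver sheaves of slope `ν` that are semistable
in the positive subcategory: every nonzero positive quiver subsheaf has slope at most `ν`. -/
def IsPositiveSemistableOfSlope (ν : WithTop ℚ) (E : QuiverSheaf D n) : Prop :=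
  E.IsPositive f ∧ E.μ f = ν ∧
    ∀ F : QuiverSubsheaf E, F.sheaf.IsNonzero → F.sheaf.IsPositive f → F.sheaf.μ f ≤ E.μ f

end QuiverSheaf

end Integral

end QuiverSheaves

end

open CategoryTheory CategoryTheory.Limits AlgebraicGeometry TopologicalSpace Opposite

noncomputable section

namespace QuiverSheaves

variable {X : Scheme.{u}}

section

section Twist
variable [IsIntegral X]

open TensorProduct

/-- The canonical map from `M(U) ⊗ 𝒪_X(D)(U)` to the sections of `M(D)`. -/
def twistUnit (D : CurveDivisor X) (M : X.Modules) (U : X.Opens) :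
    TensorProduct Γ(X, U) Γ(M, U) (divisorSections D U) →ₗ[Γ(X, U)] Γ((twist D).obj M, U) where
  toFun p := ((CategoryTheory.toSheafify (Opens.grothendieckTopology X)
    ((presheafTwist D).obj M).presheaf).app (op U)).hom p
  map_add' := map_add _
  map_smul' r p := (((PresheafOfModules.toSheafify (𝟙 X.ringCatSheaf.obj)
    (CategoryTheory.toSheafify (Opens.grothendieckTopology X)
      ((presheafTwist D).obj M).presheaf)).app (op U))).hom.map_smul r p

theorem twistUnit_res (D : CurveDivisor X) (M : X.Modules) {U V : X.Opens} (i : V ⟶ U)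
    (m : Γ(M, U)) (a : divisorSections D U) :
    ((twist D).obj M).presheaf.map i.op (twistUnit D M U (m ⊗ₜ a)) =
      twistUnit D M V (M.presheaf.map i.op m ⊗ₜ divisorRes D i.le a) :=
  ((ConcreteCategory.congr_hom ((CategoryTheory.toSheafify (Opens.grothendieckTopology X)
    ((presheafTwist D).obj M).presheaf).naturality i.op))
    (show ((presheafTwist D).obj M).obj (op U) from m ⊗ₜ[Γ(X, U)] a)).symm

theorem twistUnit_map (D : CurveDivisor X) {M N : X.Modules} (φ : M ⟶ N) (U : X.Opens)
    (m : Γ(M, U)) (a : divisorSections D U) :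
    ((twist D).map φ).app U (twistUnit D M U (m ⊗ₜ a)) = twistUnit D N U (φ.app U m ⊗ₜ a) := by
  have := CategoryTheory.toSheafify_naturality (Opens.grothendieckTopology X)
    ((PresheafOfModules.toPresheaf _).map ((presheafTwist D).map φ))
  exact (ConcreteCategory.congr_hom (congr_app this (op U))
    (show ((presheafTwist D).obj M).obj (op U) from m ⊗ₜ[Γ(X, U)] a)).symm

theorem exists_twistUnit_eq (D : CurveDivisor X) (M : X.Modules) {U : X.Opens}
    (s : Γ((twist D).obj M, U)) (x : X) (hx : x ∈ U) :
    ∃ (V : X.Opens) (i : V ⟶ U) (_ : x ∈ V)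
      (p : TensorProduct Γ(X, V) Γ(M, V) (divisorSections D V)),
      twistUnit D M V p = ((twist D).obj M).presheaf.map i.op s := by
  have := Presheaf.imageSieve_mem (Opens.grothendieckTopology X)
    (CategoryTheory.toSheafify (Opens.grothendieckTopology X)
    ((presheafTwist D).obj M).presheaf) s
  obtain ⟨V, i, ⟨p, hp⟩, hV⟩ := this x hx
  exact ⟨V, i, hV, p, hp⟩

theorem exists_res_eq_of_twistUnit_eq (D : CurveDivisor X) (M : X.Modules) {U : X.Opens}
    (p q : TensorProduct Γ(X, U) Γ(M, U) (divisorSections D U))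
    (h : twistUnit D M U p = twistUnit D M U q) (x : X) (hx : x ∈ U) :
    ∃ (V : X.Opens) (i : V ⟶ U) (_ : x ∈ V),
      ((presheafTwist D).obj M).presheaf.map i.op p =
        ((presheafTwist D).obj M).presheaf.map i.op q := by
  have := Presheaf.equalizerSieve_mem (Opens.grothendieckTopology X)
    (CategoryTheory.toSheafify (Opens.grothendieckTopology X)
    ((presheafTwist D).obj M).presheaf) p q h
  obtain ⟨V, i, hp, hV⟩ := this x hx
  exact ⟨V, i, hV, hp⟩

theorem presheafTwist_map_tmul (D : CurveDivisor X) (M : X.Modules) {U V : X.Opens} (i : V ⟶ U)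
    (m : Γ(M, U)) (a : divisorSections D U) :
    ((presheafTwist D).obj M).presheaf.map i.op
      (show ((presheafTwist D).obj M).obj (op U) from m ⊗ₜ[Γ(X, U)] a) =
      (show ((presheafTwist D).obj M).obj (op V) from
        M.presheaf.map i.op m ⊗ₜ[Γ(X, V)] divisorRes D i.le a) := rfl

/-- `t` generates `𝒪_X(D)` on `U`. -/
structure IsLocalGenerator (D : CurveDivisor X) {U : X.Opens} (t : divisorSections D U) : Prop where
  existsUnique : ∀ (V : X.Opens) (h : V ≤ U) (a : divisorSections D V), ∃! r : Γ(X, V),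
    r • divisorRes D h t = a

namespace IsLocalGenerator
variable {D : CurveDivisor X} {U : X.Opens} {t : divisorSections D U} (ht : IsLocalGenerator D t)
include ht

theorem exists_eq_tmul (M : X.Modules) {V : X.Opens} (h : V ≤ U)
    (p : TensorProduct Γ(X, V) Γ(M, V) (divisorSections D V)) :
    ∃ m, p = m ⊗ₜ divisorRes D h t := by
  induction p with
  | zero => exact ⟨0, by simp⟩
  | add p q hp hq =>
    obtain ⟨m, rfl⟩ := hp
    obtain ⟨n, rfl⟩ := hq
    exact ⟨m + n, by rw [add_tmul]⟩
  | tmul m a =>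
    obtain ⟨r, rfl, -⟩ := ht.existsUnique V h a
    exact ⟨r • m, by rw [tmul_smul, smul_tmul']⟩

def equiv {V : X.Opens} (h : V ≤ U) : Γ(X, V) ≃ₗ[Γ(X, V)] divisorSections D V :=
  LinearEquiv.ofBijective (LinearMap.toSpanSingleton _ _ (divisorRes D h t))
    ⟨fun a _ hab => (ht.existsUnique V h (a • divisorRes D h t)).unique rfl hab.symm,
      fun a => (ht.existsUnique V h a).exists⟩

theorem tmul_injective (M : X.Modules) {V : X.Opens} (h : V ≤ U) :
    Function.Injective fun m : Γ(M, V) => m ⊗ₜ[Γ(X, V)] divisorRes D h t := by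
  intro m n hmn
  let e := (TensorProduct.congr (LinearEquiv.refl Γ(X, V) Γ(M, V)) (ht.equiv h).symm).trans
    (TensorProduct.rid Γ(X, V) Γ(M, V))
  have (m : Γ(M, V)) : e (m ⊗ₜ[Γ(X, V)] divisorRes D h t) = m := by
    have : (ht.equiv h).symm (divisorRes D h t) = 1 := by
      rw [LinearEquiv.symm_apply_eq]; exact (one_smul Γ(X, V) (divisorRes D h t)).symm
    simp [e, this]
  rw [← this m, ← this n]
  exact congrArg e hmn

theorem bijective (M : X.Modules) {V : X.Opens} (h : V ≤ U) :
    Function.Bijective fun m : Γ(M, V) => twistUnit D M V (m ⊗ₜ divisorRes D h t) := by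
  have inj : ∀ {V : X.Opens} (h : V ≤ U), Function.Injective fun m : Γ(M, V) =>
    twistUnit D M V (m ⊗ₜ divisorRes D h t) := by
    intro V h m n hmn
    refine TopCat.Presheaf.section_ext ⟨M.presheaf, M.isSheaf⟩ _ _ _ fun x hx => ?_
    obtain ⟨W, i, hW, hi⟩ := exists_res_eq_of_twistUnit_eq D M _ _ hmn x hx
    erw [presheafTwist_map_tmul, presheafTwist_map_tmul] at hi
    have := ht.tmul_injective M (i.le.trans h) hi
    exact TopCat.Presheaf.germ_ext _ W hW i i this
  refine ⟨inj h, fun s => ?_⟩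
  have key (x : V) : ∃ (W : X.Opens) (i : W ⟶ V) (_ : x.1 ∈ W) (m : Γ(M, W)),
      twistUnit D M W (m ⊗ₜ divisorRes D (i.le.trans h) t) =
        ((twist D).obj M).presheaf.map i.op s := by
    obtain ⟨W, i, hW, p, hp⟩ := exists_twistUnit_eq D M s x.1 x.2
    obtain ⟨m, rfl⟩ := ht.exists_eq_tmul M (i.le.trans h) p
    exact ⟨W, i, hW, m, hp⟩
  choose W i hW m hm using key
  have res {W W' : X.Opens} (hW : W ≤ U) (j : W' ⟶ W) (m : Γ(M, W)) :
      ((twist D).obj M).presheaf.map j.op (twistUnit D M W (m ⊗ₜ divisorRes D hW t)) =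
        twistUnit D M W' (M.presheaf.map j.op m ⊗ₜ divisorRes D (j.le.trans hW) t) :=
    twistUnit_res D M j m _
  have hcov : V ≤ iSup W := fun x hx => Opens.mem_iSup.mpr ⟨⟨x, hx⟩, hW _⟩
  obtain ⟨m', hm', -⟩ := TopCat.Sheaf.existsUnique_gluing' ⟨M.presheaf, M.isSheaf⟩ W V i hcov m
    (fun x y => by
      apply inj (V := W x ⊓ W y) (inf_le_left.trans ((i x).le.trans h))
      change twistUnit D M _ (M.presheaf.map (Opens.infLELeft (W x) (W y)).op _ ⊗ₜ _) =
        twistUnit D M _ (M.presheaf.map (Opens.infLERight (W x) (W y)).op _ ⊗ₜ _)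
      rw [← res ((i x).le.trans h), ← res ((i y).le.trans h), hm, hm,
        ← Functor.map_comp_apply, ← Functor.map_comp_apply]
      rfl)
  refine ⟨m', TopCat.Sheaf.eq_of_locally_eq' ⟨((twist D).obj M).presheaf,
    ((twist D).obj M).isSheaf⟩ W V i hcov _ _ fun x => ?_⟩
  change ((twist D).obj M).presheaf.map _ _ = ((twist D).obj M).presheaf.map _ _
  rw [res h (i x), ← hm, ← hm' x]

end IsLocalGenerator
end Twist

end

section

open Scheme.Modules

/-- The sections of `M` over a basic open subset of `U` are the localization of `Γ(M, U)`. -/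
structure IsLocalizingOn (M : X.Modules) (U : X.Opens) : Prop where
  exists_eq : ∀ (f : Γ(X, U)) (s : Γ(M, X.basicOpen f)), ∃ (n : ℕ) (t : Γ(M, U)),
    M.presheaf.map (homOfLE (X.basicOpen_le f)).op t =
      X.presheaf.map (homOfLE (X.basicOpen_le f)).op (f ^ n) • s
  exists_zero : ∀ (f : Γ(X, U)) (t : Γ(M, U)),
    M.presheaf.map (homOfLE (X.basicOpen_le f)).op t = 0 → ∃ n : ℕ, f ^ n • t = 0

theorem fromSpec_image_le {U : X.Opens} (hU : IsAffineOpen U) (W : (Spec Γ(X, U)).Opens) :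
    hU.fromSpec ''ᵁ W ≤ U := by
  exact (hU.fromSpec.image_le_opensRange W).trans hU.opensRange_fromSpec.le

theorem restrict_fromSpec_smul (M : X.Modules) {U : X.Opens} (hU : IsAffineOpen U)
    (W : (Spec Γ(X, U)).Opens) (r : Γ(X, U)) (x : Γ(M, hU.fromSpec ''ᵁ W)) :
    (show Γ(M, hU.fromSpec ''ᵁ W) from r • (show Γ(M.restrict hU.fromSpec, W) from x)) =
      X.presheaf.map (homOfLE (fromSpec_image_le hU W)).op r • x := by
  rw [smul_Spec_def]
  have h : X.presheaf.map (homOfLE (fromSpec_image_le hU W)).op r =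
    ((hU.fromSpec.appIso W).inv
      (((Spec Γ(X, U)).presheaf.map W.leTop.op) ((Scheme.ΓSpecIso Γ(X, U)).inv r))) := by
    rw [← ConcreteCategory.comp_apply, ← ConcreteCategory.comp_apply]
    congr 2
    rw [← cancel_mono (hU.fromSpec.appIso W).hom]
    rw [Scheme.Hom.appIso_hom', Scheme.Hom.map_appLE, Scheme.Hom.appLE, hU.fromSpec_app_self]
    simp only [Category.assoc, ← Functor.map_comp]
    have : (hU.fromSpec.appIso W).inv ≫ hU.fromSpec.appLE (hU.fromSpec ''ᵁ W) W
        (hU.fromSpec.preimage_image_eq W).ge = 𝟙 _ := by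
      rw [← Scheme.Hom.appIso_hom', Iso.inv_hom_id]
    rw [this, Category.comp_id]
    rfl
  rw [h]
  rfl


theorem isLocalizingOn_iff (M : X.Modules) {U : X.Opens} (hU : IsAffineOpen U) :
    IsLocalizing (modulesSpecToSheaf.obj (M.restrict hU.fromSpec)) ↔ IsLocalizingOn M U := by
  have key (f : Γ(X, U)) : IsLocalizedModule (.powers f)
      ((modulesSpecToSheaf.obj (M.restrict hU.fromSpec)).obj.map
        (PrimeSpectrum.basicOpen f).leTop.op).hom ↔
      (∀ (s : Γ(M, X.basicOpen f)), ∃ (n : ℕ) (t : Γ(M, U)),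
    M.presheaf.map (homOfLE (X.basicOpen_le f)).op t =
      X.presheaf.map (homOfLE (X.basicOpen_le f)).op (f ^ n) • s) ∧ ∀ (t : Γ(M, U)),
    M.presheaf.map (homOfLE (X.basicOpen_le f)).op t = 0 → ∃ n : ℕ, f ^ n • t = 0 := by
    have tr : ∀ {U' V' : X.Opens} (h1 : U' = U) (h2 : V' = X.basicOpen f) (h3 : V' ≤ U'),
       ((∀ (s : Γ(M, X.basicOpen f)), ∃ (n : ℕ) (t : Γ(M, U)),
    M.presheaf.map (homOfLE (X.basicOpen_le f)).op t =
      X.presheaf.map (homOfLE (X.basicOpen_le f)).op (f ^ n) • s) ∧ ∀ (t : Γ(M, U)),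
    M.presheaf.map (homOfLE (X.basicOpen_le f)).op t = 0 → ∃ n : ℕ, f ^ n • t = 0) ↔
      ((∀ (s : Γ(M, V')), ∃ (n : ℕ) (t : Γ(M, U')),
    M.presheaf.map (homOfLE h3).op t =
      X.presheaf.map (homOfLE (h3.trans h1.le)).op (f ^ n) • s) ∧ ∀ (t : Γ(M, U')),
    M.presheaf.map (homOfLE h3).op t = 0 →
      ∃ n : ℕ, X.presheaf.map (homOfLE h1.le).op (f ^ n) • t = 0) := by
      rintro U' _ h1 rfl h3
      subst h1
      simp
    rw [tr (U' := hU.fromSpec ''ᵁ ⊤) (V' := hU.fromSpec ''ᵁ (PrimeSpectrum.basicOpen f))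
      (by rw [Scheme.Hom.image_top_eq_opensRange, hU.opensRange_fromSpec])
        (hU.fromSpec_image_basicOpen f)
      (hU.fromSpec.image_mono le_top)]
    constructor
    · intro h
      refine ⟨fun s => ?_, fun t ht => ?_⟩
      · obtain ⟨⟨t, ⟨_, n, rfl⟩⟩, hy⟩ := h.surj s
        refine ⟨n, t, ?_⟩
        exact hy.symm.trans (restrict_fromSpec_smul M hU _ _ _)
      · obtain ⟨⟨_, n, rfl⟩, hn⟩ :=
          (h.exists_of_eq (x₁ := t) (x₂ := 0) (by rw [map_zero]; exact ht))
        refine ⟨n, ?_⟩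
        exact (restrict_fromSpec_smul M hU _ _ _).symm.trans (hn.trans (smul_zero _))
    · intro h
      refine IsLocalizedModule.Away.mk_of_addCommGroup ?_ ?_ ?_
      · exact Scheme.Modules.isUnit_algebraMap_end_of_le_basicOpen f le_rfl
      · intro s
        obtain ⟨n, t, ht⟩ := h.1 s
        refine ⟨n, t, ?_⟩
        exact (restrict_fromSpec_smul M hU _ _ _).trans ht.symm
      · intro t ht
        obtain ⟨n, hn⟩ := h.2 t ht
        refine ⟨n, ?_⟩
        exact (restrict_fromSpec_smul M hU _ _ _).trans hn
  exact ⟨fun h => ⟨fun f => ((key f).1 (h f)).1, fun f => ((key f).1 (h f)).2⟩,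
    fun h f => (key f).2 ⟨h.1 f, h.2 f⟩⟩

theorem isQuasicoherent_restrict_iff (M : X.Modules) {U : X.Opens} (hU : IsAffineOpen U) :
    SheafOfModules.IsQuasicoherent (R := (Spec Γ(X, U)).ringCatSheaf) (M.restrict hU.fromSpec) ↔
      IsLocalizingOn M U := by
  rw [isQuasicoherent_iff_isIso_fromTildeΓ, isIso_fromTildeΓ_iff_isLocalizing, isLocalizingOn_iff]

theorem isLocalizingOn_of_isQuasicoherent (M : X.Modules)
    (hM : SheafOfModules.IsQuasicoherent (R := X.ringCatSheaf) M) {U : X.Opens}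
    (hU : IsAffineOpen U) :
    IsLocalizingOn M U :=
  (isQuasicoherent_restrict_iff M hU).1 inferInstance

theorem isQuasicoherent_of_isLocalizingOn (M : X.Modules) {ι : Type u} (U : ι → X.Opens)
    (hU : ∀ i, IsAffineOpen (U i))
    (hc : IsOpenCover U) (hM : ∀ i, IsLocalizingOn M (U i)) :
    SheafOfModules.IsQuasicoherent (R := X.ringCatSheaf) M := by
  have (i : ι) : Nonempty
    (SheafOfModules.Presentation.{u, u, u} (SheafOfModules.over M (U i))) := by
    have h1 := (isIso_fromTildeΓ_iff_isLocalizing _).2 ((isLocalizingOn_iff M (hU i)).2 (hM i))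
    let P := presentationTilde ((modulesSpecToSheaf.obj (M.restrict (hU i).fromSpec)).presheaf.obj
      (.op ⊤)) .univ (by simp) _ (Submodule.span_eq _)
    let P1 : SheafOfModules.Presentation (M.restrict (hU i).fromSpec) :=
      @SheafOfModules.Presentation.ofIsIso _ _ _ _ _ _ _ _ (fromTildeΓ _) h1 P
    let P2 := presentationRestrict (hU i).isoSpec.hom P1
    let iso : restrictFunctor (hU i).fromSpec ⋙ restrictFunctor (hU i).isoSpec.hom ≅
      restrictFunctor (U i).ι :=
      (restrictFunctorComp _ _).symm ≪≫ restrictFunctorCongr (by simp)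
    let P3 : SheafOfModules.Presentation (M.restrict (U i).ι) :=
      @SheafOfModules.Presentation.ofIsIso _ _ _ _ _ _ _ _ (iso.app M).hom (iso.app M).isIso_hom P2
    let F : SheafOfModules.{u} (U i : Scheme.{u}).ringCatSheaf ⥤
        SheafOfModules.{u} (X.ringCatSheaf.over (U i)) := (overEquiv (U i)).inverse
    have : PreservesColimitsOfSize.{u, u, u, u, u + 1, u + 1} F :=
      inferInstanceAs (PreservesColimitsOfSize.{u, u} (overEquiv (U i)).inverse)
    let P4 := P3.map F ((overEquiv (U i)).unitIso.app (SheafOfModules.unit.{u} _))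
    let e : F.obj (M.restrict (U i).ι) ≅ SheafOfModules.over M (U i) :=
      F.mapIso ((overFunctorEquiv (U i)).symm.app M) ≪≫
        (overEquiv (U i)).unitIso.symm.app (SheafOfModules.over M (U i))
    exact ⟨SheafOfModules.Presentation.ofIsIso.{u, u, u} e.hom P4⟩
  exact (SheafOfModules.QuasicoherentData.mk (M := M) (R := X.ringCatSheaf) ι U
    ((Opens.coversTop_iff (T := X) U).2 hc) fun i => (this i).some).isQuasicoherent

end

section

open Scheme.Modules

/-- The functor of sections over `U`. -/
def sectionsFunctor (U : X.Opens) : X.Modules ⥤ Ab.{u} :=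
  toPresheaf X ⋙ (evaluation (Opens X)ᵒᵖ Ab.{u}).obj (op U)

instance (U : X.Opens) : PreservesLimits (sectionsFunctor U) :=
  have : PreservesLimits ((evaluation (Opens X)ᵒᵖ Ab.{u}).obj (op U)) := ⟨inferInstance⟩
  comp_preservesLimits (toPresheaf X) _

instance (U : X.Opens) : (sectionsFunctor U).PreservesZeroMorphisms where
  map_zero _ _ := rfl

theorem app_injective {M N : X.Modules} (φ : M ⟶ N) [Mono φ] (U : X.Opens) :
    Function.Injective (φ.app U) :=
  (AddCommGrpCat.mono_iff_injective ((sectionsFunctor U).map φ)).1 inferInstance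

theorem exists_app_eq_of_exact {S : ShortComplex X.Modules} (hS : S.Exact) [Mono S.f]
    {U : X.Opens} (s : Γ(S.X₂, U)) (hs : S.g.app U s = 0) : ∃ t, S.f.app U t = s :=
  (ShortComplex.ab_exact_iff _).1
    (hS.map_of_mono_of_preservesKernel (sectionsFunctor U) inferInstance inferInstance) s hs

theorem app_map {M N : X.Modules} (φ : M ⟶ N) {U V : X.Opens} (i : V ⟶ U) (s : Γ(M, U)) :
    N.presheaf.map i.op (φ.app U s) = φ.app V (M.presheaf.map i.op s) :=
  (ConcreteCategory.congr_hom (φ.mapPresheaf.naturality i.op) s).symm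

theorem IsLocalizingOn.of_exact {S : ShortComplex X.Modules} (hS : S.Exact) [Mono S.f]
    {U : X.Opens} (h2 : IsLocalizingOn S.X₂ U) (h3 : IsLocalizingOn S.X₃ U) :
    IsLocalizingOn S.X₁ U where
  exists_eq f s := by
    obtain ⟨n, t, ht⟩ := h2.exists_eq f (S.f.app _ s)
    have hfg : ∀ V (s : Γ(S.X₁, V)), S.g.app V (S.f.app V s) = 0 := fun V s => by
      have : (S.f ≫ S.g).app V s = 0 := by rw [S.zero]; rfl
      exact this
    obtain ⟨m, hm⟩ := h3.exists_zero f (S.g.app _ t) (by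
      rw [app_map, ht, Hom.app_smul, hfg, smul_zero])
    obtain ⟨k, hk⟩ := exists_app_eq_of_exact hS (f ^ m • t) (by rw [Hom.app_smul, hm])
    refine ⟨m + n, k, app_injective S.f _ ?_⟩
    rw [← app_map, hk, map_smul, ht, Hom.app_smul, smul_smul, ← map_mul, pow_add]
  exists_zero f t ht := by
    obtain ⟨n, hn⟩ := h2.exists_zero f (S.f.app _ t) (by rw [app_map, ht, map_zero])
    exact ⟨n, app_injective S.f _ (by rw [Hom.app_smul, hn, map_zero])⟩

theorem isIso_fromTildeΓ_cokernel {R : CommRingCat.{u}} {M N : (Spec R).Modules} (φ : M ⟶ N)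
    (h1 : IsIso M.fromTildeΓ) (h2 : IsIso N.fromTildeΓ) : IsIso (cokernel φ).fromTildeΓ := by
  rw [isIso_fromTildeΓ_iff] at h1 h2 ⊢
  obtain ⟨A, ⟨a⟩⟩ := h1
  obtain ⟨B, ⟨b⟩⟩ := h2
  let g := (tilde.functor R).preimage (a.hom ≫ φ ≫ b.inv)
  refine ⟨cokernel g, ⟨PreservesCokernel.iso (tilde.functor R) g ≪≫ cokernel.mapIso _ _ a b ?_⟩⟩
  simp only [g, Functor.map_preimage]
  simp

theorem app_top_surjective {R : CommRingCat.{u}} {M N : (Spec R).Modules} (φ : M ⟶ N) [Epi φ]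
    (h1 : SheafOfModules.IsQuasicoherent (R := (Spec R).ringCatSheaf) M)
    (h2 : SheafOfModules.IsQuasicoherent (R := (Spec R).ringCatSheaf) N) :
    Function.Surjective (φ.app ⊤) := by
  let M' : (SheafOfModules.isQuasicoherent (Spec R).ringCatSheaf).FullSubcategory := ⟨M, h1⟩
  let N' : (SheafOfModules.isQuasicoherent (Spec R).ringCatSheaf).FullSubcategory := ⟨N, h2⟩
  let p : M' ⟶ N' := ObjectProperty.homMk φ
  have : Epi p := (ObjectProperty.ι _).epi_of_epi_map (f := p) (by assumption)
  have h := (ModuleCat.epi_iff_surjective (tildeEquiv.inverse.map p)).1 inferInstance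
  exact h

theorem isLocalizingOn_cokernel {M N : X.Modules} (φ : M ⟶ N) {U : X.Opens} (hU : IsAffineOpen U)
    (h1 : IsLocalizingOn M U) (h2 : IsLocalizingOn N U) : IsLocalizingOn (cokernel φ) U := by
  rw [← isLocalizingOn_iff _ hU, ← isIso_fromTildeΓ_iff_isLocalizing] at h1 h2 ⊢
  have := isIso_fromTildeΓ_cokernel ((restrictFunctor hU.fromSpec).map φ) h1 h2
  rw [isIso_fromTildeΓ_iff] at this ⊢
  exact (tilde.functor _).essImage.prop_of_iso
    (PreservesCokernel.iso (restrictFunctor hU.fromSpec) φ).symm this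

theorem app_surjective {M N : X.Modules} (φ : M ⟶ N) [Epi φ] {U : X.Opens} (hU : IsAffineOpen U)
    (h1 : IsLocalizingOn M U) (h2 : IsLocalizingOn N U) : Function.Surjective (φ.app U) := by
  rw [← isQuasicoherent_restrict_iff _ hU] at h1 h2
  have := app_top_surjective ((restrictFunctor hU.fromSpec).map φ) h1 h2
  have h3 : Function.Surjective (φ.app (hU.fromSpec ''ᵁ ⊤)) := this
  rwa [Scheme.Hom.image_top_eq_opensRange, hU.opensRange_fromSpec] at h3

/-- Quasi-coherence, as a property of the sections over affine open sets. -/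
def IsQCoh (M : X.Modules) : Prop := ∀ U : X.Opens, IsAffineOpen U → IsLocalizingOn M U

theorem IsCoherent.isQCoh {M : X.Modules} (h : IsCoherent M) : IsQCoh M := fun _ hU =>
  isLocalizingOn_of_isQuasicoherent M h.1 hU

theorem IsQCoh.isQuasicoherent {M : X.Modules} (h : IsQCoh M) :
    SheafOfModules.IsQuasicoherent (R := X.ringCatSheaf) M :=
  isQuasicoherent_of_isLocalizingOn M (fun i : X.affineOpens => i.1) (fun i => i.2)
    (iSup_affineOpens_eq_top X) fun i => h i.1 i.2

theorem IsQCoh.isCoherent_of_mono [IsLocallyNoetherian X] {M N : X.Modules} (hM : IsQCoh M)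
    (φ : M ⟶ N) [Mono φ] (hN : IsCoherent N) : IsCoherent M where
  quasicoherent := hM.isQuasicoherent
  finite U hU := by
    have := hN.finite U hU
    have : IsNoetherianRing Γ(X, U) := IsLocallyNoetherian.component_noetherian ⟨U, hU⟩
    let l : Γ(M, U) →ₗ[Γ(X, U)] Γ(N, U) := ⟨⟨φ.app U, map_add _⟩, fun r x => Hom.app_smul _ _ _⟩
    exact Module.Finite.of_injective l (app_injective φ U)

theorem IsQCoh.isCoherent_of_epi {M N : X.Modules} (hN : IsQCoh N) (φ : M ⟶ N) [Epi φ]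
    (hM : IsCoherent M) : IsCoherent N where
  quasicoherent := hN.isQuasicoherent
  finite U hU := by
    have := hM.finite U hU
    let l : Γ(M, U) →ₗ[Γ(X, U)] Γ(N, U) := ⟨⟨φ.app U, map_add _⟩, fun r x => Hom.app_smul _ _ _⟩
    exact Module.Finite.of_surjective l (app_surjective φ hU (hM.isQCoh U hU) (hN U hU))

theorem IsQCoh.kernel {M N : X.Modules} (φ : M ⟶ N) (hM : IsQCoh M) (hN : IsQCoh N) :
    IsQCoh (kernel φ) := fun U hU =>
  IsLocalizingOn.of_exact (S := ShortComplex.mk (kernel.ι φ) φ (by simp))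
    (ShortComplex.exact_kernel φ) (hM U hU) (hN U hU)

theorem IsQCoh.cokernel {M N : X.Modules} (φ : M ⟶ N) (hM : IsQCoh M) (hN : IsQCoh N) :
    IsQCoh (cokernel φ) := fun U hU =>
  isLocalizingOn_cokernel φ hU (hM U hU) (hN U hU)

theorem IsQCoh.of_iso {M N : X.Modules} (e : M ≅ N) (hM : IsQCoh M) : IsQCoh N := fun _ hU =>
  isLocalizingOn_of_isQuasicoherent N
    ((SheafOfModules.isQuasicoherent X.ringCatSheaf).prop_of_iso e hM.isQuasicoherent) hU

theorem IsCoherent.kernel [IsLocallyNoetherian X] {M N : X.Modules} (φ : M ⟶ N) (hM : IsCoherent M)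
    (hN : IsQCoh N) : IsCoherent (kernel φ) :=
  IsQCoh.isCoherent_of_mono (hM.isQCoh.kernel φ hN) (kernel.ι φ) hM

theorem IsCoherent.cokernel {M N : X.Modules} (φ : M ⟶ N) (hM : IsQCoh M) (hN : IsCoherent N) :
    IsCoherent (cokernel φ) :=
  IsQCoh.isCoherent_of_epi (hM.cokernel φ hN.isQCoh) (cokernel.π φ) hN

theorem IsCoherent.of_iso {M N : X.Modules} (e : M ≅ N) (hM : IsCoherent M) : IsCoherent N :=
  IsQCoh.isCoherent_of_epi (hM.isQCoh.of_iso e) e.hom hM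

end

section

theorem isDiscreteValuationRing_of_etale {A S : Type*} [CommRing A] [IsDomain A]
    [IsPrincipalIdealRing A] [IsJacobsonRing A] (hA : ¬ IsField A) [CommRing S] [IsDomain S]
    [Algebra A S] [Algebra.Etale A S] (q : Ideal S) [hq : q.IsMaximal] :
    IsDiscreteValuationRing (Localization.AtPrime q) := by
  have hft : Algebra.FiniteType A (S ⧸ q) :=
    .of_surjective (Ideal.Quotient.mkₐ A q) (Ideal.Quotient.mkₐ_surjective A q)
  let _ := Ideal.Quotient.field q
  have hfin := finite_of_finite_type_of_isJacobsonRing A (S ⧸ q)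
  let p := q.under A
  have hp : p.IsMaximal := by
    have h := Ideal.isMaximal_comap_of_isIntegral_of_isMaximal (R := A) (⊥ : Ideal (S ⧸ q))
    rwa [← RingHom.ker_eq_comap_bot, IsScalarTower.algebraMap_eq A S (S ⧸ q), ← RingHom.comap_ker,
      Ideal.Quotient.algebraMap_eq, Ideal.mk_ker] at h
  have hp0 : p ≠ ⊥ := Ring.ne_bot_of_isMaximal_of_not_isField hp hA
  obtain ⟨π, hπ⟩ := (IsPrincipalIdealRing.principal p).principal
  have hπ0 : π ≠ 0 := by rintro rfl; apply hp0; rw [hπ]; simp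
  have : IsNoetherianRing S := Algebra.FiniteType.isNoetherianRing A S
  have : IsNoetherianRing (Localization.AtPrime q) :=
    IsLocalization.isNoetherianRing q.primeCompl _ inferInstance
  have hmax : p.map (algebraMap A (Localization.AtPrime q)) = IsLocalRing.maximalIdeal _ := by
    have : q.LiesOver p := ⟨rfl⟩
    let _ := (Localization.localRingHom p q (algebraMap A S) rfl).toAlgebra
    have : Localization.AtPrime.IsLiesOverAlgebra p q := ⟨rfl⟩
    exact ((Algebra.isUnramifiedAt_iff_map_eq A p q).1 inferInstance).2
  have hinj : Function.Injective (algebraMap A (Localization.AtPrime q)) := by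
    rw [IsScalarTower.algebraMap_eq A S]
    exact (IsLocalization.injective _ q.primeCompl_le_nonZeroDivisors).comp
      (FaithfulSMul.algebraMap_injective A S)
  have hpr : IsLocalRing.maximalIdeal (Localization.AtPrime q) =
      Ideal.span {algebraMap A (Localization.AtPrime q) π} := by
    rw [← hmax, hπ, Ideal.submodule_span_eq, Ideal.map_span, Set.image_singleton]
  have hnf : ¬ IsField (Localization.AtPrime q) := by
    rw [IsLocalRing.isField_iff_maximalIdeal_eq, hpr, Ideal.span_singleton_eq_bot]
    exact fun h => hπ0 (hinj (by rw [h, map_zero]))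
  exact ((IsDiscreteValuationRing.TFAE _ hnf).out 0 4 rfl rfl).2 ⟨⟨_, hpr⟩⟩

theorem isDiscreteValuationRing_of_isStandardSmooth {R S : Type*} [CommRing R] [CommRing S]
    [IsDomain S]
    (hR : IsField R) {f : R →+* S} (hf : f.IsStandardSmoothOfRelativeDimension 1)
    (q : Ideal S) [q.IsMaximal] : IsDiscreteValuationRing (Localization.AtPrime q) := by
  let _ := hR.toField
  obtain ⟨g, -, hg⟩ := hf.exists_etale_mvPolynomial
  algebraize [g]
  have : IsPrincipalIdealRing (MvPolynomial (Fin 1) R) :=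
    .of_surjective (MvPolynomial.uniqueAlgEquiv R (Fin 1)).symm.toRingEquiv.toRingHom
      (MvPolynomial.uniqueAlgEquiv R (Fin 1)).symm.surjective
  refine isDiscreteValuationRing_of_etale (A := MvPolynomial (Fin 1) R) ?_ q
  intro h
  have := (MvPolynomial.uniqueAlgEquiv R (Fin 1)).symm.toMulEquiv.isField h
  exact Polynomial.not_isField R this

section
variable [IsIntegral X] {k : Type u} [Field k] (f : X ⟶ Spec (.of k))

theorem isDiscreteValuationRing_stalk [SmoothOfRelativeDimension 1 f] {x : X} (hx : IsClosed {x}) :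
    IsDiscreteValuationRing (X.presheaf.stalk x) := by
  obtain ⟨U, hU, V, hV, hxV, e, hf⟩ :=
    SmoothOfRelativeDimension.exists_isStandardSmoothOfRelativeDimension (n := 1) (f := f) x
  have hU' : U = ⊤ := by
    ext y
    simp only [TopologicalSpace.Opens.coe_top, Set.mem_univ, iff_true]
    rw [Subsingleton.elim y (f x)]
    exact e hxV
  subst hU'
  have hF : IsField Γ(Spec (.of k), ⊤) :=
    (Scheme.ΓSpecIso (.of k)).commRingCatIsoToRingEquiv.toMulEquiv.isField (Field.toIsField k)
  have : Nonempty V := ⟨⟨x, hxV⟩⟩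
  obtain ⟨x, rfl⟩ : ∃ y : V, y.1 = x := ⟨⟨x, hxV⟩, rfl⟩
  have := hV.primeIdealOf_isMaximal_of_isClosed x hx
  have h1 := isDiscreteValuationRing_of_isStandardSmooth hF hf (hV.primeIdealOf x).asIdeal
  have := hV.isLocalization_stalk x
  exact IsDiscreteValuationRing.RingEquivClass.isDiscreteValuationRing
    (IsLocalization.algEquiv (hV.primeIdealOf x).asIdeal.primeCompl
      (Localization.AtPrime (hV.primeIdealOf x).asIdeal) (X.presheaf.stalk x))

variable (X) in
/-- The properties of smooth curves that enter below. -/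
class IsRegularCurve : Prop where
  isLocallyNoetherian : IsLocallyNoetherian X
  compactSpace : CompactSpace X
  dvr (x : X) (hx : IsClosed {x}) : IsDiscreteValuationRing (X.presheaf.stalk x)
  eq_genericPoint (x : X) (hx : ¬ IsClosed {x}) : x = genericPoint X

attribute [instance] IsRegularCurve.isLocallyNoetherian IsRegularCurve.compactSpace

theorem isRegularCurve [SmoothOfRelativeDimension 1 f] [IsProper f] : IsRegularCurve X where
  isLocallyNoetherian := LocallyOfFiniteType.isLocallyNoetherian f
  compactSpace := (quasiCompact_iff_compactSpace (f := f)).1 inferInstance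
  dvr x hx := isDiscreteValuationRing_stalk f hx
  eq_genericPoint x hx := by
    have := LocallyOfFiniteType.jacobsonSpace f
    obtain ⟨y, hyx, hy⟩ := nonempty_inter_closedPoints (Z := closure {x}) ⟨x, subset_closure rfl⟩
      isClosed_closure.isLocallyClosed
    have hxy : x ⤳ y := specializes_iff_mem_closure.2 hyx
    have hdvr := isDiscreteValuationRing_stalk f hy
    have h1 : x ∈ Set.range (X.fromSpecStalk y) := by rwa [Scheme.range_fromSpecStalk]
    have h2 : genericPoint X ∈ Set.range (X.fromSpecStalk y) := by
      rw [Scheme.range_fromSpecStalk]; exact (genericPoint_spec X).specializes trivial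
    have h0 (p : Spec (X.presheaf.stalk y)) (hp : X.fromSpecStalk y p ≠ y) : p.asIdeal = ⊥ := by
      by_contra h
      have := IsPrime.to_maximal_ideal (hpi := p.isPrime) h
      have := IsLocalRing.eq_maximalIdeal this
      have : p = IsLocalRing.closedPoint _ := PrimeSpectrum.ext this
      exact hp (by rw [this, Scheme.fromSpecStalk_closedPoint])
    obtain ⟨p, rfl⟩ := h1
    obtain ⟨q, hq⟩ := h2
    rw [← hq]
    congr 1
    apply PrimeSpectrum.ext
    rw [h0, h0]
    · rw [hq]
      rintro rfl
      exact IsDiscreteValuationRing.not_isField _ (Field.toIsField X.functionField)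
    · intro h
      exact hx (by rw [h]; exact hy)

end

end

section

open Scheme.Modules

section Stalks

/-- The germ at `x` of a section of `M`. -/
def germ (M : X.Modules) {U : X.Opens} {x : X} (hx : x ∈ U) : Γ(M, U) →+ stalk M x :=
  (TopCat.Presheaf.germ (C := Ab.{u}) M.presheaf U x hx).hom

theorem germ_res (M : X.Modules) {U V : X.Opens} (i : V ⟶ U) {x : X} (hx : x ∈ V) (s : Γ(M, U)) :
    germ M hx (M.presheaf.map i.op s) = germ M (i.le hx) s :=
  TopCat.Presheaf.germ_res_apply (C := Ab.{u}) M.presheaf i x hx s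

theorem germ_smul (M : X.Modules) {U : X.Opens} {x : X} (hx : x ∈ U) (r : Γ(X, U)) (s : Γ(M, U)) :
    germ M hx (r • s) = X.presheaf.germ U x hx r • germ M hx s :=
  PresheafOfModules.germ_smul (R := X.presheaf) M.val x U hx r s

theorem exists_germ_eq (M : X.Modules) {x : X} (m : stalk M x) :
    ∃ (U : X.Opens) (hx : x ∈ U) (s : Γ(M, U)), germ M hx s = m :=
  TopCat.Presheaf.exists_germ_eq (C := Ab.{u}) M.presheaf m

theorem exists_res_eq_zero (M : X.Modules) {U : X.Opens} {x : X} (hx : x ∈ U) (s : Γ(M, U))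
    (h : germ M hx s = 0) : ∃ (V : X.Opens) (i : V ⟶ U), x ∈ V ∧ M.presheaf.map i.op s = 0 := by
  obtain ⟨W, hW, i, j, hij⟩ := TopCat.Presheaf.germ_eq (C := Ab.{u}) M.presheaf x hx hx s 0
    (h.trans (map_zero (germ M hx)).symm)
  exact ⟨W, i, hW, hij.trans (map_zero _)⟩

theorem isUnit_germ {U : X.Opens} {x : X} (hx : x ∈ U) {f : Γ(X, U)} (hf : x ∈ X.basicOpen f) :
    IsUnit (X.presheaf.germ U x hx f) :=
  (X.mem_basicOpen f x hx).1 hf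

theorem IsLocalizingOn.exists_smul_eq_germ {M : X.Modules} {U : X.Opens} (hM : IsLocalizingOn M U)
    (hU : IsAffineOpen U) {x : X} (hx : x ∈ U) (m : stalk M x) :
    ∃ f : Γ(X, U), x ∈ X.basicOpen f ∧ ∃ t : Γ(M, U),
      X.presheaf.germ U x hx f • m = germ M hx t := by
  obtain ⟨W, hW, s, rfl⟩ := exists_germ_eq M m
  obtain ⟨f, hfW, hf⟩ := hU.exists_basicOpen_le ⟨x, hW⟩ hx
  obtain ⟨n, t, ht⟩ := hM.exists_eq f (M.presheaf.map (homOfLE hfW).op s)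
  refine ⟨f ^ n, (X.mem_basicOpen _ x hx).2 ?_, t, ?_⟩
  · rw [map_pow]
    exact (isUnit_germ hx hf).pow n
  · rw [← germ_res M (homOfLE (X.basicOpen_le f)) hf, ht, germ_smul, germ_res,
      X.presheaf.germ_res_apply]

theorem IsLocalizingOn.exists_smul_eq_zero {M : X.Modules} {U : X.Opens} (hM : IsLocalizingOn M U)
    (hU : IsAffineOpen U) {x : X} (hx : x ∈ U) (t : Γ(M, U)) (ht : germ M hx t = 0) :
    ∃ f : Γ(X, U), x ∈ X.basicOpen f ∧ f • t = 0 := by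
  obtain ⟨W, i, hW, h0⟩ := exists_res_eq_zero M hx t ht
  obtain ⟨f, hfW, hf⟩ := hU.exists_basicOpen_le ⟨x, hW⟩ hx
  obtain ⟨n, hn⟩ := hM.exists_zero f t (by
    rw [← Subsingleton.elim (homOfLE hfW ≫ i) (homOfLE (X.basicOpen_le f)), op_comp,
      Functor.map_comp_apply, h0, map_zero])
  refine ⟨f ^ n, (X.mem_basicOpen _ x hx).2 ?_, hn⟩
  rw [map_pow]
  exact (isUnit_germ hx hf).pow n

theorem exists_isAffineOpen_mem_le {x : X} {W : X.Opens} (hx : x ∈ W) :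
    ∃ U : X.Opens, IsAffineOpen U ∧ x ∈ U ∧ U ≤ W := by
  obtain ⟨_, ⟨U, hU, rfl⟩, hxU, hUW⟩ := X.isBasis_affineOpens.exists_subset_of_mem_open hx W.isOpen
  exact ⟨U, hU, hxU, hUW⟩

theorem IsCoherent.span_germ_eq_top {M : X.Modules} (hM : IsCoherent M) {U : X.Opens}
    (hU : IsAffineOpen U) {x : X} (hx : x ∈ U) {S : Set Γ(M, U)}
    (hS : Submodule.span Γ(X, U) S = ⊤) :
    Submodule.span (X.presheaf.stalk x) (germ M hx '' S) = ⊤ := by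
  refine eq_top_iff.2 fun m _ => ?_
  obtain ⟨f, hf, t, ht⟩ := (hM.isQCoh U hU).exists_smul_eq_germ hU hx m
  have key (t : Γ(M, U)) :
      germ M hx t ∈ Submodule.span (X.presheaf.stalk x) (germ M hx '' S) := by
    have : t ∈ Submodule.span Γ(X, U) S := hS ▸ trivial
    induction this using Submodule.span_induction with
    | mem t ht => exact Submodule.subset_span ⟨t, ht, rfl⟩
    | zero => rw [map_zero]; exact zero_mem _
    | add a b _ _ ha hb => rw [map_add]; exact add_mem ha hb
    | smul r a _ ha => rw [germ_smul]; exact Submodule.smul_mem _ _ ha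
  rw [← (Submodule.smul_mem_iff_of_isUnit _ (isUnit_germ hx hf)), ht]
  exact key t

theorem IsCoherent.finite_stalk {M : X.Modules} (hM : IsCoherent M) (x : X) :
    Module.Finite (X.presheaf.stalk x) (stalk M x) := by
  obtain ⟨U, hU, hx, -⟩ := exists_isAffineOpen_mem_le (W := ⊤) (x := x) trivial
  obtain ⟨S, hS⟩ := hM.finite U hU
  classical
  exact ⟨⟨S.image (germ M hx), by rw [Finset.coe_image]; exact hM.span_germ_eq_top hU hx hS⟩⟩

/-- The map on stalks induced by a morphism of `𝒪_X`-modules. -/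
def stalkMap {M N : X.Modules} (φ : M ⟶ N) (x : X) :
    stalk M x →ₗ[X.presheaf.stalk x] stalk N x where
  toFun := ((TopCat.Presheaf.stalkFunctor Ab.{u} x).map φ.mapPresheaf).hom
  map_add' := map_add _
  map_smul' r m := by
    obtain ⟨U, hx, s, rfl⟩ := exists_germ_eq M m
    obtain ⟨V, hV, r, rfl⟩ := X.presheaf.exists_germ_eq r
    have hW : x ∈ U ⊓ V := ⟨hx, hV⟩
    have key {W : X.Opens} (hW : x ∈ W) (s : Γ(M, W)) :
        ((TopCat.Presheaf.stalkFunctor Ab.{u} x).map φ.mapPresheaf).hom (germ M hW s) =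
          germ N hW (φ.app W s) :=
      TopCat.Presheaf.stalkFunctor_map_germ_apply (C := Ab.{u}) W x hW φ.mapPresheaf s
    rw [← germ_res M (Opens.infLELeft U V) hW, ← X.presheaf.germ_res_apply (Opens.infLERight U V) x
      hW,
      ← germ_smul, key, key, Hom.app_smul, germ_smul]
    rfl

theorem stalkMap_germ {M N : X.Modules} (φ : M ⟶ N) {U : X.Opens} {x : X} (hx : x ∈ U)
    (s : Γ(M, U)) :
    stalkMap φ x (germ M hx s) = germ N hx (φ.app U s) :=
  TopCat.Presheaf.stalkFunctor_map_germ_apply (C := Ab.{u}) U x hx φ.mapPresheaf s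

theorem stalkMap_comp {M N L : X.Modules} (φ : M ⟶ N) (ψ : N ⟶ L) (x : X) (m : stalk M x) :
    stalkMap (φ ≫ ψ) x m = stalkMap ψ x (stalkMap φ x m) := by
  obtain ⟨U, hx, s, rfl⟩ := exists_germ_eq M m
  simp only [stalkMap_germ]
  rfl

theorem stalkMap_injective {M N : X.Modules} (φ : M ⟶ N) [Mono φ] (x : X) :
    Function.Injective (stalkMap φ x) := by
  refine (injective_iff_map_eq_zero _).2 fun m hm => ?_
  obtain ⟨U, hx, s, rfl⟩ := exists_germ_eq M m
  rw [stalkMap_germ] at hm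
  obtain ⟨V, i, hV, h⟩ := exists_res_eq_zero N hx _ hm
  rw [app_map] at h
  rw [← germ_res M i hV, app_injective φ V (h.trans (map_zero _).symm), map_zero]

theorem stalkMap_surjective {M N : X.Modules} (φ : M ⟶ N) [Epi φ] (hM : IsQCoh M) (hN : IsQCoh N)
    (x : X) : Function.Surjective (stalkMap φ x) := by
  intro n
  obtain ⟨W, hW, s, rfl⟩ := exists_germ_eq N n
  obtain ⟨U, hU, hx, hUW⟩ := exists_isAffineOpen_mem_le hW
  obtain ⟨t, ht⟩ := app_surjective φ hU (hM U hU) (hN U hU) (N.presheaf.map (homOfLE hUW).op s)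
  exact ⟨germ M hx t, by rw [stalkMap_germ, ht, germ_res]⟩

theorem stalkMap_exact {S : ShortComplex X.Modules} (hS : S.ShortExact) (x : X) :
    Function.Exact (stalkMap S.f x) (stalkMap S.g x) := by
  have := hS.mono_f
  intro m
  constructor
  · intro hm
    obtain ⟨U, hx, s, rfl⟩ := exists_germ_eq _ m
    rw [stalkMap_germ] at hm
    obtain ⟨V, i, hV, h⟩ := exists_res_eq_zero _ hx _ hm
    rw [app_map] at h
    obtain ⟨t, ht⟩ := exists_app_eq_of_exact hS.exact _ h
    exact ⟨germ _ hV t, by rw [stalkMap_germ, ht, germ_res]⟩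
  · rintro ⟨a, rfl⟩
    rw [← stalkMap_comp, S.zero]
    obtain ⟨U, hx, s, rfl⟩ := exists_germ_eq _ a
    rw [stalkMap_germ]
    exact map_zero (germ _ hx)

end Stalks

section Generic

variable [IsIntegral X]

theorem genericPoint_mem {U : X.Opens} {x : X} (hx : x ∈ U) : genericPoint X ∈ U :=
  ((genericPoint_spec X).mem_open_set_iff U.isOpen).2 ⟨x, trivial, hx⟩

theorem algebraMap_germ {U : X.Opens} {x : X} (hx : x ∈ U) (r : Γ(X, U)) :
    algebraMap (X.presheaf.stalk x) X.functionField (X.presheaf.germ U x hx r) =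
      X.presheaf.germ U (genericPoint X) (genericPoint_mem hx) r := by
  have : Nonempty U := ⟨⟨x, hx⟩⟩
  exact Scheme.algebraMap_germ_eq_germToFunctionField X hx r

theorem toGenericStalk_germ (M : X.Modules) {U : X.Opens} {x : X} (hx : x ∈ U) (s : Γ(M, U)) :
    toGenericStalk M x (germ M hx s) = germ M (genericPoint_mem hx) s :=
  TopCat.Presheaf.germ_stalkSpecializes_apply (C := Ab.{u}) M.presheaf hx _ s

theorem toGenericStalk_add (M : X.Modules) (x : X) (m n : stalk M x) :
    toGenericStalk M x (m + n) = toGenericStalk M x m + toGenericStalk M x n :=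
  map_add _ m n

theorem toGenericStalk_smul (M : X.Modules) (x : X) (r : X.presheaf.stalk x) (m : stalk M x) :
    toGenericStalk M x (r • m) =
      algebraMap (X.presheaf.stalk x) X.functionField r • toGenericStalk M x m := by
  obtain ⟨U, hx, s, rfl⟩ := exists_germ_eq M m
  obtain ⟨V, hV, r, rfl⟩ := X.presheaf.exists_germ_eq r
  have hW : x ∈ U ⊓ V := ⟨hx, hV⟩
  rw [← germ_res M (Opens.infLELeft U V) hW, ← X.presheaf.germ_res_apply (Opens.infLERight U V) x
    hW,
    ← germ_smul, toGenericStalk_germ, toGenericStalk_germ, germ_smul, algebraMap_germ]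

/-- `toGenericStalk` as a linear map. -/
def toGenericLinear (M : X.Modules) (x : X) :
    letI := genericStalkModule M x
    stalk M x →ₗ[X.presheaf.stalk x] genericStalk M :=
  letI := genericStalkModule M x
  { toFun := toGenericStalk M x
    map_add' := toGenericStalk_add M x
    map_smul' := toGenericStalk_smul M x }

theorem toGenericStalk_stalkMap {M N : X.Modules} (φ : M ⟶ N) (x : X) (m : stalk M x) :
    toGenericStalk N x (stalkMap φ x m) = stalkMap φ (genericPoint X) (toGenericStalk M x m) := by
  obtain ⟨U, hx, s, rfl⟩ := exists_germ_eq M m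
  rw [stalkMap_germ, toGenericStalk_germ, toGenericStalk_germ, stalkMap_germ]

theorem IsQCoh.exists_smul_eq_toGenericStalk {M : X.Modules} (hM : IsQCoh M) (x : X)
    (v : genericStalk M) : ∃ r : X.presheaf.stalk x, r ≠ 0 ∧ ∃ m : stalk M x,
      algebraMap (X.presheaf.stalk x) X.functionField r • v = toGenericStalk M x m := by
  obtain ⟨U, hU, hx, -⟩ := exists_isAffineOpen_mem_le (W := ⊤) (x := x) trivial
  have : Nonempty U := ⟨⟨x, hx⟩⟩
  obtain ⟨f, hf, t, ht⟩ := (hM U hU).exists_smul_eq_germ hU (genericPoint_mem hx) v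
  refine ⟨X.presheaf.germ U x hx f, fun h => ?_, germ M hx t, ?_⟩
  · rw [(injective_iff_map_eq_zero _).1 (germ_injective_of_isIntegral X x hx) f h] at hf
    simpa using isUnit_germ (genericPoint_mem hx) hf
  · rw [toGenericStalk_germ, ← ht, algebraMap_germ]

theorem IsQCoh.exists_smul_eq_zero {M : X.Modules} (hM : IsQCoh M) (x : X)
    (m : stalk M x) (hm : toGenericStalk M x m = 0) :
    ∃ r : X.presheaf.stalk x, r ≠ 0 ∧ r • m = 0 := by
  obtain ⟨W, hW, s, rfl⟩ := exists_germ_eq M m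
  obtain ⟨U, hU, hx, hUW⟩ := exists_isAffineOpen_mem_le hW
  rw [← germ_res M (homOfLE hUW) hx, toGenericStalk_germ] at hm
  obtain ⟨f, hf, h0⟩ := (hM U hU).exists_smul_eq_zero hU _ _ hm
  refine ⟨X.presheaf.germ U x hx f, fun h => ?_, ?_⟩
  · rw [(injective_iff_map_eq_zero _).1 (germ_injective_of_isIntegral X x hx) f h] at hf
    simpa using isUnit_germ (genericPoint_mem hx) hf
  · rw [← germ_res M (homOfLE hUW) hx, ← germ_smul, h0, map_zero]

end Generic

end

section

section Lattice

variable {R : Type*} [CommRing R]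

variable (R) in
/-- The length of a module, as an integer (`0` if the length is infinite). -/
def len (N : Type*) [AddCommGroup N] [Module R N] : ℤ := ((Module.length R N).toNat : ℤ)

section Length

variable {A B C : Type*} [AddCommGroup A] [AddCommGroup B] [AddCommGroup C] [Module R A]
  [Module R B] [Module R C]

theorem len_eq_add_of_exact {f : A →ₗ[R] B} {g : B →ₗ[R] C} (hf : Function.Injective f)
    (hg : Function.Surjective g) (h : Function.Exact f g) (hB : Module.length R B ≠ ⊤) :
    len R B = len R A + len R C := by
  have := Module.length_eq_add_of_exact f g hf hg h
  rw [len, len, len, this, ENat.toNat_add]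
  · push_cast; rfl
  · exact fun h => hB (by rw [this, h, top_add])
  · exact fun h => hB (by rw [this, h, add_top])

theorem len_congr (e : A ≃ₗ[R] B) : len R A = len R B := by
  rw [len, len, e.length_eq]

theorem len_tower {P Q T : Submodule R A} (hPQ : P ≤ Q) (hQT : Q ≤ T)
    (hfin : Module.length R (T ⧸ P.submoduleOf T) ≠ ⊤) :
    len R (T ⧸ P.submoduleOf T) = len R (Q ⧸ P.submoduleOf Q) + len R (T ⧸ Q.submoduleOf T) := by
  have h1 : P.submoduleOf Q ≤ (P.submoduleOf T).comap (Submodule.inclusion hQT) := fun x hx => hx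
  have h2 : P.submoduleOf T ≤ Q.submoduleOf T := Submodule.comap_mono hPQ
  refine len_eq_add_of_exact (f := Submodule.mapQ _ _ _ h1) (g := Submodule.factor h2) ?_
    (Submodule.factor_surjective _) ?_ hfin
  · refine (injective_iff_map_eq_zero _).2 fun x hx => ?_
    obtain ⟨x, rfl⟩ := Submodule.Quotient.mk_surjective _ x
    exact (Submodule.Quotient.mk_eq_zero _).2
      ((Submodule.Quotient.mk_eq_zero (P.submoduleOf T)).1 hx)
  · intro x
    obtain ⟨x, rfl⟩ := Submodule.Quotient.mk_surjective _ x
    constructor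
    · intro hx
      exact ⟨Submodule.Quotient.mk ⟨x.1, (Submodule.Quotient.mk_eq_zero (Q.submoduleOf T)).1 hx⟩,
        rfl⟩
    · rintro ⟨y, hy⟩
      obtain ⟨y, rfl⟩ := Submodule.Quotient.mk_surjective _ y
      rw [← hy]
      exact (Submodule.Quotient.mk_eq_zero (Q.submoduleOf T)).2 y.2

theorem len_quotient_tower {P Q : Submodule R A} (hPQ : P ≤ Q)
    (hfin : Module.length R (A ⧸ P) ≠ ⊤) :
    len R (A ⧸ P) = len R (Q ⧸ P.submoduleOf Q) + len R (A ⧸ Q) := by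
  have h1 : P.submoduleOf Q ≤ P.comap Q.subtype := fun x hx => hx
  refine len_eq_add_of_exact (f := Submodule.mapQ _ _ _ h1) (g := Submodule.factor hPQ) ?_
    (Submodule.factor_surjective _) ?_ hfin
  · refine (injective_iff_map_eq_zero _).2 fun x hx => ?_
    obtain ⟨x, rfl⟩ := Submodule.Quotient.mk_surjective _ x
    exact (Submodule.Quotient.mk_eq_zero _).2 ((Submodule.Quotient.mk_eq_zero P).1 hx)
  · intro x
    obtain ⟨x, rfl⟩ := Submodule.Quotient.mk_surjective _ x
    constructor
    · intro hx
      exact ⟨Submodule.Quotient.mk ⟨x, (Submodule.Quotient.mk_eq_zero Q).1 hx⟩, rfl⟩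
    · rintro ⟨y, hy⟩
      obtain ⟨y, rfl⟩ := Submodule.Quotient.mk_surjective _ y
      rw [← hy]
      exact (Submodule.Quotient.mk_eq_zero Q).2 y.2

end Length

section RelIndex

variable {V : Type*} [AddCommGroup V] [Module R V]

theorem relIndex_eq {P Q T : Submodule R V} (hP : T ≤ P) (hQ : T ≤ Q)
    (hPT : Module.length R (P ⧸ T.submoduleOf P) ≠ ⊤)
    (hQT : Module.length R (Q ⧸ T.submoduleOf Q) ≠ ⊤) :
    relIndex P Q = len R (P ⧸ T.submoduleOf P) - len R (Q ⧸ T.submoduleOf Q) := by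
  have h1 := len_tower (le_inf hP hQ) inf_le_left hPT
  have h2 := len_tower (le_inf hP hQ) inf_le_right hQT
  have e1 : (P ⊓ Q).submoduleOf P = Q.submoduleOf P := by
    ext x; exact ⟨fun h => h.2, fun h => ⟨x.2, h⟩⟩
  have e2 : (P ⊓ Q).submoduleOf Q = P.submoduleOf Q := by
    ext x; exact ⟨fun h => h.1, fun h => ⟨h, x.2⟩⟩
  rw [e1] at h1
  rw [e2] at h2
  have : relIndex P Q = len R (P ⧸ Q.submoduleOf P) - len R (Q ⧸ P.submoduleOf Q) := rfl
  rw [this]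
  linarith

end RelIndex

section Free

variable {N κ : Type*} [AddCommGroup N] [Module R N] [Fintype κ]

theorem length_span_quotient_span_smul {e : κ → N} (he : LinearIndependent R e) (u : κ → R) :
    Module.length R (Submodule.span R (Set.range e) ⧸
      (Submodule.span R (Set.range fun i => u i • e i)).submoduleOf
        (Submodule.span R (Set.range e))) =
    ∑ i, Module.length R (R ⧸ Ideal.span {u i}) := by
  classical
  let B := Module.Basis.span he
  have hB (i) : (B i : N) = e i := congrArg Subtype.val (Module.Basis.span_apply he i)
  have hsum (c : κ → R) : (B.equivFun.symm c : N) = ∑ i, c i • e i := by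
    rw [Module.Basis.equivFun_symm_apply, AddSubmonoidClass.coe_finsetSum]
    simp only [Submodule.coe_smul, hB]
  rw [← Module.length_pi_of_fintype, ← (Submodule.quotientPi fun i => Ideal.span {u i}).length_eq]
  refine (Submodule.Quotient.equiv _ _ B.equivFun ?_).length_eq
  ext c
  simp only [Submodule.mem_map, Submodule.mem_pi, Set.mem_univ, forall_const]
  constructor
  · rintro ⟨x, hx, rfl⟩ i
    obtain ⟨c, hc⟩ := (Submodule.mem_span_range_iff_exists_fun R).1
      (show (x : N) ∈ Submodule.span R (Set.range fun i => u i • e i) from hx)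
    have : x = B.equivFun.symm fun i => c i * u i :=
      Subtype.ext (by rw [hsum, ← hc]; simp only [mul_smul])
    rw [this]
    change B.equivFun (B.equivFun.symm _) i ∈ _
    rw [LinearEquiv.apply_symm_apply]
    exact Ideal.mul_mem_left _ _ (Ideal.mem_span_singleton_self _)
  · intro hc
    choose y hy using fun i => Ideal.mem_span_singleton'.1 (hc i)
    refine ⟨B.equivFun.symm c, ?_, LinearEquiv.apply_symm_apply _ _⟩
    change (B.equivFun.symm c : N) ∈ Submodule.span R (Set.range fun i => u i • e i)
    rw [hsum]
    refine sum_mem fun i _ => ?_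
    rw [← hy i, mul_smul]
    exact Submodule.smul_mem _ _ (Submodule.subset_span ⟨i, rfl⟩)

end Free

variable [IsDomain R] [IsDiscreteValuationRing R]

theorem length_ne_top_of_isTorsion {N : Type*} [AddCommGroup N] [Module R N] [Module.Finite R N]
    (h : ∀ n : N, ∃ r : R, r ≠ 0 ∧ r • n = 0) : Module.length R N ≠ ⊤ := by
  obtain ⟨r, hr, hr0⟩ := Submodule.annihilator_top_inter_nonZeroDivisors (R := R) (M := N)
    (fun n => by
      obtain ⟨r, hr, h⟩ := h n
      exact ⟨⟨r, mem_nonZeroDivisors_of_ne_zero hr⟩, h⟩)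
  obtain ⟨n, g, hg⟩ := Module.Finite.exists_fin' R N
  have hfin : Module.length R (Fin n → R ⧸ Ideal.span {r}) ≠ ⊤ := by
    obtain ⟨_, _⟩ := isFiniteLength_iff_isNoetherian_isArtinian.1
      (isFiniteLength_quotient_span_singleton R hr0)
    exact Module.length_ne_top
  let q : (Fin n → R) →ₗ[R] (Fin n → R ⧸ Ideal.span {r}) :=
    LinearMap.pi fun i => (Ideal.span {r}).mkQ ∘ₗ LinearMap.proj i
  have hq : Function.Surjective q := fun x => by
    choose y hy using fun i => Submodule.mkQ_surjective _ (x i)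
    exact ⟨y, funext hy⟩
  have hker : LinearMap.ker q ≤ LinearMap.ker g := by
    intro x hx
    have hx (i) : ∃ y, x i = r * y := by
      have := congr_fun (LinearMap.mem_ker.1 hx) i
      exact Ideal.mem_span_singleton'.1 ((Submodule.Quotient.mk_eq_zero _).1 this) |>.imp
        fun y hy => (mul_comm r y).trans hy |>.symm
    choose y hy using hx
    have : x = r • y := funext hy
    rw [LinearMap.mem_ker, this, map_smul]
    exact Submodule.mem_annihilator.1 hr _ trivial
  let g' := (LinearMap.ker q).liftQ g hker ∘ₗ (q.quotKerEquivOfSurjective hq).symm.toLinearMap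
  have hg' : Function.Surjective g' := fun x => by
    obtain ⟨y, rfl⟩ := hg x
    refine ⟨q y, ?_⟩
    have : (q.quotKerEquivOfSurjective hq).symm (q y) = Submodule.Quotient.mk y := by
      rw [LinearEquiv.symm_apply_eq]; rfl
    simp [g', this]
  exact ne_top_of_le_ne_top hfin (Module.length_le_of_surjective g' hg')

theorem length_quotient_span_singleton_ne_top {r : R} (hr : r ≠ 0) :
    Module.length R (R ⧸ Ideal.span {r}) ≠ ⊤ :=
  Ring.ord_ne_top (mem_nonZeroDivisors_of_ne_zero hr)

section Free

variable {N κ : Type*} [AddCommGroup N] [Module R N] [Fintype κ]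

theorem len_span_quotient_span_smul {e : κ → N} (he : LinearIndependent R e) {u : κ → R}
    (hu : ∀ i, u i ≠ 0) :
    len R (Submodule.span R (Set.range e) ⧸
      (Submodule.span R (Set.range fun i => u i • e i)).submoduleOf
        (Submodule.span R (Set.range e))) =
    ∑ i, len R (R ⧸ Ideal.span {u i}) := by
  rw [len, length_span_quotient_span_smul he, ENat.toNat_sum fun i _ =>
    length_quotient_span_singleton_ne_top (hu i)]
  push_cast; rfl

end Free

section LatticeDegree

variable {K M V κ : Type*} [Field K] [Algebra R K] [AddCommGroup M] [Module R M]
  [AddCommGroup V] [Module R V] [Module K V]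

/-- The map `ι` from a module to a vector space over the fraction field is a localization map. -/
structure IsGenericFibre (ι : M →ₗ[R] V) : Prop where
  exists_smul_eq : ∀ v, ∃ r : R, r ≠ 0 ∧ ∃ m, ι m = r • v
  exists_smul_eq_zero : ∀ m, ι m = 0 → ∃ r : R, r ≠ 0 ∧ r • m = 0

/-- The degree of a module relative to a family of vectors in its generic fibre. -/
def latticeDegree (ι : M →ₗ[R] V) (b : κ → V) : ℤ :=
  len R (Submodule.torsion R M) + relIndex (LinearMap.range ι) (Submodule.span R (Set.range b))

theorem latticeDegree_congr {κ κ' : Type*} (ι : M →ₗ[R] V) {b : κ → V} {b' : κ' → V}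
    (h : Submodule.span R (Set.range b) = Submodule.span R (Set.range b')) :
    latticeDegree ι b = latticeDegree ι b' := by
  rw [latticeDegree, latticeDegree, h]

variable [IsFractionRing R K] [IsScalarTower R K V] [Fintype κ]
  {ι : M →ₗ[R] V} (hι : IsGenericFibre ι) (b : Module.Basis κ K V) {s : R} (hs : s ≠ 0)
  {m : κ → M} (hm : ∀ i, ι (m i) = s • b i)

include hs hm in
theorem linearIndependent_of_lift : LinearIndependent R m := by
  refine Fintype.linearIndependent_iff.2 fun c hc i => ?_
  have h : ∑ i, algebraMap R K (c i * s) • b i = 0 := by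
    rw [← map_zero ι, ← hc, map_sum]
    exact Finset.sum_congr rfl fun i _ => by
      rw [map_smul, hm, smul_smul, IsScalarTower.algebraMap_smul]
  have := Fintype.linearIndependent_iff.1 b.linearIndependent _ h i
  rw [FaithfulSMul.algebraMap_eq_zero_iff, mul_eq_zero] at this
  exact this.resolve_right hs

variable [Module.Finite R M]

include hι hs hm in
theorem length_quotient_span_ne_top :
    Module.length R (M ⧸ Submodule.span R (Set.range m)) ≠ ⊤ := by
  refine length_ne_top_of_isTorsion fun n => ?_
  obtain ⟨n, rfl⟩ := Submodule.Quotient.mk_surjective _ n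
  obtain ⟨⟨d, hd0⟩, hd⟩ := IsLocalization.exist_integer_multiples_of_finite (nonZeroDivisors R)
    fun i => b.repr (ι n) i
  choose a ha using hd
  have h : ι (∑ i, a i • m i) = ι ((s * d) • n) := by
    rw [map_sum, map_smul, mul_smul, ← b.sum_repr (ι n), Finset.smul_sum, Finset.smul_sum]
    refine Finset.sum_congr rfl fun i _ => ?_
    rw [map_smul, hm, smul_comm, ← algebraMap_smul K (a i), ha, smul_assoc]
  obtain ⟨r, hr, h0⟩ := hι.exists_smul_eq_zero ((s * d) • n - ∑ i, a i • m i) (by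
    rw [map_sub, h, sub_self])
  refine ⟨r * (s * d), mul_ne_zero hr (mul_ne_zero hs (nonZeroDivisors.ne_zero hd0)), ?_⟩
  rw [← Submodule.Quotient.mk_smul, Submodule.Quotient.mk_eq_zero, mul_smul,
    sub_eq_zero.1 ((smul_sub r _ _).symm.trans h0)]
  exact Submodule.smul_mem _ _ (sum_mem fun i _ =>
    Submodule.smul_mem _ _ (Submodule.subset_span ⟨i, rfl⟩))

include hι hs hm in
theorem latticeDegree_eq : latticeDegree ι b =
    len R (M ⧸ Submodule.span R (Set.range m)) - Fintype.card κ * len R (R ⧸ Ideal.span {s}) := by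
  have hfin := length_quotient_span_ne_top hι b hs hm
  have hb : LinearIndependent R b := linearIndependent_of_lift (ι := LinearMap.id) b
    (one_ne_zero (α := R)) fun i => (one_smul R (b i)).symm
  have hmap : (Submodule.span R (Set.range m)).map ι =
      Submodule.span R (Set.range fun i => s • b i) := by
    rw [Submodule.map_span, ← Set.range_comp]
    exact congrArg _ (congrArg _ (funext hm))
  set L := Submodule.span R (Set.range m) with hL
  have hP : Submodule.span R (Set.range fun i => s • b i) ≤ LinearMap.range ι := by
    rw [← hmap]; exact LinearMap.map_le_range
  have hQ : Submodule.span R (Set.range fun i => s • b i) ≤ Submodule.span R (Set.range b) := by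
    rw [Submodule.span_le]
    rintro _ ⟨i, rfl⟩
    exact Submodule.smul_mem _ _ (Submodule.subset_span ⟨i, rfl⟩)
  have hQT := length_span_quotient_span_smul hb fun _ => s
  have hle : L ≤ ((Submodule.span R (Set.range fun i => s • b i)).submoduleOf
      (LinearMap.range ι)).comap ι.rangeRestrict := fun x hx => by
    change ι x ∈ Submodule.span R (Set.range fun i => s • b i)
    rw [← hmap]
    exact ⟨x, hx, rfl⟩
  let g := L.mapQ _ _ hle
  have hg : Function.Surjective g := by
    intro y
    obtain ⟨⟨_, x, rfl⟩, rfl⟩ := Submodule.Quotient.mk_surjective _ y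
    exact ⟨Submodule.Quotient.mk x, rfl⟩
  have hseq : len R (M ⧸ L) = len R (Submodule.torsion R M) + len R (LinearMap.range ι ⧸
      (Submodule.span R (Set.range fun i => s • b i)).submoduleOf (LinearMap.range ι)) := by
    refine len_eq_add_of_exact (f := L.mkQ ∘ₗ (Submodule.torsion R M).subtype)
      (g := g) ?_ hg ?_ hfin
    · refine (injective_iff_map_eq_zero _).2 fun t ht => ?_
      have ht : (t : M) ∈ L := (Submodule.Quotient.mk_eq_zero _).1 ht
      obtain ⟨c, hc⟩ := (Submodule.mem_span_range_iff_exists_fun R).1 ht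
      obtain ⟨⟨r, hr⟩, h0⟩ := (Submodule.mem_torsion_iff _).1 t.2
      have : ∑ i, (r * c i) • m i = 0 := by
        simp only [mul_smul, ← Finset.smul_sum, hc]
        exact h0
      have := Fintype.linearIndependent_iff.1 (linearIndependent_of_lift b hs hm) _ this
      refine Subtype.ext ?_
      rw [← hc]
      exact Finset.sum_eq_zero fun i _ => by
        rw [(mul_eq_zero.1 (this i)).resolve_left (nonZeroDivisors.ne_zero hr), zero_smul]
    · intro y
      obtain ⟨y, rfl⟩ := Submodule.Quotient.mk_surjective _ y
      constructor
      · intro hy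
        have hy : ι y ∈ Submodule.span R (Set.range fun i => s • b i) :=
          (Submodule.Quotient.mk_eq_zero (Submodule.submoduleOf _ (LinearMap.range ι))).1 hy
        rw [← hmap] at hy
        obtain ⟨l, hl, hly⟩ := hy
        obtain ⟨r, hr, h0⟩ := hι.exists_smul_eq_zero (y - l) (by rw [map_sub, hly, sub_self])
        refine ⟨⟨y - l, (Submodule.mem_torsion_iff _).2
          ⟨⟨r, mem_nonZeroDivisors_of_ne_zero hr⟩, h0⟩⟩, ?_⟩
        refine (Submodule.Quotient.eq _).2 ?_
        simpa using hl
      · rintro ⟨t, ht⟩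
        rw [← ht]
        obtain ⟨⟨r, hr⟩, h0⟩ := (Submodule.mem_torsion_iff _).1 t.2
        have h0 : r • (t : M) = 0 := h0
        have : ι t = 0 := by
          have := congrArg ι h0
          rw [map_smul, map_zero, ← algebraMap_smul K, smul_eq_zero,
            FaithfulSMul.algebraMap_eq_zero_iff] at this
          exact this.resolve_left (nonZeroDivisors.ne_zero hr)
        refine (Submodule.Quotient.mk_eq_zero _).2 ?_
        change ι t ∈ Submodule.span R (Set.range fun i => s • b i)
        rw [this]
        exact zero_mem _
  have hQ' : len R (Submodule.span R (Set.range b) ⧸ (Submodule.span R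
      (Set.range fun i => s • b i)).submoduleOf (Submodule.span R (Set.range b))) =
      Fintype.card κ * len R (R ⧸ Ideal.span {s}) := by
    rw [len_span_quotient_span_smul hb fun _ => hs]
    simp
  rw [latticeDegree, relIndex_eq hP hQ, hseq, hQ']
  · ring
  · exact ne_top_of_le_ne_top hfin (Module.length_le_of_surjective g hg)
  · rw [hQT, ENat.sum_ne_top]
    exact fun i _ => length_quotient_span_singleton_ne_top hs

end LatticeDegree

end Lattice

end

section

section LatticeDegree

variable {R : Type*} [CommRing R] [IsDomain R] [IsDiscreteValuationRing R]
variable {K : Type*} [Field K] [Algebra R K] [IsFractionRing R K]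

variable (R) in
/-- The order of an element of the fraction field of a discrete valuation ring. -/
def ordK (a : K) : ℤ := WithZero.log (Ring.ordFrac R a)

theorem ordK_mul {a b : K} (ha : a ≠ 0) (hb : b ≠ 0) : ordK R (a * b) = ordK R a + ordK R b := by
  rw [ordK, map_mul, WithZero.log_mul ((map_ne_zero _).2 ha) ((map_ne_zero _).2 hb)]
  rfl

theorem ordK_one : ordK R (1 : K) = 0 := by
  rw [ordK, map_one, WithZero.log_one]

theorem ordK_prod {κ : Type*} (S : Finset κ) (d : κ → K) (hd : ∀ i, d i ≠ 0) :
    ordK R (∏ i ∈ S, d i) = ∑ i ∈ S, ordK R (d i) := by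
  classical
  induction S using Finset.induction_on with
  | empty => simp [ordK_one]
  | insert i S hi ih =>
    rw [Finset.prod_insert hi, Finset.sum_insert hi,
      ordK_mul (hd i) (Finset.prod_ne_zero_iff.2 fun i _ => hd i), ih]

theorem ordK_algebraMap {r : R} (hr : r ≠ 0) :
    ordK R (algebraMap R K r) = len R (R ⧸ Ideal.span {r}) := by
  have h := length_quotient_span_singleton_ne_top hr
  rw [ordK, Ring.ordFrac_eq_ord R hr, Ring.ordMonoidWithZeroHom_eq_coe R
    (mem_nonZeroDivisors_of_ne_zero hr) (ENat.natCast_toNat h).symm]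
  rfl

variable {M V : Type*} [AddCommGroup M] [Module R M] [AddCommGroup V] [Module R V] [Module K V]

theorem IsGenericFibre.exists_lift {ι : M →ₗ[R] V} (hι : IsGenericFibre ι) {κ : Type*} [Finite κ]
    (v : κ → V) : ∃ s : R, s ≠ 0 ∧ ∃ m : κ → M, ∀ i, ι (m i) = s • v i := by
  classical
  have := Fintype.ofFinite κ
  choose r hr m hm using hι.exists_smul_eq
  refine ⟨∏ i, r (v i), Finset.prod_ne_zero_iff.2 fun i _ => hr _,
    fun i => (∏ j ∈ Finset.univ.erase i, r (v j)) • m (v i), fun i => ?_⟩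
  rw [map_smul, hm, smul_smul, Finset.prod_erase_mul _ _ (Finset.mem_univ i)]

variable [IsScalarTower R K V] [Module.Finite R M] {κ : Type*}

section Basis

variable [Fintype κ] {ι : M →ₗ[R] V} (hι : IsGenericFibre ι) (b b' : Module.Basis κ K V)

include hι

theorem latticeDegree_smul {d : κ → K} (hd : ∀ i, d i ≠ 0) (h : ∀ i, b' i = d i • b i) :
    latticeDegree ι b' = latticeDegree ι b + ∑ i, ordK R (d i) := by
  obtain ⟨s, hs, m, hm⟩ := hι.exists_lift b
  obtain ⟨w', hu⟩ := IsLocalization.exist_integer_multiples_of_finite (nonZeroDivisors R) d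
  obtain ⟨w, hw⟩ : ∃ w : R, w = w' := ⟨_, rfl⟩
  have hw0 : w ≠ 0 := hw ▸ nonZeroDivisors.ne_zero w'.2
  rw [← hw] at hu
  choose u hu using hu
  have hu0 (i) : u i ≠ 0 := by
    rintro h0
    have := hu i
    rw [h0, map_zero, eq_comm, ← algebraMap_smul K] at this
    simp [hw0, hd i] at this
  have hd' (i) : ordK R (d i) = len R (R ⧸ Ideal.span {u i}) - len R (R ⧸ Ideal.span {w}) := by
    rw [← ordK_algebraMap (K := K) (hu0 i), hu i, Algebra.smul_def,
      ordK_mul (by simpa using hw0) (hd i), ordK_algebraMap hw0]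
    ring
  have hsw := mul_ne_zero hs hw0
  have h1 : ∀ i, ι (w • m i) = (s * w) • b i := fun i => by
    rw [map_smul, hm, smul_smul, mul_comm]
  have h2 : ∀ i, ι (u i • m i) = (s * w) • b' i := fun i => by
    rw [map_smul, hm, h, smul_comm, ← algebraMap_smul K (u i), hu, mul_smul, smul_assoc]
  have hli := linearIndependent_of_lift b hs hm
  have key {v : κ → R} (hv : ∀ i, v i ≠ 0) {c : Module.Basis κ K V}
      (hc : ∀ i, ι (v i • m i) = (s * w) • c i) :
      len R (M ⧸ Submodule.span R (Set.range fun i => v i • m i)) =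
        ∑ i, len R (R ⧸ Ideal.span {v i}) + len R (M ⧸ Submodule.span R (Set.range m)) := by
    rw [← len_span_quotient_span_smul hli hv]
    refine len_quotient_tower (Submodule.span_le.2 ?_) (length_quotient_span_ne_top hι c hsw hc)
    rintro _ ⟨i, rfl⟩
    exact Submodule.smul_mem _ _ (Submodule.subset_span ⟨i, rfl⟩)
  rw [latticeDegree_eq hι b hsw h1, latticeDegree_eq hι b' hsw h2, key (fun _ => hw0) h1,
    key hu0 h2, Finset.sum_congr rfl fun i _ => hd' i, Finset.sum_sub_distrib]
  ring

theorem latticeDegree_of_matrix [DecidableEq κ] {A : Matrix κ κ K} (hA : A.det ≠ 0)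
    (h : ∀ i, b' i = ∑ j, A i j • b j) :
    latticeDegree ι b' = latticeDegree ι b + ordK R A.det := by
  revert b b'
  refine Matrix.diagonal_transvection_induction_of_det_ne_zero
    (fun A => ∀ b b' : Module.Basis κ K V,
    (∀ i, b' i = ∑ j, A i j • b j) → latticeDegree ι b' = latticeDegree ι b + ordK R A.det) A hA
    ?_ ?_ ?_
  · intro D hD b b' h
    rw [Matrix.det_diagonal] at hD ⊢
    have hD' (i) : D i ≠ 0 := (Finset.prod_ne_zero_iff.1 hD) i (Finset.mem_univ i)
    rw [ordK_prod _ _ hD']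
    refine latticeDegree_smul hι b b' hD' fun i => ?_
    rw [h]
    simp [Matrix.diagonal_apply, ite_smul]
  · rintro ⟨i, j, hij, c⟩ b b' h
    rw [Matrix.TransvectionStruct.det, ordK_one, add_zero]
    obtain ⟨u, w, hw, rfl⟩ := IsFractionRing.div_surjective R c
    have hw0 : algebraMap R K w ≠ 0 := by simpa using nonZeroDivisors.ne_zero hw
    let d : κ → Kˣ := fun l => if l = j then (Units.mk0 _ hw0)⁻¹ else 1
    have h1 := latticeDegree_smul hι b (b.unitsSMul d) (d := fun l => d l) (fun l => (d l).ne_zero)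
      fun l => by rw [Module.Basis.unitsSMul_apply]; rfl
    have h2 := latticeDegree_smul hι b' (b'.unitsSMul d)
      (d := fun l => d l) (fun l => (d l).ne_zero)
      fun l => by rw [Module.Basis.unitsSMul_apply]; rfl
    have h3 : latticeDegree ι (b'.unitsSMul d) = latticeDegree ι (b.unitsSMul d) := by
      set e := b.unitsSMul d with he
      set e' := b'.unitsSMul d with he'
      have hne (l) (hl : l ≠ i) : e' l = e l := by
        rw [he, he', Module.Basis.unitsSMul_apply, Module.Basis.unitsSMul_apply, h]
        simp [Matrix.TransvectionStruct.toMatrix, Matrix.transvection, Matrix.add_apply,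
          Matrix.one_apply, hl.symm]
      have hi : e' i = e i + u • e j := by
        have hdi : d i = 1 := if_neg hij
        have hdj : d j = (Units.mk0 _ hw0)⁻¹ := if_pos rfl
        rw [he, he', Module.Basis.unitsSMul_apply, Module.Basis.unitsSMul_apply,
          Module.Basis.unitsSMul_apply, h, hdi, hdj]
        simp [Matrix.TransvectionStruct.toMatrix, Matrix.transvection, Matrix.add_apply, add_smul,
          Finset.sum_add_distrib, Matrix.one_apply, Matrix.single_apply, div_eq_mul_inv, mul_smul,
          Units.smul_def, ite_smul]
      refine latticeDegree_congr ι (le_antisymm (Submodule.span_le.2 ?_) (Submodule.span_le.2 ?_))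
      · rintro _ ⟨l, rfl⟩
        by_cases hl : l = i
        · rw [hl, hi]
          exact add_mem (Submodule.subset_span ⟨i, rfl⟩)
            (Submodule.smul_mem _ _ (Submodule.subset_span ⟨j, rfl⟩))
        · rw [hne l hl]
          exact Submodule.subset_span ⟨l, rfl⟩
      · rintro _ ⟨l, rfl⟩
        by_cases hl : l = i
        · rw [hl, eq_sub_of_add_eq hi.symm, ← hne j hij.symm]
          exact sub_mem (Submodule.subset_span ⟨i, rfl⟩)
            (Submodule.smul_mem _ _ (Submodule.subset_span ⟨j, rfl⟩))
        · rw [← hne l hl]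
          exact Submodule.subset_span ⟨l, rfl⟩
    linarith
  · intro A B hA hB ihA ihB b b' h
    let e := Matrix.toLinearEquiv b B.transpose (by simpa using hB)
    have he (i) : b.map e i = ∑ j, B i j • b j := by
      rw [Module.Basis.map_apply]
      exact Matrix.toLin_self b b B.transpose i
    rw [Matrix.det_mul, ordK_mul hA hB, ihA (b.map e) b', ihB b (b.map e) he]
    · ring
    · intro i
      rw [h]
      simp only [he, Matrix.mul_apply, Finset.smul_sum, Finset.sum_smul, mul_smul]
      rw [Finset.sum_comm]

end Basis

section Exact

variable {κ' A B C VA VB VC : Type*} [Fintype κ] [Fintype κ'] [AddCommGroup A] [AddCommGroup B]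
  [AddCommGroup C]
  [Module R A] [Module R B] [Module R C] [AddCommGroup VA] [AddCommGroup VB] [AddCommGroup VC]
  [Module R VA] [Module R VB] [Module R VC] [Module K VA] [Module K VB] [Module K VC]
  [IsScalarTower R K VA] [IsScalarTower R K VB] [IsScalarTower R K VC]
  [Module.Finite R A] [Module.Finite R B] [Module.Finite R C]
  {ιA : A →ₗ[R] VA} {ιB : B →ₗ[R] VB} {ιC : C →ₗ[R] VC}

theorem latticeDegree_add (hA : IsGenericFibre ιA) (hB : IsGenericFibre ιB) (hC : IsGenericFibre ιC)
    {f : A →ₗ[R] B} {g : B →ₗ[R] C} (hf : Function.Injective f) (hg : Function.Surjective g)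
    (hfg : Function.Exact f g) {F : VA →ₗ[K] VB} {G : VB →ₗ[K] VC}
    (hF : ∀ a, ιB (f a) = F (ιA a)) (hG : ∀ b, ιC (g b) = G (ιB b))
    (a : Module.Basis κ K VA) (c : Module.Basis κ' K VC) (b : Module.Basis (κ ⊕ κ') K VB)
    (ha : ∀ i, b (.inl i) = F (a i)) (hc : ∀ j, G (b (.inr j)) = c j) :
    latticeDegree ιB b = latticeDegree ιA a + latticeDegree ιC c := by
  obtain ⟨s, hs, x, hx⟩ := hA.exists_lift a
  obtain ⟨t, ht, y, hy⟩ := hB.exists_lift fun j => b (.inr j)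
  have hst := mul_ne_zero hs ht
  have hx' (i) : ιA (t • x i) = (s * t) • a i := by rw [map_smul, hx, smul_smul, mul_comm]
  have hz' (j) : ιC (g (s • y j)) = (s * t) • c j := by
    rw [hG, map_smul, hy, smul_smul, ← algebraMap_smul K (s * t), map_smul, hc, algebraMap_smul]
  let m : κ ⊕ κ' → B := Sum.elim (fun i => f (t • x i)) fun j => s • y j
  have hm (l) : ιB (m l) = (s * t) • b l := by
    rcases l with i | j
    · change ιB (f (t • x i)) = _
      rw [hF, hx', ha, ← algebraMap_smul K, map_smul, algebraMap_smul]
    · change ιB (s • y j) = _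
      rw [map_smul, hy, smul_smul]
  have hfin := length_quotient_span_ne_top hB b hst hm
  rw [latticeDegree_eq hA a hst hx', latticeDegree_eq hB b hst hm, latticeDegree_eq hC c hst hz']
  have hlen : len R (B ⧸ Submodule.span R (Set.range m)) =
      len R (A ⧸ Submodule.span R (Set.range fun i => t • x i)) +
        len R (C ⧸ Submodule.span R (Set.range fun j => g (s • y j))) := by
    have h1 : Submodule.span R (Set.range fun i => t • x i) ≤
        (Submodule.span R (Set.range m)).comap f := Submodule.span_le.2 (by
      rintro _ ⟨i, rfl⟩
      exact Submodule.subset_span ⟨.inl i, rfl⟩)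
    have hgf (n) : g (f n) = 0 := (hfg _).2 ⟨n, rfl⟩
    have h2 : Submodule.span R (Set.range m) ≤
        (Submodule.span R (Set.range fun j => g (s • y j))).comap g := Submodule.span_le.2 (by
      rintro _ ⟨i | j, rfl⟩
      · change g (f (t • x i)) ∈ Submodule.span R (Set.range fun j => g (s • y j))
        rw [hgf]
        exact zero_mem _
      · exact Submodule.subset_span ⟨j, rfl⟩)
    refine len_eq_add_of_exact (f := Submodule.mapQ _ _ f h1) (g := Submodule.mapQ _ _ g h2)
      ?_ ?_ ?_ hfin
    · refine (injective_iff_map_eq_zero _).2 fun n hn => ?_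
      obtain ⟨n, rfl⟩ := Submodule.Quotient.mk_surjective _ n
      have hn : f n ∈ Submodule.span R (Set.range m) := (Submodule.Quotient.mk_eq_zero _).1 hn
      obtain ⟨r, hr⟩ := (Submodule.mem_span_range_iff_exists_fun R).1 hn
      rw [Fintype.sum_sum_type] at hr
      have h0 : ∑ j, r (.inr j) • g (s • y j) = 0 := by
        have := congrArg g hr
        rw [hgf, map_add, map_sum, map_sum] at this
        simpa only [m, Sum.elim_inl, Sum.elim_inr, map_smul, hgf, smul_zero, Finset.sum_const_zero,
          zero_add] using this
      have h0 := Fintype.linearIndependent_iff.1 (linearIndependent_of_lift c hst hz') _ h0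
      refine (Submodule.Quotient.mk_eq_zero _).2 ?_
      have : n = ∑ i, r (.inl i) • t • x i := hf (by
        rw [← hr, map_sum]
        simp only [m, Sum.elim_inl, Sum.elim_inr, h0, zero_smul, Finset.sum_const_zero, add_zero,
          map_smul])
      rw [this]
      exact sum_mem fun i _ => Submodule.smul_mem _ _ (Submodule.subset_span ⟨i, rfl⟩)
    · intro n
      obtain ⟨n, rfl⟩ := Submodule.Quotient.mk_surjective _ n
      obtain ⟨n, rfl⟩ := hg n
      exact ⟨Submodule.Quotient.mk n, rfl⟩
    · intro n
      obtain ⟨n, rfl⟩ := Submodule.Quotient.mk_surjective _ n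
      constructor
      · intro hn
        have hn : g n ∈ Submodule.span R (Set.range fun j => g (s • y j)) :=
          (Submodule.Quotient.mk_eq_zero _).1 hn
        obtain ⟨r, hr⟩ := (Submodule.mem_span_range_iff_exists_fun R).1 hn
        obtain ⟨a', ha'⟩ := (hfg (n - ∑ j, r j • s • y j)).1 (by
          rw [map_sub, ← hr, map_sum]
          simp only [map_smul, sub_self])
        refine ⟨Submodule.Quotient.mk a', (Submodule.Quotient.eq _).2 ?_⟩
        rw [ha', sub_sub_cancel_left]
        exact neg_mem (sum_mem fun j _ =>
          Submodule.smul_mem _ _ (Submodule.subset_span ⟨.inr j, rfl⟩))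
      · rintro ⟨a', ha'⟩
        obtain ⟨a', rfl⟩ := Submodule.Quotient.mk_surjective _ a'
        rw [← ha']
        refine (Submodule.Quotient.mk_eq_zero _).2 ?_
        rw [hgf]
        exact zero_mem _
  rw [hlen, Fintype.card_sum]
  push_cast
  ring

end Exact

end LatticeDegree

end

section

section ProductFormula

open WithZero Filter

theorem eventually_pow_mul_lt {g : ℤᵐ⁰} (hg : g < 1) (h : ℤᵐ⁰) {c : ℤᵐ⁰} (hc : c ≠ 0) :
    ∀ᶠ n : ℕ in atTop, g ^ n * h < c := by
  have hc0 : 0 < c := zero_lt_iff.2 hc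
  by_cases hh : h = 0
  · exact .of_forall fun n => by rw [hh, mul_zero]; exact hc0
  by_cases hg0 : g = 0
  · filter_upwards [eventually_ge_atTop 1] with n hn
    rw [hg0, zero_pow (by omega), zero_mul]
    exact hc0
  · have hl : log g ≤ -1 := by
      have := (log_lt_log hg0 one_ne_zero).2 hg
      rw [log_one] at this
      omega
    filter_upwards [eventually_ge_atTop (log h - log c + 1).toNat] with n hn
    rw [← log_lt_log (mul_ne_zero (pow_ne_zero n hg0) hh) hc, log_mul (pow_ne_zero n hg0) hh,
      log_pow]
    have : (n : ℤ) * log g ≤ n * (-1) := mul_le_mul_of_nonneg_left hl (by positivity)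
    have := Int.self_le_toNat (log h - log c + 1)
    have : ((log h - log c + 1).toNat : ℤ) ≤ n := by exact_mod_cast hn
    simp only [nsmul_eq_mul]
    linarith

theorem eventually_lt_pow_mul {g : ℤᵐ⁰} (hg : 1 < g) {h : ℤᵐ⁰} (hh : h ≠ 0) :
    ∀ᶠ n : ℕ in atTop, 1 < g ^ n * h := by
  filter_upwards [eventually_pow_mul_lt (inv_lt_one_of_one_lt₀ hg) h⁻¹ (one_ne_zero)] with n hn
  have h0 : g ^ n * h ≠ 0 := mul_ne_zero (pow_ne_zero n (zero_lt_one.trans hg).ne') hh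
  rw [inv_pow, ← mul_inv] at hn
  rwa [inv_lt_one₀ (zero_lt_iff.2 h0)] at hn

variable {k K S : Type*} [Field k] [Field K] [Algebra k K]

/-- The elements of `K` on which `w` is at most `g`. -/
def valuationBall (w : Valuation K ℤᵐ⁰) (hw : ∀ c : k, w (algebraMap k K c) ≤ 1) (g : ℤᵐ⁰) :
    Submodule k K where
  carrier := {a | w a ≤ g}
  add_mem' ha hb := w.map_add_le ha hb
  zero_mem' := by simp
  smul_mem' c a ha := by
    change w (c • a) ≤ g
    rw [Algebra.smul_def, map_mul]
    exact (mul_le_of_le_one_left' (hw c)).trans ha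

/-- Properties of the family of the valuations of the closed points of a proper regular curve over
`k` with function field `K`, and residue fields `Q x`. -/
structure CurveValuations (k : Type*) {K S : Type*} [Field k] [Field K] [Algebra k K]
    (v : S → Valuation K ℤᵐ⁰) (Q : S → Type*) [∀ x, AddCommGroup (Q x)] [∀ x, Module k (Q x)] where
  le_one : ∀ x (c : k), v x (algebraMap k K c) ≤ 1
  exists_uniformizer : ∀ x, ∃ a, v x a = exp (-1)
  finite : ∀ a, a ≠ 0 → {x | v x a ≠ 1}.Finite
  incomparable : ∀ x y, x ≠ y → ∃ a, v x a ≤ 1 ∧ 1 < v y a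
  residue : ∀ x, valuationBall (v x) (le_one x) 1 →ₗ[k] Q x
  residue_surjective : ∀ x, Function.Surjective (residue x)
  residue_eq_zero : ∀ x a, residue x a = 0 ↔ v x a < 1
  finite_residue : ∀ x, Module.Finite k (Q x)
  finite_const : Module.Finite k (⨅ x, valuationBall (v x) (le_one x) 1 : Submodule k K)

namespace CurveValuations

variable {v : S → Valuation K ℤᵐ⁰} {Q : S → Type*} [∀ x, AddCommGroup (Q x)]
  [∀ x, Module k (Q x)] (h : CurveValuations k v Q)

include h

theorem exists_one_lt {x : S} {T : Finset S} (hx : x ∉ T) :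
    ∃ z, 1 < v x z ∧ ∀ y ∈ T, v y z < 1 := by
  classical
  induction T using Finset.induction_on with
  | empty =>
    obtain ⟨a, ha⟩ := h.exists_uniformizer x
    refine ⟨a⁻¹, ?_, by simp⟩
    rw [map_inv₀, ha, ← exp_neg, ← exp_zero, exp_lt_exp]
    norm_num
  | insert y T hy ih =>
    rw [Finset.mem_insert, not_or] at hx
    obtain ⟨z, hz, hzT⟩ := ih hx.2
    obtain ⟨a, ha, ha'⟩ := h.incomparable x y hx.1
    obtain ⟨b, hb, hb'⟩ := h.incomparable y x (Ne.symm hx.1)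
    have ha0 : a ≠ 0 := by rintro rfl; simp at ha'
    have hw : 1 < v x (b / a) := by
      rw [map_div₀, one_lt_div₀ (zero_lt_iff.2 ((map_ne_zero _).2 ha0))]
      exact ha.trans_lt hb'
    have hw' : v y (b / a) < 1 := by
      rw [map_div₀, div_lt_one₀ (zero_lt_iff.2 ((map_ne_zero _).2 ha0))]
      exact hb.trans_lt ha'
    have hw0 : v x (b / a) ≠ 0 := (zero_lt_one.trans hw).ne'
    have hT : ∀ᶠ n : ℕ in atTop, ∀ t ∈ T, v t (z ^ n * (b / a)) < 1 := by
      rw [eventually_all_finset]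
      intro t ht
      simp only [map_mul, map_pow]
      exact eventually_pow_mul_lt (hzT t ht) _ one_ne_zero
    rcases lt_trichotomy (v y z) 1 with hy1 | hy1 | hy1
    · exact ⟨z, hz, fun t ht => (Finset.mem_insert.1 ht).elim (fun h => h ▸ hy1) (hzT t)⟩
    · obtain ⟨n, hn, hn'⟩ := (hT.and (eventually_lt_pow_mul hz hw0)).exists
      refine ⟨z ^ n * (b / a), by rwa [map_mul, map_pow], fun t ht => ?_⟩
      rcases Finset.mem_insert.1 ht with rfl | ht
      · rwa [map_mul, map_pow, hy1, one_pow, one_mul]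
      · exact hn t ht
    · obtain ⟨n, hn, hn0⟩ := (hT.and (eventually_ge_atTop 1)).exists
      have hn0 : n ≠ 0 := by omega
      have big {s : S} (hs : 1 < v s z) : v s (z ^ n / (1 + z ^ n)) = 1 := by
        have : v s 1 < v s (z ^ n) := by
          rw [map_one, map_pow]; exact one_lt_pow₀ hs hn0
        rw [map_div₀, Valuation.map_add_eq_of_lt_right _ this, div_self]
        rw [map_one] at this
        exact (zero_lt_one.trans this).ne'
      refine ⟨z ^ n / (1 + z ^ n) * (b / a), by rwa [map_mul, big hz, one_mul], fun t ht => ?_⟩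
      rcases Finset.mem_insert.1 ht with rfl | ht
      · rwa [map_mul, big hy1, one_mul]
      · have hlt : v t (z ^ n) < v t 1 := by
          rw [map_one, map_pow]; exact pow_lt_one₀ zero_le (hzT t ht) hn0
        have := hn t ht
        rwa [div_mul_eq_mul_div, map_div₀, Valuation.map_add_eq_of_lt_left _ hlt, map_one, div_one]

theorem exists_approx_one {x : S} {T : Finset S} (hx : x ∉ T) {g : ℤᵐ⁰} (hg : g ≠ 0) :
    ∃ e, v x (e - 1) < g ∧ ∀ y ∈ T, v y e < g := by
  obtain ⟨z, hz, hzT⟩ := h.exists_one_lt hx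
  have h1 : ∀ᶠ n : ℕ in atTop, ∀ t ∈ T, v t z ^ n * 1 < g := by
    rw [eventually_all_finset]
    exact fun t ht => eventually_pow_mul_lt (hzT t ht) _ hg
  obtain ⟨n, hn, hn', hn0⟩ := (h1.and ((eventually_pow_mul_lt (inv_lt_one_of_one_lt₀ hz) 1 hg).and
    (eventually_ge_atTop 1))).exists
  have hn0 : n ≠ 0 := by omega
  have hxz : v x 1 < v x (z ^ n) := by
    rw [map_one, map_pow]; exact one_lt_pow₀ hz hn0
  have hne : 1 + z ^ n ≠ 0 := fun h0 => by
    have := Valuation.map_add_eq_of_lt_right _ hxz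
    rw [h0, map_zero] at this
    rw [← this] at hxz
    simp at hxz
  refine ⟨z ^ n / (1 + z ^ n), ?_, fun t ht => ?_⟩
  · have : z ^ n / (1 + z ^ n) - 1 = - (1 + z ^ n)⁻¹ := by
      field_simp
      ring
    rw [this, Valuation.map_neg, map_inv₀, Valuation.map_add_eq_of_lt_right _ hxz, map_pow,
      ← inv_pow]
    simpa using hn'
  · have : v t (z ^ n) < v t 1 := by
      rw [map_one, map_pow]; exact pow_lt_one₀ zero_le (hzT t ht) hn0
    rw [map_div₀, Valuation.map_add_eq_of_lt_left _ this, map_one, div_one, map_pow]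
    simpa using hn t ht

theorem exists_approx (T : Finset S) (r : S → K) {g : ℤᵐ⁰} (hg : g ≠ 0) :
    ∃ u, ∀ y ∈ T, v y (u - r y) < g := by
  classical
  have h1 (x) : ∃ c : ℤᵐ⁰, c ≠ 0 ∧ ∀ y ∈ T, c * v y (r x) < g := by
    have : ∀ᶠ n : ℕ in atTop, ∀ y ∈ T, (exp (-1) : ℤᵐ⁰) ^ n * v y (r x) < g := by
      rw [eventually_all_finset]
      refine fun y hy => eventually_pow_mul_lt ?_ _ hg
      rw [← exp_zero, exp_lt_exp]; norm_num
    obtain ⟨n, hn⟩ := this.exists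
    exact ⟨_, pow_ne_zero n exp_ne_zero, hn⟩
  choose c hc0 hc using h1
  choose e he he' using fun x => h.exists_approx_one (Finset.notMem_erase x T) (hc0 x)
  refine ⟨∑ x ∈ T, e x * r x, fun y hy => ?_⟩
  have lt {a : K} {x : S} (ha : v y a < c x) : v y (a * r x) < g := by
    rw [map_mul]
    exact (mul_le_mul_left ha.le _).trans_lt (hc x y hy)
  rw [← Finset.add_sum_erase T _ hy, add_sub_right_comm, ← sub_one_mul]
  refine Valuation.map_add_lt _ (lt (he y)) (Valuation.map_sum_lt _ hg fun x hx => ?_)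
  exact lt (he' x y (Finset.mem_erase.2 ⟨(Finset.ne_of_mem_erase hx).symm, hy⟩))

end CurveValuations

end ProductFormula

end

section

section ProductFormula

open WithZero Filter

variable {k K S : Type*} [Field k] [Field K] [Algebra k K]

theorem le_of_map_sum_pow_le {w : Valuation K ℤᵐ⁰} {a : K} (ha0 : a ≠ 0) (ha : w a ≤ 1) {e : ℕ}
    {s : Fin e → K} (hs : ∀ j, w (s j) ≤ 1) (hsum : w (∑ j : Fin e, a ^ (j : ℕ) * s j) ≤ w a ^ e)
    (j : Fin e) (hj : ∀ l < j, s l = 0) : w (s j) ≤ w a := by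
  have h0 : 0 < w a := zero_lt_iff.2 ((map_ne_zero _).2 ha0)
  have h1 : w (a ^ (j : ℕ) * s j) ≤ w a ^ ((j : ℕ) + 1) := by
    rw [← Finset.add_sum_erase _ _ (Finset.mem_univ j)] at hsum
    rw [← add_sub_cancel_right (a ^ (j : ℕ) * s j)
      (∑ l ∈ Finset.univ.erase j, a ^ (l : ℕ) * s l)]
    refine (w.map_sub _ _).trans (max_le (hsum.trans (pow_le_pow_right_of_le_one' ha j.2))
      (w.map_sum_le fun l hl => ?_))
    rcases lt_or_gt_of_ne (Finset.ne_of_mem_erase hl) with hlj | hlj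
    · rw [hj l hlj, mul_zero, map_zero]
      exact zero_le
    · rw [map_mul, map_pow]
      exact (mul_le_of_le_one_right' (hs l)).trans (pow_le_pow_right_of_le_one' ha hlj)
  rw [map_mul, map_pow, pow_succ] at h1
  exact le_of_mul_le_mul_left h1 (pow_pos h0 _)

namespace CurveValuations

variable {v : S → Valuation K ℤᵐ⁰} {Q : S → Type*} [∀ x, AddCommGroup (Q x)]
  [∀ x, Module k (Q x)] (h : CurveValuations k v Q)

/-- The space of elements with poles bounded by `D`. -/
def poleSpace (D : S →₀ ℕ) : Submodule k K :=
  ⨅ x, valuationBall (v x) (h.le_one x) (exp (D x))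

theorem mem_poleSpace {D : S →₀ ℕ} {a : K} : a ∈ h.poleSpace D ↔ ∀ x, v x a ≤ exp (D x : ℤ) := by
  simp only [poleSpace, Submodule.mem_iInf]
  rfl

/-- The dimension of the residue field. -/
def weight (_h : CurveValuations k v Q) (x : S) : ℕ := Module.finrank k (Q x)

theorem poleSpace_zero :
    h.poleSpace 0 = ⨅ x, valuationBall (v x) (h.le_one x) 1 := by
  simp [poleSpace]

include h

theorem finite_poleSpace_add_single {D : S →₀ ℕ} (hD : Module.Finite k (h.poleSpace D)) (x : S) :
    Module.Finite k (h.poleSpace (D + Finsupp.single x 1)) ∧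
    Module.finrank k (h.poleSpace (D + Finsupp.single x 1)) ≤
      Module.finrank k (h.poleSpace D) + h.weight x := by
  classical
  obtain ⟨π, hπ⟩ := h.exists_uniformizer x
  have hle : h.poleSpace (D + Finsupp.single x 1) ≤
      (valuationBall (v x) (h.le_one x) 1).comap (LinearMap.mulLeft k (π ^ (D x + 1))) := by
    intro a ha
    have := h.mem_poleSpace.1 ha x
    change v x (π ^ (D x + 1) * a) ≤ 1
    rw [map_mul, map_pow, hπ]
    refine (mul_le_mul_right this _).trans ?_
    rw [← exp_nsmul, ← exp_add, ← exp_zero, exp_le_exp]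
    simp
  let ψ := h.residue x ∘ₗ (LinearMap.mulLeft k (π ^ (D x + 1))).restrict hle
  have hker : LinearMap.ker ψ ≤ (h.poleSpace D).submoduleOf
    (h.poleSpace (D + Finsupp.single x 1)) := by
    intro a ha
    have ha := (h.residue_eq_zero x _).1 (LinearMap.mem_ker.1 ha)
    change v x (π ^ (D x + 1) * a) < 1 at ha
    change (a : K) ∈ h.poleSpace D
    rw [mem_poleSpace]
    intro y
    by_cases hy : y = x
    · subst hy
      rw [map_mul, map_pow, hπ, ← exp_nsmul] at ha
      by_cases h0 : v y a = 0
      · rw [h0]; exact zero_le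
      · rw [← exp_log h0, ← exp_add, ← exp_zero, exp_lt_exp] at ha
        rw [← exp_log h0, exp_le_exp]
        simp at ha
        omega
    · have := h.mem_poleSpace.1 a.2 y
      simpa [Finsupp.single_apply, Ne.symm hy] using this
  have : Module.Finite k (Q x) := h.finite_residue x
  let j : LinearMap.ker ψ →ₗ[k] h.poleSpace D :=
    (((h.poleSpace _).subtype ∘ₗ (LinearMap.ker ψ).subtype).codRestrict _ fun a => hker a.2)
  have hj : Function.Injective j := fun a b hab =>
    Subtype.ext (Subtype.ext (congrArg Subtype.val hab :))
  have hfk : Module.Finite k (LinearMap.ker ψ) := Module.Finite.of_injective j hj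
  have hfq : Module.Finite k (h.poleSpace (D + Finsupp.single x 1) ⧸ LinearMap.ker ψ) :=
    Module.Finite.equiv ψ.quotKerEquivRange.symm
  have hfin := Module.Finite.of_submodule_quotient (LinearMap.ker ψ)
  refine ⟨hfin, ?_⟩
  rw [← LinearMap.finrank_range_add_finrank_ker ψ, add_comm]
  exact add_le_add (LinearMap.finrank_le_finrank_of_injective hj) (Submodule.finrank_le _)

theorem finite_poleSpace (D : S →₀ ℕ) :
    Module.Finite k (h.poleSpace D) ∧ Module.finrank k (h.poleSpace D) ≤
      Module.finrank k (h.poleSpace 0) + D.sum fun x n => n * h.weight x := by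
  classical
  induction D using Finsupp.induction with
  | zero =>
    have := h.finite_const
    rw [← h.poleSpace_zero] at this
    exact ⟨this, by simp⟩
  | single_add x n D hx hn ih =>
    clear hn
    suffices ∀ n : ℕ, Module.Finite k (h.poleSpace (D + Finsupp.single x n)) ∧
        Module.finrank k (h.poleSpace (D + Finsupp.single x n)) ≤
        Module.finrank k (h.poleSpace 0) + (D.sum fun x n => n * h.weight x) + n * h.weight x by
      rw [add_comm (Finsupp.single x n), Finsupp.sum_add_index' (by simp) (by intros; ring),
        Finsupp.sum_single_index (by simp), ← add_assoc]
      exact this n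
    intro n
    induction n with
    | zero => rw [Finsupp.single_zero, add_zero, zero_mul, add_zero]; exact ih
    | succ n ihn =>
      have := h.finite_poleSpace_add_single ihn.1 x
      rw [add_assoc, ← Finsupp.single_add] at this
      refine ⟨this.1, this.2.trans ?_⟩
      rw [add_mul, one_mul, ← add_assoc]
      exact Nat.add_le_add_right ihn.2 _

/-- The degree of the positive part of the order of poles. -/
def poleDivisor {a : K} (ha : a ≠ 0) : S →₀ ℕ :=
  Finsupp.ofSupportFinite (fun x => (log (v x a)).toNat) <| (h.finite a ha).subset fun x hx => by
    intro h1
    simp [h1] at hx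

theorem le_exp_poleDivisor {a : K} (ha : a ≠ 0) (x : S) :
    v x a ≤ exp (h.poleDivisor ha x : ℤ) := by
  have h0 : v x a ≠ 0 := (map_ne_zero _).2 ha
  rw [← exp_log h0, exp_le_exp]
  exact Int.self_le_toNat _

/-- The exponents of zeros, as an index set. -/
abbrev ZeroIndex {a : K} (ha : a ≠ 0) : Type _ :=
  Σ x : (h.poleDivisor (inv_ne_zero ha)).support,
    Fin (h.poleDivisor (inv_ne_zero ha) x) × Fin (h.weight x)

theorem exists_residue_basis (x : S) : ∃ r : Fin (h.weight x) → K, (∀ i, v x (r i) ≤ 1) ∧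
    ∀ c : Fin (h.weight x) → k, v x (∑ i, c i • r i) < 1 → c = 0 := by
  have := h.finite_residue x
  let b := Module.finBasis k (Q x)
  choose r hr using fun i => h.residue_surjective x (b i)
  refine ⟨fun i => r i, fun i => (r i).2, fun c hc => ?_⟩
  have h1 : ((∑ i, c i • r i : valuationBall (v x) (h.le_one x) 1) : K) = ∑ i, c i • (r i : K) := by
    simp
  rw [← h1, ← h.residue_eq_zero, map_sum] at hc
  refine funext fun i => Fintype.linearIndependent_iff.1 b.linearIndependent c ?_ i
  rw [← hc]
  exact Finset.sum_congr rfl fun i _ => by rw [map_smul, hr]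

theorem map_smul_le (x : S) (c : k) (a : K) : v x (c • a) ≤ v x a := by
  rw [Algebra.smul_def, map_mul]
  exact mul_le_of_le_one_left' (h.le_one x c)

theorem map_sum_smul_le (x : S) {ι : Type*} [Fintype ι] (c : ι → k) {u : ι → K} {g : ℤᵐ⁰}
    (hu : ∀ p, v x (u p) ≤ g) : v x (∑ p, c p • u p) ≤ g :=
  (v x).map_sum_le fun p _ => (h.map_smul_le x _ _).trans (hu p)

/-- Truncated power series at a point are independent modulo high powers of the maximal ideal. -/
theorem eq_zero_of_sum_pow_le {x : S} {π : K} (hπ : v x π = exp (-1)) {d : ℕ} {r : Fin d → K}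
    (hr : ∀ i, v x (r i) ≤ 1) (hr0 : ∀ c : Fin d → k, v x (∑ i, c i • r i) < 1 → c = 0) (e : ℕ)
    (c : Fin e × Fin d → k) (hc : v x (∑ p, c p • (π ^ (p.1 : ℕ) * r p.2)) ≤ exp (-(e : ℤ))) :
    c = 0 := by
  have hπ0 : π ≠ 0 := by rintro rfl; simp at hπ; exact exp_ne_zero hπ.symm
  have hπ1 : v x π < 1 := by rw [hπ, ← exp_zero, exp_lt_exp]; norm_num
  have hsum : ∑ p, c p • (π ^ (p.1 : ℕ) * r p.2) =
      ∑ j : Fin e, π ^ (j : ℕ) * ∑ i, c (j, i) • r i := by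
    rw [Fintype.sum_prod_type]
    simp only [Finset.mul_sum, mul_smul_comm]
  rw [hsum] at hc
  have key (j : Fin e) : (fun i => c (j, i)) = 0 := by
    induction j using WellFoundedLT.induction with
    | ind j ih =>
      refine hr0 _ ((le_of_map_sum_pow_le hπ0 hπ1.le
        (fun j => h.map_sum_smul_le x (fun i => c (j, i)) hr) ?_ j
        fun l hl => ?_).trans_lt hπ1)
      · refine hc.trans_eq ?_
        rw [hπ, ← exp_nsmul]
        simp
      · exact Finset.sum_eq_zero fun i _ => by rw [congr_fun (ih l hl) i, Pi.zero_apply, zero_smul]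
  exact funext fun p => congr_fun (key p.1) p.2

theorem exists_independent_mod {a : K} (ha : a ≠ 0) : ∃ u : h.ZeroIndex ha → K,
    (∀ p, ∀ x ∈ (h.poleDivisor (inv_ne_zero ha)).support, v x (u p) ≤ 1) ∧
    ∀ c : h.ZeroIndex ha → k, (∀ x ∈ (h.poleDivisor (inv_ne_zero ha)).support,
      v x (∑ p, c p • u p) ≤ v x a) → c = 0 := by
  classical
  set Z := h.poleDivisor (inv_ne_zero ha) with hZ
  have hva {x} (hx : x ∈ Z.support) : v x a = exp (-(Z x : ℤ)) := by
    have h0 : v x a ≠ 0 := (map_ne_zero _).2 ha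
    have h1 : Z x ≠ 0 := Finsupp.mem_support_iff.1 hx
    have h2 : Z x = (log (v x a⁻¹)).toNat := rfl
    rw [map_inv₀, log_inv] at h2
    rw [← exp_log h0]
    congr 1
    omega
  have hva1 {x} (hx : x ∈ Z.support) : v x a ≤ 1 := by
    rw [hva hx, ← exp_zero, exp_le_exp]
    simp
  choose π hπ using h.exists_uniformizer
  choose r hr hr0 using h.exists_residue_basis
  have hπ1 (x) : v x (π x) ≤ 1 := by rw [hπ, ← exp_zero, exp_le_exp]; norm_num
  have hg : ∃ g : ℤᵐ⁰, g ≠ 0 ∧ ∀ x ∈ Z.support, g < v x a := by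
    have : ∀ᶠ n : ℕ in atTop, ∀ y ∈ Z.support, (exp (-1) : ℤᵐ⁰) ^ n * 1 < v y a := by
      rw [eventually_all_finset]
      refine fun y hy => eventually_pow_mul_lt ?_ _ ((map_ne_zero _).2 ha)
      rw [← exp_zero, exp_lt_exp]; norm_num
    obtain ⟨n, hn⟩ := this.exists
    exact ⟨_, mul_ne_zero (pow_ne_zero n exp_ne_zero) one_ne_zero, hn⟩
  obtain ⟨g, hg0, hg⟩ := hg
  let t (p : h.ZeroIndex ha) (y : S) : K :=
    if (p.1 : S) = y then π p.1 ^ (p.2.1 : ℕ) * r p.1 p.2.2 else 0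
  have ht (p) (y) : v y (t p y) ≤ 1 := by
    dsimp only [t]
    split_ifs with hy
    · rw [← hy, map_mul, map_pow]
      exact mul_le_one' (pow_le_one' (hπ1 _) _) (hr _ _)
    · rw [map_zero]
      exact zero_le
  choose u hu using fun p => h.exists_approx Z.support (t p) hg0
  refine ⟨u, fun p x hx => ?_, fun c hc => ?_⟩
  · rw [← sub_add_cancel (u p) (t p x)]
    exact (v x).map_add_le (((hu p x hx).trans (hg x hx)).le.trans (hva1 hx)) (ht p x)
  · have key (x : Z.support) : v x (∑ p, c ⟨x, p⟩ • (π x ^ (p.1 : ℕ) * r x p.2)) ≤ v x a := by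
      have h1 : ∑ p, c p • t p x = ∑ p, c ⟨x, p⟩ • (π x ^ (p.1 : ℕ) * r x p.2) := by
        rw [Fintype.sum_sigma, Finset.sum_eq_single x]
        · exact Finset.sum_congr rfl fun p _ => by simp [t]
        · intro y _ hy
          exact Finset.sum_eq_zero fun p _ => by simp [t, Subtype.coe_ne_coe.2 hy]
        · simp
      have h2 : ∑ p, c p • t p x = ∑ p, c p • u p - ∑ p, c p • (u p - t p x) := by
        rw [← Finset.sum_sub_distrib]
        exact Finset.sum_congr rfl fun p _ => by rw [← smul_sub, sub_sub_cancel]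
      rw [← h1, h2]
      exact ((v x).map_sub _ _).trans (max_le (hc x x.2) (h.map_sum_smul_le x _ fun p =>
        ((hu p x x.2).trans (hg x x.2)).le))
    funext p
    have := h.eq_zero_of_sum_pow_le (hπ p.1) (hr p.1) (hr0 p.1) (Z p.1) (fun q => c ⟨p.1, q⟩)
      ((key p.1).trans_eq (hva p.1.2))
    exact congr_fun this p.2

theorem linearIndependent_mul_pow {a : K} (ha : a ≠ 0) {ι : Type*} [Fintype ι] {T : Finset S}
    (haT : ∀ x ∈ T, v x a ≤ 1)
    {u : ι → K} (hu : ∀ p, ∀ x ∈ T, v x (u p) ≤ 1)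
    (hu0 : ∀ c : ι → k, (∀ x ∈ T, v x (∑ p, c p • u p) ≤ v x a) → c = 0) (l : ℕ) :
    LinearIndependent k fun p : ι × Fin l => u p.1 * a ^ (p.2 : ℕ) := by
  refine Fintype.linearIndependent_iff.2 fun c hc => ?_
  have hsum : ∑ p, c p • (u p.1 * a ^ (p.2 : ℕ)) =
      ∑ j : Fin l, a ^ (j : ℕ) * ∑ i, c (i, j) • u i := by
    rw [Fintype.sum_prod_type_right]
    simp only [Finset.mul_sum, mul_smul_comm, mul_comm]
  rw [hsum] at hc
  have key (j : Fin l) : (fun i => c (i, j)) = 0 := by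
    induction j using WellFoundedLT.induction with
    | ind j ih =>
      refine hu0 _ fun x hx => le_of_map_sum_pow_le ha (haT x hx)
        (fun j => h.map_sum_smul_le x (fun i => c (i, j)) fun p => hu p x hx) ?_ j fun l hl => ?_
      · rw [hc, map_zero]
        exact zero_le
      · exact Finset.sum_eq_zero fun i _ => by rw [congr_fun (ih l hl) i, Pi.zero_apply, zero_smul]
  exact fun p => congr_fun (key p.2) p.1

theorem degree_zeros_le {a : K} (ha : a ≠ 0) :
    ((h.poleDivisor (inv_ne_zero ha)).sum fun x n => n * h.weight x) ≤
      (h.poleDivisor ha).sum fun x n => n * h.weight x := by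
  classical
  obtain ⟨u, hu, hu0⟩ := h.exists_independent_mod ha
  have hcard : Fintype.card (h.ZeroIndex ha) =
      (h.poleDivisor (inv_ne_zero ha)).sum fun x n => n * h.weight x := by
    rw [Fintype.card_sigma, Finsupp.sum, ← Finset.sum_coe_sort (f := fun x =>
      h.poleDivisor (inv_ne_zero ha) x * h.weight x)]
    simp
  have haT : ∀ x ∈ (h.poleDivisor (inv_ne_zero ha)).support, v x a ≤ 1 := by
    intro x hx
    have h0 : v x a ≠ 0 := (map_ne_zero _).2 ha
    have h1 : (log (v x a⁻¹)).toNat ≠ 0 := Finsupp.mem_support_iff.1 hx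
    rw [map_inv₀, log_inv] at h1
    rw [← exp_log h0, ← exp_zero, exp_le_exp]
    omega
  have hune (p) : u p ≠ 0 := by
    intro h0
    have := congr_fun (hu0 (Pi.single p 1) fun x hx => by
      rw [Finset.sum_eq_single p (fun q _ hq => by simp [Pi.single_eq_of_ne hq]) (by simp), h0]
      simp) p
    simp at this
  let C := ∑ p, h.poleDivisor (hune p)
  have hC (p) (x) : v x (u p) ≤ exp (C x : ℤ) := by
    refine (h.le_exp_poleDivisor (hune p) x).trans ?_
    rw [exp_le_exp, Nat.cast_le, Finsupp.finsetSum_apply]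
    exact Finset.single_le_sum (f := fun p => h.poleDivisor (hune p) x) (fun _ _ => Nat.zero_le _)
      (Finset.mem_univ p)
  have bound (l : ℕ) : Fintype.card (h.ZeroIndex ha) * l ≤
      Module.finrank k (h.poleSpace 0) + (C.sum fun x n => n * h.weight x) +
        l * (h.poleDivisor ha).sum fun x n => n * h.weight x := by
    have hli := h.linearIndependent_mul_pow ha haT hu hu0 l
    have hmem (p : h.ZeroIndex ha × Fin l) :
        u p.1 * a ^ (p.2 : ℕ) ∈ h.poleSpace (C + l • h.poleDivisor ha) := by
      rw [mem_poleSpace]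
      intro x
      have h1 : v x a ^ (p.2 : ℕ) ≤ exp ((l * h.poleDivisor ha x : ℕ) : ℤ) := by
        refine (pow_le_pow_left' (h.le_exp_poleDivisor ha x) _).trans ?_
        rw [← exp_nsmul, exp_le_exp, nsmul_eq_mul]
        exact_mod_cast Nat.mul_le_mul_right _ p.2.2.le
      rw [map_mul, map_pow, Finsupp.add_apply, Nat.cast_add, exp_add]
      exact mul_le_mul' (hC p.1 x) h1
    have hfin := h.finite_poleSpace (C + l • h.poleDivisor ha)
    have := hfin.1
    have hli' : LinearIndependent k fun p : h.ZeroIndex ha × Fin l =>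
        (⟨_, hmem p⟩ : h.poleSpace (C + l • h.poleDivisor ha)) :=
      LinearIndependent.of_comp (h.poleSpace _).subtype hli
    have hle := hli'.fintype_card_le_finrank.trans hfin.2
    rw [Fintype.card_prod, Fintype.card_fin, Finsupp.sum_add_index' (by simp) (by intros; ring),
      Finsupp.sum_smul_index (by simp)] at hle
    simp only [mul_assoc] at hle
    rwa [← Finsupp.mul_sum, ← add_assoc] at hle
  rw [← hcard]
  by_contra! hlt
  have := bound (Module.finrank k (h.poleSpace 0) + (C.sum fun x n => n * h.weight x) + 1)
  have hle := Nat.mul_le_mul_right (Module.finrank k (h.poleSpace 0) +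
    (C.sum fun x n => n * h.weight x) + 1) (Nat.succ_le_of_lt hlt)
  rw [Nat.succ_eq_add_one, add_mul, one_mul] at hle
  have := hle.trans this
  rw [mul_comm] at this
  omega

theorem finsum_log_eq_zero {a : K} (ha : a ≠ 0) : ∑ᶠ x, (h.weight x : ℤ) * log (v x a) = 0 := by
  have h1 := h.degree_zeros_le ha
  have h2 := h.degree_zeros_le (inv_ne_zero ha)
  simp only [inv_inv] at h2
  have h3 := le_antisymm h1 h2
  have hsup {b : K} (hb : b ≠ 0) : (h.poleDivisor hb).sum (fun x n => n * h.weight x) =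
      ∑ᶠ x, (log (v x b)).toNat * h.weight x := by
    rw [finsum_eq_sum_of_support_subset]
    · rfl
    · intro x hx
      refine Finset.mem_coe.2 (Finsupp.mem_support_iff.2 fun h0 => hx ?_)
      change (log (v x b)).toNat * h.weight x = 0
      rw [show (log (v x b)).toNat = 0 from h0, zero_mul]
  have hfin {b : K} (hb : b ≠ 0) :
      (Function.support fun x => ((log (v x b)).toNat * h.weight x : ℤ)).Finite := by
    refine (h.finite b hb).subset fun x hx h1 => hx ?_
    simp [h1]
  have h4 : ∀ x, (h.weight x : ℤ) * log (v x a) = ((log (v x a)).toNat * h.weight x : ℤ) -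
      ((log (v x a⁻¹)).toNat * h.weight x : ℤ) := fun x => by
    rw [map_inv₀, log_inv, ← sub_mul, mul_comm]
    congr 1
    omega
  rw [finsum_congr h4, finsum_sub_distrib (hfin ha) (hfin (inv_ne_zero ha)), sub_eq_zero]
  rw [hsup ha, hsup (inv_ne_zero ha)] at h3
  have hcast {b : K} (hb : b ≠ 0) :
      ∑ᶠ x, ((log (v x b)).toNat * h.weight x : ℤ) =
        ((∑ᶠ x, (log (v x b)).toNat * h.weight x : ℕ) : ℤ) := by
    refine (finsum_congr fun x => ?_).trans ((Nat.castAddMonoidHom ℤ).map_finsum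
      ((h.finite b hb).subset fun x hx h1 => hx ?_)).symm
    · simp
    · simp [h1]
  rw [hcast ha, hcast (inv_ne_zero ha), h3]

end CurveValuations

end ProductFormula

end

section

section Finiteness

variable [IsIntegral X] [IsRegularCurve X]

instance (x : ClosedPoint X) : IsDiscreteValuationRing (X.presheaf.stalk x.1) :=
  IsRegularCurve.dvr x.1 x.2

instance : IsNoetherian X where

theorem finite_of_isClosed {Z : Set X} (hZ : IsClosed Z) (hη : genericPoint X ∉ Z) : Z.Finite := by
  obtain ⟨S, hS, hcl, hirr, rfl⟩ := NoetherianSpace.exists_finite_set_isClosed_irreducible hZ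
  refine hS.sUnion fun t ht => ?_
  obtain ⟨x, hx⟩ := QuasiSober.sober (hirr t ht) (hcl t ht)
  have hxt : x ∈ t := hx.mem
  have hcx : IsClosed {x} := by
    by_contra h
    exact hη ⟨t, ht, IsRegularCurve.eq_genericPoint x h ▸ hxt⟩
  have : t = {x} := by rw [← hx.def, hcx.closure_eq]
  rw [this]
  exact Set.finite_singleton x

/-- The valuation of the function field at a closed point. -/
def pointValuation (x : ClosedPoint X) : Valuation X.functionField (WithZero (Multiplicative ℤ)) :=
  (IsDiscreteValuationRing.maximalIdeal (X.presheaf.stalk x.1)).valuation X.functionField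

theorem pointValuation_le_one_iff (x : ClosedPoint X) (a : X.functionField) :
    pointValuation x a ≤ 1 ↔ ∃ r, algebraMap (X.presheaf.stalk x.1) X.functionField r = a := by
  refine ⟨IsDiscreteValuationRing.exists_lift_of_le_one, ?_⟩
  rintro ⟨r, rfl⟩
  exact IsDedekindDomain.HeightOneSpectrum.valuation_le_one _ r

theorem pointValuation_algebraMap_lt_one_iff (x : ClosedPoint X) (r : X.presheaf.stalk x.1) :
    pointValuation x (algebraMap _ _ r) < 1 ↔ r ∈ IsLocalRing.maximalIdeal _ :=
  IsDedekindDomain.HeightOneSpectrum.valuation_lt_one_iff_mem _ r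

theorem ordK_eq_neg_log (x : ClosedPoint X) (a : X.functionField) :
    ordK (X.presheaf.stalk x.1) a = - WithZero.log (pointValuation x a) := by
  rw [ordK, Ring.ordFrac_eq_valuation_inv, WithZero.log_inv]
  rfl

theorem finite_pointValuation_ne_one {a : X.functionField} (ha : a ≠ 0) :
    {x : ClosedPoint X | pointValuation x a ≠ 1}.Finite := by
  obtain ⟨U, -, r, hU, rfl, hr⟩ := exists_isUnit_germ_eq X a ha
  obtain ⟨y⟩ := id hU
  have : (Subtype.val '' {x : ClosedPoint X | pointValuation x (X.germToFunctionField U r) ≠ 1} :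
      Set X).Finite := by
    refine (finite_of_isClosed (Z := (U : Set X)ᶜ) U.isOpen.isClosed_compl
      (fun h => h (genericPoint_mem y.2))).subset ?_
    rintro _ ⟨x, hx, rfl⟩ hxU
    refine hx (le_antisymm ?_ (not_lt.1 fun h => ?_))
    · rw [pointValuation_le_one_iff]
      exact ⟨_, algebraMap_germ hxU r⟩
    · rw [← Scheme.algebraMap_germ_eq_germToFunctionField X hxU,
        pointValuation_algebraMap_lt_one_iff] at h
      exact h (hr.map _)
  exact this.of_finite_image Subtype.val_injective.injOn

theorem exists_germ_eq_of_forall {V : X.Opens} (hV : genericPoint X ∈ V) (a : X.functionField)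
    (h : ∀ x : ClosedPoint X, x.1 ∈ V → pointValuation x a ≤ 1) :
    ∃ r : Γ(X, V), X.presheaf.germ V (genericPoint X) hV r = a := by
  have key (x : V) : ∃ (U : X.Opens) (_ : U ⟶ V) (hx : x.1 ∈ U) (s : Γ(X, U)),
      X.presheaf.germ U (genericPoint X) (genericPoint_mem hx) s = a := by
    have : ∃ r, algebraMap (X.presheaf.stalk x.1) X.functionField r = a := by
      by_cases hx : IsClosed {x.1}
      · exact (pointValuation_le_one_iff ⟨x.1, hx⟩ a).1 (h ⟨x.1, hx⟩ x.2)
      · obtain ⟨x, hxV⟩ := x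
        obtain rfl := IsRegularCurve.eq_genericPoint x hx
        obtain ⟨U, hU, s, rfl⟩ := X.presheaf.exists_germ_eq a
        exact ⟨_, algebraMap_germ hU s⟩
    obtain ⟨r, rfl⟩ := this
    obtain ⟨U, hU, s, rfl⟩ := X.presheaf.exists_germ_eq r
    refine ⟨U ⊓ V, homOfLE inf_le_right, ⟨hU, x.2⟩, X.presheaf.map (homOfLE inf_le_left).op s, ?_⟩
    rw [X.presheaf.germ_res_apply, algebraMap_germ]
  choose U i hx s hs using key
  obtain ⟨r, hr, -⟩ := X.sheaf.existsUnique_gluing' U V i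
    (fun x hx' => Opens.mem_iSup.2 ⟨⟨x, hx'⟩, hx ⟨x, hx'⟩⟩) s fun x y => by
      have hη : genericPoint X ∈ U x ⊓ U y := ⟨genericPoint_mem (hx x), genericPoint_mem (hx y)⟩
      refine germ_injective_of_isIntegral X _ hη ?_
      exact (X.presheaf.germ_res_apply _ _ hη _).trans
        (((hs x).trans (hs y).symm).trans (X.presheaf.germ_res_apply _ _ hη _).symm)
  refine ⟨r, ?_⟩
  have h1 := X.presheaf.germ_res_apply (i ⟨_, hV⟩) _ (hx ⟨_, hV⟩) r
  rw [← h1, ← hs ⟨_, hV⟩]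
  exact congrArg _ (hr _)

theorem eq_of_forall_pointValuation_le_one [X.IsSeparated] {x y : ClosedPoint X}
    (h : ∀ a, pointValuation x a ≤ 1 → pointValuation y a ≤ 1) : x = y := by
  have hle : (algebraMap (X.presheaf.stalk x.1) X.functionField).range ≤
      (algebraMap (X.presheaf.stalk y.1) X.functionField).range := by
    rintro _ ⟨r, rfl⟩
    exact (pointValuation_le_one_iff y _).1 (h _ ((pointValuation_le_one_iff x _).2 ⟨r, rfl⟩))
  have hinj := IsFractionRing.injective (X.presheaf.stalk y.1) X.functionField
  let e := RingEquiv.ofBijective (algebraMap (X.presheaf.stalk y.1) X.functionField).rangeRestrict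
    ⟨fun a b hab => hinj (congrArg Subtype.val hab), RingHom.rangeRestrict_surjective _⟩
  let φ : X.presheaf.stalk x.1 →+* X.presheaf.stalk y.1 := e.symm.toRingHom.comp
    ((Subring.inclusion hle).comp (algebraMap (X.presheaf.stalk x.1) X.functionField).rangeRestrict)
  have hφ (r) : algebraMap (X.presheaf.stalk y.1) X.functionField (φ r) =
      algebraMap (X.presheaf.stalk x.1) X.functionField r :=
    congrArg Subtype.val (e.apply_symm_apply _)
  have hsp (z : X) : genericPoint X ⤳ z := (genericPoint_spec X).specializes trivial
  have hcomp : CommRingCat.ofHom φ ≫ X.presheaf.stalkSpecializes (hsp y.1) =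
      X.presheaf.stalkSpecializes (hsp x.1) := by
    ext r
    exact hφ r
  have hdom : IsDominant (Spec.map (X.presheaf.stalkSpecializes (hsp y.1))) := by
    constructor
    exact PrimeSpectrum.denseRange_comap_iff_ker_le_nilRadical _ |>.2
      (((RingHom.injective_iff_ker_eq_bot _).1 hinj).trans_le bot_le)
  have heq : X.fromSpecStalk y.1 = Spec.map (CommRingCat.ofHom φ) ≫ X.fromSpecStalk x.1 := by
    refine ext_of_isDominant (Spec.map (X.presheaf.stalkSpecializes (hsp y.1))) ?_
    rw [← Category.assoc, ← Spec.map_comp, hcomp, Scheme.SpecMap_stalkSpecializes_fromSpecStalk,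
      Scheme.SpecMap_stalkSpecializes_fromSpecStalk]
  have hy : y.1 ∈ Set.range (X.fromSpecStalk x.1) := by
    rw [← Scheme.fromSpecStalk_closedPoint (x := y.1), heq]
    exact ⟨_, rfl⟩
  rw [Scheme.range_fromSpecStalk] at hy
  have hxy := specializes_iff_mem_closure.1 hy
  rw [y.2.closure_eq] at hxy
  exact Subtype.ext hxy

end Finiteness

section ProductFormulaCurve

theorem bijective_toStalk {k : Type u} [Field k] (y : PrimeSpectrum k) :
    Function.Bijective (StructureSheaf.toStalk k y) :=
  IsField.localization_map_bijective (M := y.asIdeal.primeCompl)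
    (Rₘ := (Spec.structureSheaf k).presheaf.stalk y) (fun h => h (zero_mem y.asIdeal))
      (Field.toIsField k)

theorem bijective_base_to_residueField {k : Type u} [Field k] (y : Spec (.of k)) :
    Function.Bijective (Spec.preimage ((Spec (.of k)).fromSpecResidueField y)).hom := by
  have h : Spec.preimage ((Spec (.of k)).fromSpecResidueField y) =
      (Scheme.ΓSpecIso (.of k)).inv ≫ (Spec (.of k)).presheaf.germ ⊤ y trivial ≫
        (Spec (.of k)).residue y := by
    refine Spec.map_injective ?_
    rw [Spec.map_preimage, Scheme.fromSpecResidueField, Spec.fromSpecStalk_eq, ← Spec.map_comp,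
      Category.assoc]
  refine ⟨RingHom.injective _, ?_⟩
  rw [h]
  exact (Ideal.Quotient.mk_surjective).comp (bijective_toStalk y).2

variable {k : Type u} [Field k] (f : X ⟶ Spec (.of k))

/-- The structure map of the local ring at a point of a `k`-scheme. -/
def baseToStalk (x : X) : .of k ⟶ X.presheaf.stalk x := Spec.preimage (X.fromSpecStalk x ≫ f)

theorem baseToStalk_eq (x : X) : baseToStalk f x =
    (Scheme.ΓSpecIso (.of k)).inv ≫ f.appTop ≫ X.presheaf.germ ⊤ x trivial := by
  refine Spec.map_injective ?_
  rw [baseToStalk, Spec.map_preimage, Spec.map_comp, Spec.map_comp, ← Scheme.fromSpecStalk_toSpecΓ]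
  simp only [Category.assoc]
  rw [← Scheme.toSpecΓ_naturality_assoc, toSpecΓ_SpecMap_ΓSpecIso_inv, Category.comp_id]

theorem baseToStalk_comp_residue (x : X) : Spec.map (baseToStalk f x ≫ X.residue x) =
    X.fromSpecResidueField x ≫ f := by
  rw [Spec.map_comp, baseToStalk, Spec.map_preimage, ← Category.assoc]
  rfl

theorem finrank_residueField (x : X) :
    let := (baseToStalk f x ≫ X.residue x).hom.toAlgebra
    Module.finrank k (X.residueField x) = f.residueDegree x := by
  let := (baseToStalk f x ≫ X.residue x).hom.toAlgebra
  let := (f.residueFieldMap x).hom.toAlgebra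
  refine Algebra.finrank_eq_of_equiv_equiv
    (RingEquiv.ofBijective _ (bijective_base_to_residueField (f x))) (RingEquiv.refl _) ?_
  have : baseToStalk f x ≫ X.residue x =
      Spec.preimage ((Spec (.of k)).fromSpecResidueField (f x)) ≫ f.residueFieldMap x := by
    refine Spec.map_injective ?_
    rw [baseToStalk_comp_residue, Spec.map_comp, Spec.map_preimage,
      Scheme.Hom.SpecMap_residueFieldMap_fromSpecResidueField]
  exact (congrArg CommRingCat.Hom.hom this).symm

theorem finite_residueField [LocallyOfFiniteType f] (x : ClosedPoint X) :
    let := (baseToStalk f x.1 ≫ X.residue x.1).hom.toAlgebra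
    Module.Finite k (X.residueField x.1) := by
  have : IsClosedImmersion (X.fromSpecResidueField x.1) :=
    isClosed_singleton_iff_isClosedImmersion.mp x.2
  have : IsFinite (X.fromSpecResidueField x.1 ≫ f) := by
    rw [isFinite_iff_locallyOfFiniteType_of_jacobsonSpace]
    infer_instance
  rwa [← baseToStalk_comp_residue, IsFinite.SpecMap_iff] at this

theorem residueDegree_pos [LocallyOfFiniteType f] (x : ClosedPoint X) :
    0 < f.residueDegree x.1 := by
  let := (baseToStalk f x.1 ≫ X.residue x.1).hom.toAlgebra
  have := finite_residueField f x
  rw [← finrank_residueField]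
  exact Module.finrank_pos (R := k) (M := X.residueField x.1)

variable [IsIntegral X]

theorem algebraMap_baseToStalk (x : X) (c : k) :
    algebraMap (X.presheaf.stalk x) X.functionField (baseToStalk f x c) =
      baseToStalk f (genericPoint X) c := by
  rw [baseToStalk_eq, baseToStalk_eq]
  exact algebraMap_germ (U := ⊤) trivial _

variable [IsRegularCurve X]

/-- The rational functions that are regular at `x`. -/
def localRingEquiv (x : ClosedPoint X) :
    let := (baseToStalk f (genericPoint X)).hom.toAlgebra
    let := (baseToStalk f x.1).hom.toAlgebra
    ∀ h : ∀ c : k, pointValuation x (algebraMap k X.functionField c) ≤ 1,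
      X.presheaf.stalk x.1 ≃ₗ[k] valuationBall (pointValuation x) h 1 :=
  let := (baseToStalk f (genericPoint X)).hom.toAlgebra
  let := (baseToStalk f x.1).hom.toAlgebra
  fun h => LinearEquiv.ofBijective
    { toFun := fun r => ⟨algebraMap (X.presheaf.stalk x.1) X.functionField r,
        (pointValuation_le_one_iff x _).2 ⟨r, rfl⟩⟩
      map_add' := fun a b => Subtype.ext (map_add _ a b)
      map_smul' := fun c a => Subtype.ext (by
        change algebraMap _ X.functionField (baseToStalk f x.1 c * a) =
          baseToStalk f (genericPoint X) c * algebraMap _ X.functionField a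
        rw [map_mul, algebraMap_baseToStalk]) }
    ⟨fun _ _ hab => IsFractionRing.injective _ X.functionField (congrArg Subtype.val hab),
      fun a => ((pointValuation_le_one_iff x _).1 a.2).imp fun _ h => Subtype.ext h⟩

theorem finsum_residueDegree_mul_ordK [IsProper f] {a : X.functionField} (ha : a ≠ 0) :
    ∑ᶠ x : ClosedPoint X, (f.residueDegree x.1 : ℤ) * ordK (X.presheaf.stalk x.1) a = 0 := by
  let := (baseToStalk f (genericPoint X)).hom.toAlgebra
  let (x : ClosedPoint X) : Algebra k (X.presheaf.stalk x.1) := (baseToStalk f x.1).hom.toAlgebra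
  let (x : ClosedPoint X) : Algebra k (X.residueField x.1) :=
    (baseToStalk f x.1 ≫ X.residue x.1).hom.toAlgebra
  have hle (x : ClosedPoint X) (c : k) : pointValuation x (algebraMap k X.functionField c) ≤ 1 :=
    (pointValuation_le_one_iff x _).2 ⟨_, algebraMap_baseToStalk f x.1 c⟩
  have : X.IsSeparated := by
    rw [Scheme.isSeparated_iff, ← terminal.comp_from f]
    infer_instance
  let res (x : ClosedPoint X) : X.presheaf.stalk x.1 →ₗ[k] X.residueField x.1 :=
    { toFun := X.residue x.1
      map_add' := map_add _
      map_smul' := fun c a => map_mul (X.residue x.1).hom _ a }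
  let h : CurveValuations k (pointValuation (X := X)) fun x => X.residueField x.1 :=
    { le_one := hle
      exists_uniformizer := fun x =>
        IsDedekindDomain.HeightOneSpectrum.valuation_exists_uniformizer _ _
      finite := fun a ha => finite_pointValuation_ne_one ha
      incomparable := fun x y hxy => by
        by_contra! hcon
        exact hxy (eq_of_forall_pointValuation_le_one hcon)
      residue := fun x => res x ∘ₗ (localRingEquiv f x (hle x)).symm.toLinearMap
      residue_surjective := fun x =>
        Ideal.Quotient.mk_surjective.comp (localRingEquiv f x (hle x)).symm.surjective
      residue_eq_zero := fun x a => by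
        obtain ⟨a, rfl⟩ := (localRingEquiv f x (hle x)).surjective a
        rw [LinearMap.comp_apply, LinearEquiv.coe_coe, LinearEquiv.symm_apply_apply]
        exact Ideal.Quotient.eq_zero_iff_mem.trans (pointValuation_algebraMap_lt_one_iff x a).symm
      finite_residue := fun x => finite_residueField f x
      finite_const := by
        have hfin := finite_appTop_of_universallyClosed k f
        have hfin' : ((Scheme.ΓSpecIso (.of k)).inv ≫ f.appTop).hom.Finite := by
          rw [CommRingCat.hom_comp]
          exact hfin.comp (RingHom.Finite.of_surjective _
            (Scheme.ΓSpecIso (.of k)).symm.commRingCatIsoToRingEquiv.surjective)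
        let := ((Scheme.ΓSpecIso (.of k)).inv ≫ f.appTop).hom.toAlgebra
        have : Module.Finite k Γ(X, ⊤) := hfin'
        let g : Γ(X, ⊤) →ₗ[k]
            (⨅ x, valuationBall (pointValuation x) (hle x) 1 : Submodule k X.functionField) :=
          { toFun := fun r => ⟨X.presheaf.germ ⊤ (genericPoint X) trivial r,
              (Submodule.mem_iInf _).2 fun x => (pointValuation_le_one_iff x _).2
                ⟨_, algebraMap_germ (U := ⊤) (x := x.1) trivial r⟩⟩
            map_add' := fun a b => Subtype.ext (map_add _ a b)
            map_smul' := fun c a => Subtype.ext (by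
              change X.presheaf.germ ⊤ (genericPoint X) trivial (_ * a) = baseToStalk f _ c * _
              rw [map_mul, baseToStalk_eq]
              rfl) }
        refine Module.Finite.of_surjective g fun a => ?_
        · obtain ⟨r, hr⟩ := exists_germ_eq_of_forall (V := ⊤) trivial a.1
            fun x _ => (Submodule.mem_iInf _).1 a.2 x
          exact ⟨r, Subtype.ext hr⟩ }
  have h0 := h.finsum_log_eq_zero ha
  rw [← neg_eq_zero, ← finsum_neg_distrib] at h0
  rw [← h0]
  refine finsum_congr fun x => ?_
  rw [ordK_eq_neg_log, mul_neg, CurveValuations.weight, finrank_residueField]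

end ProductFormulaCurve

end

section

section SheafDegree

theorem exists_basis_of_exact {K VA VB VC κ κ' : Type*} [Field K] [AddCommGroup VA]
    [AddCommGroup VB] [AddCommGroup VC] [Module K VA] [Module K VB] [Module K VC]
    {F : VA →ₗ[K] VB} {G : VB →ₗ[K] VC} (hF : Function.Injective F) (hG : Function.Surjective G)
    (hFG : Function.Exact F G) (a : Module.Basis κ K VA) (c : Module.Basis κ' K VC) :
    ∃ b : Module.Basis (κ ⊕ κ') K VB, (∀ i, b (.inl i) = F (a i)) ∧ ∀ j, G (b (.inr j)) = c j := by
  obtain ⟨l, hl⟩ := LinearMap.exists_rightInverse_of_surjective G (LinearMap.range_eq_top.2 hG)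
  obtain ⟨e, h1, h2⟩ := hFG.splitSurjectiveEquiv hF ⟨l, hl⟩
  refine ⟨(a.prod c).map e.symm, fun i => ?_, fun j => ?_⟩
  · rw [h1]
    simp
  · rw [h2]
    simp

theorem isZero_of_forall_germ {M : X.Modules} (h : ∀ (x : X) (m : stalk M x), m = 0) :
    IsZero M := by
  have key (U : X.Opens) (s : Γ(M, U)) : s = 0 :=
    TopCat.Presheaf.section_ext ⟨M.presheaf, M.isSheaf⟩ U s 0 fun x hx =>
      (h x (germ M hx s)).trans (h x (germ M hx 0)).symm
  refine (IsZero.iff_id_eq_zero M).2 (Scheme.Modules.hom_ext _ _ fun U => ?_)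
  ext s
  exact key U s

variable [IsIntegral X]

attribute [local instance 10] genericStalkModule

theorem isScalarTower_genericStalk (M : X.Modules) (x : X) :
    IsScalarTower (X.presheaf.stalk x) X.functionField (genericStalk M) :=
  ⟨fun r a v => by
    rw [Algebra.smul_def, mul_smul]
    rfl⟩

theorem IsQCoh.isGenericFibre {M : X.Modules} (hM : IsQCoh M) (x : X) :
    IsGenericFibre (toGenericLinear M x) where
  exists_smul_eq v := by
    obtain ⟨r, hr, m, hm⟩ := hM.exists_smul_eq_toGenericStalk x v
    exact ⟨r, hr, m, hm.symm⟩
  exists_smul_eq_zero m hm := hM.exists_smul_eq_zero x m hm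

theorem localDegree_eq_latticeDegree (M : X.Modules) {κ : Type*} (b : κ → genericStalk M) (x : X) :
    localDegree M b x = latticeDegree (toGenericLinear M x) b := by
  have : Submodule.span (X.presheaf.stalk x) (Set.range (toGenericStalk M x)) =
      LinearMap.range (toGenericLinear M x) :=
    (congrArg _ (LinearMap.coe_range (toGenericLinear M x)).symm).trans (Submodule.span_eq _)
  rw [localDegree, this]
  rfl

theorem IsCoherent.finite_genericStalk {M : X.Modules} (hM : IsCoherent M) :
    Module.Finite X.functionField (genericStalk M) :=
  hM.finite_stalk _

theorem subsingleton_genericStalk {M : X.Modules} (hM : IsCoherent M) (h0 : rank M = 0) :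
    Subsingleton (genericStalk M) :=
  have := hM.finite_genericStalk
  Module.finrank_zero_iff.1 h0

theorem exists_forall_germ_mem_span {M : X.Modules} {U : X.Opens} (hη : genericPoint X ∈ U)
    {κ : Type*} (s : κ → Γ(M, U)) {v : genericStalk M}
    (hv : v ∈ Submodule.span X.functionField (Set.range fun i => germ M hη (s i))) :
    ∃ (V : X.Opens) (hV : V ≤ U) (hη' : genericPoint X ∈ V) (m : Γ(M, V)), germ M hη' m = v ∧
      ∀ (x : X) (hx : x ∈ V), germ M hx m ∈
        Submodule.span (X.presheaf.stalk x) (Set.range fun i => germ M (hV hx) (s i)) := by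
  induction hv using Submodule.span_induction with
  | mem v hv =>
    obtain ⟨i, rfl⟩ := hv
    exact ⟨U, le_rfl, hη, s i, rfl, fun x hx => Submodule.subset_span ⟨i, rfl⟩⟩
  | zero => exact ⟨U, le_rfl, hη, 0, map_zero _, fun x hx => by rw [map_zero]; exact zero_mem _⟩
  | add v w _ _ hv hw =>
    obtain ⟨V, hV, hη₁, m, rfl, hm⟩ := hv
    obtain ⟨W, hW, hη₂, n, rfl, hn⟩ := hw
    have hη₃ : genericPoint X ∈ V ⊓ W := ⟨hη₁, hη₂⟩
    refine ⟨V ⊓ W, inf_le_left.trans hV, hη₃,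
      M.presheaf.map (Opens.infLELeft V W).op m + M.presheaf.map (Opens.infLERight V W).op n,
      ?_, fun x hx => ?_⟩
    · rw [map_add, germ_res, germ_res]
    · rw [map_add, germ_res, germ_res]
      exact add_mem (hm x _) (hn x _)
  | smul a v _ hv =>
    obtain ⟨V, hV, hη₁, m, rfl, hm⟩ := hv
    obtain ⟨W, hη₂, r, rfl⟩ := X.presheaf.exists_germ_eq a
    have hη₃ : genericPoint X ∈ V ⊓ W := ⟨hη₁, hη₂⟩
    refine ⟨V ⊓ W, inf_le_left.trans hV, hη₃, X.presheaf.map (Opens.infLERight V W).op r •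
      M.presheaf.map (Opens.infLELeft V W).op m, ?_, fun x hx => ?_⟩
    · rw [germ_smul, germ_res, X.presheaf.germ_res_apply]
    · rw [germ_smul, germ_res]
      exact Submodule.smul_mem _ _ (hm x _)

/-- A finite family of sections of a coherent sheaf that generates the generic stalk generates all
stalks on a neighbourhood of the generic point. -/
theorem IsCoherent.exists_span_germ_eq_top {M : X.Modules} (hM : IsCoherent M) {κ : Type*}
    [Finite κ] {b : κ → genericStalk M} (hb : Submodule.span X.functionField (Set.range b) = ⊤) :
    ∃ (U : X.Opens) (s : κ → Γ(M, U)) (hη : genericPoint X ∈ U),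
      (∀ i, germ M hη (s i) = b i) ∧ ∀ (x : X) (hx : x ∈ U),
        Submodule.span (X.presheaf.stalk x) (Set.range fun i => germ M hx (s i)) = ⊤ := by
  choose W hW s hs using fun i => exists_germ_eq M (b i)
  let W' : X.Opens := ⟨⋂ i, W i, isOpen_iInter_of_finite fun i => (W i).isOpen⟩
  have hW' : genericPoint X ∈ W' := Set.mem_iInter.2 hW
  obtain ⟨V, hV, hηV, hVW⟩ := exists_isAffineOpen_mem_le hW'
  have hVi (i) : V ≤ W i := hVW.trans fun x hx => Set.mem_iInter.1 hx i
  let t (i) : Γ(M, V) := M.presheaf.map (homOfLE (hVi i)).op (s i)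
  have ht (i) : germ M hηV (t i) = b i := (germ_res M _ hηV _).trans (hs i)
  obtain ⟨S, hS⟩ := hM.finite V hV
  have key (g : Γ(M, V)) : ∃ U : X.Opens, genericPoint X ∈ U ∧ ∀ (x : X) (_ : x ∈ U) (hx : x ∈ V),
      germ M hx g ∈ Submodule.span (X.presheaf.stalk x) (Set.range fun i => germ M hx (t i)) := by
    obtain ⟨A, hA, hη, m, hm, hmem⟩ := exists_forall_germ_mem_span hηV t (v := germ M hηV g) (by
      rw [funext ht, hb]
      trivial)
    obtain ⟨B, i, hB, h0⟩ := exists_res_eq_zero M hη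
      (M.presheaf.map (homOfLE hA).op g - m) (by rw [map_sub, germ_res, hm, sub_self])
    refine ⟨B, hB, fun x hxB hx => ?_⟩
    have h1 := congrArg (germ M hxB) h0
    rw [germ_res, map_zero, map_sub, germ_res, sub_eq_zero] at h1
    rw [h1]
    exact hmem x _
  choose U hU hUspan using key
  let U' : X.Opens := V ⊓ ⟨⋂ g : S, U g, isOpen_iInter_of_finite fun g => (U g).isOpen⟩
  have hU' : U' ≤ V := inf_le_left
  have hηU : genericPoint X ∈ U' := ⟨hηV, Set.mem_iInter.2 fun g => hU g⟩
  refine ⟨U', fun i => M.presheaf.map (homOfLE hU').op (t i), hηU,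
    fun i => (germ_res M _ hηU _).trans (ht i), fun x hx => ?_⟩
  simp only [germ_res]
  rw [eq_top_iff, ← hM.span_germ_eq_top hV (hU' hx) hS, Submodule.span_le]
  rintro _ ⟨g, hg, rfl⟩
  exact hUspan g x (Set.mem_iInter.1 hx.2 ⟨g, hg⟩) _

variable [IsRegularCurve X]

theorem finite_localDegree_ne_zero {M : X.Modules} (hM : IsCoherent M) {κ : Type*}
    [Finite κ] (b : Module.Basis κ X.functionField (genericStalk M)) :
    {x : ClosedPoint X | localDegree M b x.1 ≠ 0}.Finite := by
  have := Fintype.ofFinite κ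
  obtain ⟨U, s, hη, hs, hspan⟩ := hM.exists_span_germ_eq_top b.span_eq
  refine Set.Finite.of_finite_image ((finite_of_isClosed U.isOpen.isClosed_compl
    fun h => h hη).subset ?_) Subtype.val_injective.injOn
  rintro _ ⟨x, hx, rfl⟩ hxU
  refine hx ?_
  have := isScalarTower_genericStalk M x.1
  have := hM.finite_stalk x.1
  rw [localDegree_eq_latticeDegree, latticeDegree_eq (hM.isQCoh.isGenericFibre x.1) b one_ne_zero
    (m := fun i => germ M hxU (s i)) fun i => by
      rw [one_smul, ← hs]
      exact toGenericStalk_germ M hxU (s i), hspan x.1 hxU, Ideal.span_singleton_one]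
  simp [len, Module.length_eq_zero]

theorem exists_localDegree_eq_add {M : X.Modules} (hM : IsCoherent M) {κ κ' : Type*} [Finite κ]
    (b : Module.Basis κ X.functionField (genericStalk M))
    (b' : Module.Basis κ' X.functionField (genericStalk M)) :
    ∃ a : X.functionField, a ≠ 0 ∧ ∀ x : ClosedPoint X,
      localDegree M b' x.1 = localDegree M b x.1 + ordK (X.presheaf.stalk x.1) a := by
  classical
  have := Fintype.ofFinite κ
  let c := b'.reindex (b'.indexEquiv b)
  have hdet : (b.toMatrix c).transpose.det ≠ 0 := by
    rw [Matrix.det_transpose, ← Module.Basis.det_apply]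
    exact (b.isUnit_det c).ne_zero
  refine ⟨_, hdet, fun x => ?_⟩
  have := isScalarTower_genericStalk M x.1
  have := hM.finite_stalk x.1
  rw [localDegree_eq_latticeDegree, localDegree_eq_latticeDegree,
    ← latticeDegree_of_matrix (hM.isQCoh.isGenericFibre x.1) b c hdet fun i =>
      (b.sum_toMatrix_smul_self c i).symm]
  refine latticeDegree_congr _ ?_
  rw [Module.Basis.range_reindex]

variable {k : Type u} [Field k] (f : X ⟶ Spec (.of k)) [IsProper f]

theorem finite_ordK_ne_zero {a : X.functionField} (ha : a ≠ 0) :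
    {x : ClosedPoint X | ordK (X.presheaf.stalk x.1) a ≠ 0}.Finite := by
  refine (finite_pointValuation_ne_one ha).subset fun x hx h => hx ?_
  rw [ordK_eq_neg_log, h, WithZero.log_one, neg_zero]

theorem degree_eq {M : X.Modules} (hM : IsCoherent M) {κ : Type*} [Finite κ]
    (b : Module.Basis κ X.functionField (genericStalk M)) :
    degree f M = ∑ᶠ x : ClosedPoint X, (f.residueDegree x.1 : ℤ) * localDegree M b x.1 := by
  obtain ⟨a, ha, h⟩ := exists_localDegree_eq_add hM b (Module.Basis.ofVectorSpace _ _)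
  rw [degree, finsum_congr fun x => by rw [h x, mul_add], finsum_add_distrib,
    finsum_residueDegree_mul_ordK f ha, add_zero]
  · exact (finite_localDegree_ne_zero hM b).subset fun x hx h => hx (by simp [h])
  · exact (finite_ordK_ne_zero ha).subset fun x hx h => hx (by simp [h])

section Exact

variable {S : ShortComplex X.Modules} (hS : S.ShortExact) (h₁ : IsCoherent S.X₁)
  (h₂ : IsCoherent S.X₂) (h₃ : IsCoherent S.X₃)

include hS h₁ h₂ h₃

theorem exists_basis_genericStalk_of_shortExact :
    ∃ (κ κ' : Type u) (_ : Fintype κ) (_ : Fintype κ')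
      (a : Module.Basis κ X.functionField (genericStalk S.X₁))
      (b : Module.Basis (κ ⊕ κ') X.functionField (genericStalk S.X₂))
      (c : Module.Basis κ' X.functionField (genericStalk S.X₃)),
      ∀ x : ClosedPoint X,
        localDegree S.X₂ b x.1 = localDegree S.X₁ a x.1 + localDegree S.X₃ c x.1 := by
  have := hS.mono_f
  have := hS.epi_g
  have := h₁.finite_genericStalk
  have := h₃.finite_genericStalk
  have hinj (x : X) := stalkMap_injective S.f x
  have hsurj (x : X) := stalkMap_surjective S.g h₂.isQCoh h₃.isQCoh x
  have hex (x : X) := stalkMap_exact hS x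
  let a := Module.Basis.ofVectorSpace X.functionField (genericStalk S.X₁)
  let c := Module.Basis.ofVectorSpace X.functionField (genericStalk S.X₃)
  obtain ⟨b, hba, hbc⟩ := exists_basis_of_exact (K := X.functionField) (VA := genericStalk S.X₁)
    (VB := genericStalk S.X₂) (VC := genericStalk S.X₃) (hinj (genericPoint X))
    (hsurj (genericPoint X)) (hex (genericPoint X)) a c
  refine ⟨_, _, Fintype.ofFinite _, Fintype.ofFinite _, a, b, c, fun x => ?_⟩
  have := isScalarTower_genericStalk S.X₁ x.1
  have := isScalarTower_genericStalk S.X₂ x.1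
  have := isScalarTower_genericStalk S.X₃ x.1
  have := h₁.finite_stalk x.1
  have := h₂.finite_stalk x.1
  have := h₃.finite_stalk x.1
  simp only [localDegree_eq_latticeDegree]
  exact latticeDegree_add (h₁.isQCoh.isGenericFibre x.1) (h₂.isQCoh.isGenericFibre x.1)
    (h₃.isQCoh.isGenericFibre x.1) (hinj x.1) (hsurj x.1) (hex x.1)
    (F := stalkMap S.f (genericPoint X)) (G := stalkMap S.g (genericPoint X))
    (fun m => toGenericStalk_stalkMap S.f x.1 m) (fun m => toGenericStalk_stalkMap S.g x.1 m)
    a c b hba hbc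

theorem rank_add : rank S.X₂ = rank S.X₁ + rank S.X₃ := by
  obtain ⟨κ, κ', _, _, a, b, c, -⟩ := exists_basis_genericStalk_of_shortExact hS h₁ h₂ h₃
  rw [rank, rank, rank, Module.finrank_eq_card_basis a, Module.finrank_eq_card_basis b,
    Module.finrank_eq_card_basis c, Fintype.card_sum]

theorem degree_add : degree f S.X₂ = degree f S.X₁ + degree f S.X₃ := by
  obtain ⟨κ, κ', _, _, a, b, c, h⟩ := exists_basis_genericStalk_of_shortExact hS h₁ h₂ h₃
  rw [degree_eq f h₁ a, degree_eq f h₂ b, degree_eq f h₃ c, ← finsum_add_distrib]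
  · exact finsum_congr fun x => by rw [h x, mul_add]
  · exact (finite_localDegree_ne_zero h₁ a).subset fun x hx h => hx (by simp [h])
  · exact (finite_localDegree_ne_zero h₃ c).subset fun x hx h => hx (by simp [h])

end Exact

section Torsion

variable {M : X.Modules} (hM : IsCoherent M) (h0 : rank M = 0)

include hM h0

theorem localDegree_of_rank_eq_zero {κ : Type*} (b : κ → genericStalk M) (x : ClosedPoint X) :
    localDegree M b x.1 = len (X.presheaf.stalk x.1) (stalk M x.1) := by
  have := subsingleton_genericStalk hM h0
  have := isScalarTower_genericStalk M x.1
  have := hM.finite_stalk x.1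
  have h := latticeDegree_eq (hM.isQCoh.isGenericFibre x.1)
    (Module.Basis.empty (ι := Empty) (R := X.functionField) (genericStalk M)) one_ne_zero
    (m := Empty.elim) (fun i => i.elim)
  rw [Fintype.card_empty, Nat.cast_zero, zero_mul, sub_zero, Set.range_eq_empty,
    Submodule.span_empty] at h
  rw [localDegree_eq_latticeDegree, ← len_congr (Submodule.quotEquivOfEqBot _ rfl), ← h]
  refine latticeDegree_congr _ ?_
  rw [Subsingleton.elim (Submodule.span _ (Set.range b)) ⊥]
  exact Subsingleton.elim _ _

theorem degree_nonneg_of_rank_eq_zero (f : X ⟶ Spec (.of k)) : 0 ≤ degree f M := by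
  refine finsum_nonneg fun x => mul_nonneg (by positivity) ?_
  rw [localDegree_of_rank_eq_zero hM h0]
  exact Int.natCast_nonneg _

theorem isZero_of_degree_eq_zero (hdeg : degree f M = 0) : IsZero M := by
  have := subsingleton_genericStalk hM h0
  have := hM.finite_genericStalk
  refine isZero_of_forall_germ fun x => ?_
  by_cases hx : IsClosed {x}
  · have h1 :
        localDegree M (Module.Basis.ofVectorSpace X.functionField (genericStalk M)) x = 0 := by
      have hnn (y : ClosedPoint X) : 0 ≤ localDegree M
          (Module.Basis.ofVectorSpace X.functionField (genericStalk M)) y.1 := by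
        rw [localDegree_of_rank_eq_zero hM h0]
        exact Int.natCast_nonneg _
      have h1 := single_le_finsum (⟨x, hx⟩ : ClosedPoint X)
        (f := fun y => (f.residueDegree y.1 : ℤ) * localDegree M
          (Module.Basis.ofVectorSpace X.functionField (genericStalk M)) y.1)
        ((finite_localDegree_ne_zero hM (Module.Basis.ofVectorSpace _ _)).subset
          fun y hy h => hy (by dsimp only; rw [h, mul_zero])) fun y =>
            mul_nonneg (by positivity) (hnn y)
      have h2 := h1.trans_eq hdeg
      have h3 : (0 : ℤ) < f.residueDegree x := Int.natCast_pos.2 (residueDegree_pos f ⟨x, hx⟩)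
      have h4 := hnn ⟨x, hx⟩
      dsimp only at h2 h4
      nlinarith
    rw [localDegree_of_rank_eq_zero hM h0 _ ⟨x, hx⟩] at h1
    have := hM.finite_stalk x
    have h2 : Module.length (X.presheaf.stalk x) (stalk M x) ≠ ⊤ := by
      have := IsRegularCurve.dvr x hx
      exact length_ne_top_of_isTorsion fun n => hM.isQCoh.exists_smul_eq_zero x n
        (Subsingleton.elim _ _)
    have h3 : Module.length (X.presheaf.stalk x) (stalk M x) = 0 := by
      have : (Module.length (X.presheaf.stalk x) (stalk M x)).toNat = 0 := Int.natCast_eq_zero.1 h1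
      exact (ENat.toNat_eq_zero.1 this).resolve_right h2
    have := Module.length_eq_zero_iff.1 h3
    exact fun m => Subsingleton.elim _ _
  · obtain rfl := IsRegularCurve.eq_genericPoint x hx
    exact fun m => Subsingleton.elim _ _

end Torsion

end SheafDegree

end

section

section LocalIso

/-- An isomorphism between the restrictions of `M` and `N` to `U`. -/
structure LocalIso (U : X.Opens) (M N : X.Modules) where
  /-- the isomorphisms on sections -/
  equiv : ∀ V : X.Opens, V ≤ U → Γ(M, V) ≃ₗ[Γ(X, V)] Γ(N, V)
  map_equiv : ∀ {V W : X.Opens} (hV : V ≤ U) (i : W ⟶ V) (s : Γ(M, V)),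
    N.presheaf.map i.op (equiv V hV s) = equiv W (i.le.trans hV) (M.presheaf.map i.op s)

namespace LocalIso

variable {U : X.Opens} {M N : X.Modules} (e : LocalIso U M N)

/-- The inverse of a local isomorphism. -/
def symm : LocalIso U N M where
  equiv V hV := (e.equiv V hV).symm
  map_equiv {V W} hV i s := by
    rw [LinearEquiv.eq_symm_apply, ← e.map_equiv hV, LinearEquiv.apply_symm_apply]

include e in
theorem isLocalizingOn {V : X.Opens} (hV : V ≤ U) (hM : IsLocalizingOn M V) :
    IsLocalizingOn N V where
  exists_eq f s := by
    obtain ⟨n, t, ht⟩ := hM.exists_eq f ((e.equiv _ ((X.basicOpen_le f).trans hV)).symm s)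
    refine ⟨n, e.equiv V hV t, ?_⟩
    rw [e.map_equiv, ht, LinearEquiv.map_smul, LinearEquiv.apply_symm_apply]
  exists_zero f t ht := by
    obtain ⟨t, rfl⟩ := (e.equiv V hV).surjective t
    rw [e.map_equiv, LinearEquiv.map_eq_zero_iff] at ht
    obtain ⟨n, hn⟩ := hM.exists_zero f t ht
    exact ⟨n, by rw [← LinearEquiv.map_smul, hn, map_zero]⟩

theorem exists_stalkEquiv {x : X} (hx : x ∈ U) :
    ∃ E : stalk M x ≃ₗ[X.presheaf.stalk x] stalk N x, ∀ {V : X.Opens} (hV : V ≤ U) (hxV : x ∈ V)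
      (s : Γ(M, V)), E (germ M hxV s) = germ N hxV (e.equiv V hV s) := by
  have key {M N : X.Modules} (e : LocalIso U M N) :
    ∃ E : stalk M x → stalk N x, ∀ {V : X.Opens} (hV : V ≤ U)
      (hxV : x ∈ V) (s : Γ(M, V)), E (germ M hxV s) = germ N hxV (e.equiv V hV s) := by
    have h (m : stalk M x) : ∃ n : stalk N x, ∀ {V : X.Opens} (hV : V ≤ U)
        (hxV : x ∈ V) (s : Γ(M, V)), germ M hxV s = m → n = germ N hxV (e.equiv V hV s) := by
      obtain ⟨W, hW, t, rfl⟩ := exists_germ_eq M m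
      have hWU : x ∈ W ⊓ U := ⟨hW, hx⟩
      refine ⟨germ N hWU (e.equiv _ inf_le_right (M.presheaf.map (Opens.infLELeft W U).op t)),
        fun {V} hV hxV s hs => ?_⟩
      obtain ⟨A, hA, i, j, hij⟩ := TopCat.Presheaf.germ_eq (C := Ab.{u}) M.presheaf x hxV hW s t hs
      have hA' : x ∈ A := hA
      rw [← germ_res N (homOfLE (le_inf j.le (i.le.trans hV)) : A ⟶ W ⊓ U) hA', ← germ_res N i hA',
        e.map_equiv, e.map_equiv, hij, ← ConcreteCategory.comp_apply, ← Functor.map_comp]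
      rfl
    choose E hE using h
    exact ⟨E, fun hV hxV s => hE _ hV hxV s rfl⟩
  have rep {M : X.Modules} (m : stalk M x) :
      ∃ (V : X.Opens) (_ : V ≤ U) (hxV : x ∈ V) (s : Γ(M, V)), germ M hxV s = m := by
    obtain ⟨W, hW, t, rfl⟩ := exists_germ_eq M m
    exact ⟨W ⊓ U, inf_le_right, ⟨hW, hx⟩, _, germ_res M (Opens.infLELeft W U) _ t⟩
  obtain ⟨E, hE⟩ := key e
  obtain ⟨E', hE'⟩ := key e.symm
  refine ⟨{ toFun := E, map_add' := fun m n => ?_, map_smul' := fun r m => ?_, invFun := E'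
            left_inv := fun m => ?_, right_inv := fun n => ?_ }, fun hV hxV s => hE hV hxV s⟩
  · obtain ⟨V, hV, hxV, s, rfl⟩ := rep m
    obtain ⟨W, hW, hxW, t, rfl⟩ := rep n
    have hxVW : x ∈ V ⊓ W := ⟨hxV, hxW⟩
    rw [← germ_res M (Opens.infLELeft V W) hxVW, ← germ_res M (Opens.infLERight V W) hxVW,
      ← map_add,
      hE (inf_le_left.trans hV), hE (inf_le_left.trans hV), hE (inf_le_left.trans hV), map_add,
      map_add]
  · obtain ⟨V, hV, hxV, s, rfl⟩ := rep m
    obtain ⟨W, hxW, r, rfl⟩ := X.presheaf.exists_germ_eq r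
    have hxVW : x ∈ V ⊓ W := ⟨hxV, hxW⟩
    rw [← germ_res M (Opens.infLELeft V W) hxVW,
      ← X.presheaf.germ_res_apply (Opens.infLERight V W) x hxVW, ← germ_smul,
      hE (inf_le_left.trans hV), hE (inf_le_left.trans hV), LinearEquiv.map_smul, germ_smul]
    rfl
  · obtain ⟨V, hV, hxV, s, rfl⟩ := rep m
    exact (congrArg E' (hE hV hxV s)).trans ((hE' hV hxV _).trans
      (congrArg _ ((e.equiv V hV).symm_apply_apply s)))
  · obtain ⟨V, hV, hxV, s, rfl⟩ := rep n
    exact (congrArg E (hE' hV hxV s)).trans ((hE hV hxV _).trans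
      (congrArg _ ((e.equiv V hV).apply_symm_apply s)))

end LocalIso

theorem IsQCoh.of_localIso {M N : X.Modules} (hM : IsQCoh M)
    (h : ∀ x : X, ∃ U : X.Opens, x ∈ U ∧ Nonempty (LocalIso U M N)) : IsQCoh N := by
  have key (x : X) : ∃ U : X.Opens, IsAffineOpen U ∧ x ∈ U ∧ IsLocalizingOn N U := by
    obtain ⟨U, hxU, ⟨e⟩⟩ := h x
    obtain ⟨V, hV, hxV, hVU⟩ := exists_isAffineOpen_mem_le hxU
    exact ⟨V, hV, hxV, e.isLocalizingOn hVU (hM V hV)⟩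
  choose U hU hxU hN using key
  have := isQuasicoherent_of_isLocalizingOn N U hU
    (eq_top_iff.2 fun x _ => Opens.mem_iSup.2 ⟨x, hxU x⟩) hN
  exact fun V hV => isLocalizingOn_of_isQuasicoherent N this hV

end LocalIso

section TwistLocal

variable [IsIntegral X]

open TensorProduct

/-- Multiplication with a local generator of `𝒪_X(D)` identifies `M` with `M(D)` locally. -/
def IsLocalGenerator.localIso {D : CurveDivisor X} {U : X.Opens} {t : divisorSections D U}
    (ht : IsLocalGenerator D t) (M : X.Modules) : LocalIso U M ((twist D).obj M) where
  equiv V hV := LinearEquiv.ofBijective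
    (twistUnit D M V ∘ₗ (TensorProduct.mk Γ(X, V) Γ(M, V) (divisorSections D V)).flip
      (divisorRes D hV t)) (ht.bijective M hV)
  map_equiv _ i s := twistUnit_res D M i s _

theorem IsLocalGenerator.localIso_apply {D : CurveDivisor X} {U : X.Opens}
    {t : divisorSections D U} (ht : IsLocalGenerator D t) (M : X.Modules) {V : X.Opens} (hV : V ≤ U)
    (m : Γ(M, V)) : (ht.localIso M).equiv V hV m = twistUnit D M V (m ⊗ₜ divisorRes D hV t) := rfl

theorem IsLocalGenerator.localIso_naturality {D : CurveDivisor X} {U : X.Opens}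
    {t : divisorSections D U} (ht : IsLocalGenerator D t) {M N : X.Modules} (φ : M ⟶ N)
    {V : X.Opens} (hV : V ≤ U) (m : Γ(M, V)) :
    ((twist D).map φ).app V ((ht.localIso M).equiv V hV m) =
      (ht.localIso N).equiv V hV (φ.app V m) :=
  twistUnit_map D φ V m _

theorem ratFamily_smul_apply {U : X.Opens} (hU : genericPoint X ∈ U) (r : Γ(X, U))
    (s : RatFamily U) (y : U) : (r • s) y = X.presheaf.germ U _ hU r * s y :=
  (RatFamily.smul_apply r s y).trans
    ((Algebra.smul_def _ _).trans (congrArg (· * s y) (algebraMap_germ y.2 r)))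

variable [IsRegularCurve X]

theorem pointValuation_le_exp_iff (x : ClosedPoint X) (n : ℕ) (a : X.functionField) :
    pointValuation x a ≤ WithZero.exp (-(n : ℤ)) ↔ a ∈ IsLocalization.coeSubmodule X.functionField
      (IsLocalRing.maximalIdeal (X.presheaf.stalk x.1) ^ n) := by
  rw [IsLocalization.mem_coeSubmodule]
  have key (r : X.presheaf.stalk x.1) : pointValuation x (algebraMap _ X.functionField r) ≤
      WithZero.exp (-(n : ℤ)) ↔ r ∈ IsLocalRing.maximalIdeal (X.presheaf.stalk x.1) ^ n := by
    rw [pointValuation, IsDedekindDomain.HeightOneSpectrum.valuation_of_algebraMap,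
      IsDedekindDomain.HeightOneSpectrum.intValuation_le_pow_iff_mem]
    rfl
  constructor
  · intro h
    obtain ⟨r, rfl⟩ := (pointValuation_le_one_iff x a).1 (h.trans (by
      rw [← WithZero.exp_zero, WithZero.exp_le_exp]
      omega))
    exact ⟨r, (key r).1 h, rfl⟩
  · rintro ⟨r, hr, rfl⟩
    exact (key r).2 hr

theorem mem_localPoles_iff (x : ClosedPoint X) (d : ℤ) (a : X.functionField) :
    a ∈ localPoles x.1 d ↔ pointValuation x a ≤ WithZero.exp d := by
  obtain ⟨π, hπ⟩ : ∃ π, pointValuation x π = WithZero.exp (-1) :=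
    IsDedekindDomain.HeightOneSpectrum.valuation_exists_uniformizer _ _
  have hd : d = d.toNat - (-d).toNat := by omega
  have hexp : WithZero.exp d = WithZero.exp (-((-d).toNat : ℤ)) * WithZero.exp (d.toNat : ℤ) := by
    rw [← WithZero.exp_add]
    congr 1
    omega
  rw [localPoles, Submodule.mem_div_iff_forall_mul_mem]
  constructor
  · intro h
    have hp : pointValuation x (π ^ d.toNat) = WithZero.exp (-(d.toNat : ℤ)) := by
      rw [map_pow, hπ, ← WithZero.exp_nsmul]
      simp
    have h1 := (pointValuation_le_exp_iff x _ _).2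
      (h _ ((pointValuation_le_exp_iff x _ _).1 hp.le))
    rw [map_mul, hp] at h1
    rw [hexp]
    refine (mul_le_mul_left h1 (WithZero.exp (d.toNat : ℤ))).trans' ?_
    rw [mul_assoc, ← WithZero.exp_add, neg_add_cancel, WithZero.exp_zero, mul_one]
  · intro h b hb
    rw [← pointValuation_le_exp_iff] at hb ⊢
    rw [map_mul]
    refine (mul_le_mul' h hb).trans_eq ?_
    rw [← WithZero.exp_add]
    congr 1
    omega

/-- The constant section of `𝒪_X(D)` over `U` with value `g`. -/
def constSection (D : CurveDivisor X) (U : X.Opens) (g : X.functionField)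
    (h : ∀ y : ClosedPoint X, y.1 ∈ U → pointValuation y g ≤ WithZero.exp (D y)) :
    divisorSections D U :=
  ⟨fun _ => g, fun _ _ => rfl, fun y hy => (mem_localPoles_iff y _ _).2 (h y hy)⟩

theorem isLocalGenerator_constSection (D : CurveDivisor X) (U : X.Opens) {g : X.functionField}
    (hg : g ≠ 0) (h : ∀ y : ClosedPoint X, y.1 ∈ U → pointValuation y g = WithZero.exp (D y)) :
    IsLocalGenerator D (constSection D U g fun y hy => (h y hy).le) where
  existsUnique V hVU a := by
    by_cases hV : genericPoint X ∈ V
    · have hval (y : ClosedPoint X) (hy : y.1 ∈ V) :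
          pointValuation y (a.1 ⟨_, hV⟩ / g) ≤ 1 := by
        have h1 := (mem_localPoles_iff y _ _).1 (a.2.2 y hy)
        rw [a.2.1 _ ⟨_, hV⟩] at h1
        rw [map_div₀, h y (hVU hy)]
        exact div_le_one_of_le₀ h1 zero_le
      obtain ⟨r, hr⟩ := exists_germ_eq_of_forall hV _ hval
      refine ⟨r, ?_, fun r' hr' => ?_⟩
      · refine Subtype.ext (funext fun y => ?_)
        change (r • (divisorRes D hVU (constSection D U g _)).1) y = a.1 y
        rw [ratFamily_smul_apply hV, a.2.1 y ⟨_, hV⟩, hr]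
        exact div_mul_cancel₀ _ hg
      · refine germ_injective_of_isIntegral X _ hV ?_
        rw [hr, eq_div_iff hg]
        have h1 : (r' • (divisorRes D hVU (constSection D U g _)).1) ⟨_, hV⟩ = a.1 ⟨_, hV⟩ :=
          congrFun (congrArg Subtype.val hr') _
        rw [← h1, ratFamily_smul_apply hV]
        rfl
    · have hbot : V = ⊥ := by
        refine Opens.ext (Set.eq_empty_of_forall_notMem fun y hy => hV (genericPoint_mem hy))
      subst hbot
      exact ⟨0, Subtype.ext (funext fun y => y.2.elim), fun r _ => Subsingleton.elim _ _⟩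

theorem exists_isLocalGenerator (D : CurveDivisor X) (x : X) {W : X.Opens} (hx : x ∈ W) :
    ∃ (U : X.Opens) (g : X.functionField), IsAffineOpen U ∧ x ∈ U ∧ U ≤ W ∧ g ≠ 0 ∧
      ∀ y : ClosedPoint X, y.1 ∈ U → pointValuation y g = WithZero.exp (D y) := by
  obtain ⟨g, hg0, hg⟩ : ∃ g : X.functionField, g ≠ 0 ∧
      ∀ y : ClosedPoint X, y.1 = x → pointValuation y g = WithZero.exp (D y) := by
    by_cases hcl : IsClosed {x}
    · have := IsRegularCurve.dvr x hcl
      obtain ⟨π, hπ⟩ : ∃ π, pointValuation ⟨x, hcl⟩ π = WithZero.exp (-1) :=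
        IsDedekindDomain.HeightOneSpectrum.valuation_exists_uniformizer _ _
      have hπ0 : π ≠ 0 := by
        rintro rfl
        rw [map_zero] at hπ
        exact WithZero.exp_ne_zero hπ.symm
      refine ⟨π ^ (-D ⟨x, hcl⟩), zpow_ne_zero _ hπ0, ?_⟩
      rintro ⟨y, hy⟩ rfl
      rw [map_zpow₀, hπ, ← WithZero.exp_zsmul]
      simp
    · exact ⟨1, one_ne_zero, fun y hy => (hcl (hy ▸ y.2)).elim⟩
  let B : Set X := Subtype.val '' {y : ClosedPoint X | y.1 ≠ x ∧
    pointValuation y g ≠ WithZero.exp (D y)}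
  have hB : B.Finite := by
    refine (((finite_pointValuation_ne_one hg0).union D.support.finite_toSet).subset ?_).image _
    rintro y ⟨-, hy⟩
    by_contra h
    rw [Set.mem_union, not_or] at h
    have h1 : pointValuation y g = 1 := not_not.1 h.1
    have h2 : D y = 0 := Finsupp.notMem_support_iff.1 h.2
    rw [h1, h2] at hy
    exact hy WithZero.exp_zero.symm
  have hBcl : IsClosed B := by
    rw [← Set.biUnion_of_singleton B]
    refine hB.isClosed_biUnion ?_
    rintro _ ⟨y, -, rfl⟩
    exact y.2
  obtain ⟨U, hU, hxU, hUW⟩ := exists_isAffineOpen_mem_le (x := x)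
    (W := W ⊓ ⟨Bᶜ, hBcl.isOpen_compl⟩) ⟨hx, by rintro ⟨y, hy, rfl⟩; exact hy.1 rfl⟩
  refine ⟨U, g, hU, hxU, hUW.trans inf_le_left, hg0, fun y hy => ?_⟩
  by_contra h
  by_cases hyx : y.1 = x
  · exact h (hg y hyx)
  · exact (hUW hy).2 ⟨y, ⟨hyx, h⟩, rfl⟩

theorem IsQCoh.twist {M : X.Modules} (hM : IsQCoh M) (D : CurveDivisor X) :
    IsQCoh ((twist D).obj M) :=
  hM.of_localIso fun x => by
    obtain ⟨U, g, -, hx, -, hg, h⟩ := exists_isLocalGenerator D x (W := ⊤) trivial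
    exact ⟨U, hx, ⟨(isLocalGenerator_constSection D U hg h).localIso M⟩⟩

end TwistLocal

end

section

section LatticeEquiv

variable {R : Type*} [CommRing R] [IsDomain R] [IsDiscreteValuationRing R]
variable {K : Type*} [Field K] [Algebra R K] [IsFractionRing R K]
variable {M V M' V' : Type*} [AddCommGroup M] [Module R M] [AddCommGroup V] [Module R V]
  [Module K V] [IsScalarTower R K V] [Module.Finite R M] [AddCommGroup M'] [Module R M']
  [AddCommGroup V'] [Module R V'] [Module K V'] [IsScalarTower R K V'] [Module.Finite R M']
  {κ : Type*} [Fintype κ] {ι : M →ₗ[R] V} {ι' : M' →ₗ[R] V'}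

theorem latticeDegree_map (hι : IsGenericFibre ι) (hι' : IsGenericFibre ι') (E : M ≃ₗ[R] M')
    (T : V ≃ₗ[K] V') (h : ∀ m, T (ι m) = ι' (E m)) (b : Module.Basis κ K V) :
    latticeDegree ι' (b.map T) = latticeDegree ι b := by
  obtain ⟨s, hs, m, hm⟩ := hι.exists_lift b
  have hm' (i : κ) : ι' (E (m i)) = s • (b.map T) i := by
    rw [← h, hm, Module.Basis.map_apply, ← IsScalarTower.algebraMap_smul K s (b i), map_smul,
      IsScalarTower.algebraMap_smul]
  rw [latticeDegree_eq hι b hs hm, latticeDegree_eq hι' (b.map T) hs hm']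
  congr 1
  refine (len_congr (Submodule.Quotient.equiv _ _ E ?_)).symm
  refine (Submodule.map_span _ _).trans ?_
  rw [← Set.range_comp]
  rfl

theorem latticeDegree_map_smul (hι : IsGenericFibre ι) (hι' : IsGenericFibre ι')
    (E : M ≃ₗ[R] M') (T : V ≃ₗ[K] V') {a : K} (ha : a ≠ 0) (h : ∀ m, T (ι m) = a • ι' (E m))
    (b : Module.Basis κ K V) :
    latticeDegree ι' (b.map T) = latticeDegree ι b + Fintype.card κ * ordK R a := by
  have h1 := latticeDegree_map hι hι' E
    (T.trans (LinearEquiv.smulOfNeZero K V' a⁻¹ (inv_ne_zero ha)))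
    (fun m => by
      change a⁻¹ • T (ι m) = _
      rw [h, inv_smul_smul₀ ha]) b
  rw [← h1, latticeDegree_smul hι'
    (b.map (T.trans (LinearEquiv.smulOfNeZero K V' a⁻¹ (inv_ne_zero ha))))
    (b.map T) (fun _ => ha) fun i => ?_]
  · simp
  · change T (b i) = a • a⁻¹ • T (b i)
    rw [smul_inv_smul₀ ha]

end LatticeEquiv

section LocalEquation

variable [IsIntegral X] [IsRegularCurve X]

/-- A local equation of the divisor `D` on the open set `U`. -/
structure LocalEquation (D : CurveDivisor X) where
  /-- the open set -/
  U : X.Opens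
  /-- the rational function -/
  g : X.functionField
  ne_zero : g ≠ 0
  valuation_eq : ∀ y : ClosedPoint X, y.1 ∈ U → pointValuation y g = WithZero.exp (D y)

namespace LocalEquation

variable {D : CurveDivisor X}

theorem exists_mem (D : CurveDivisor X) (x : X) : ∃ t : LocalEquation D, x ∈ t.U := by
  obtain ⟨U, g, -, hx, -, hg, h⟩ := exists_isLocalGenerator D x (W := ⊤) trivial
  exact ⟨⟨U, g, hg, h⟩, hx⟩

variable (t : LocalEquation D)

/-- The generator of `𝒪_X(D)` given by a local equation. -/
def generator : divisorSections D t.U := constSection D t.U t.g fun y hy => (t.valuation_eq y hy).le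

theorem isLocalGenerator : IsLocalGenerator D t.generator :=
  isLocalGenerator_constSection D t.U t.ne_zero t.valuation_eq

theorem divisorRes_generator (t' : LocalEquation D) {V : X.Opens} (hV : V ≤ t.U) (hV' : V ≤ t'.U)
    (hη : genericPoint X ∈ V) (r : Γ(X, V)) (hr : t.g = X.presheaf.germ V _ hη r * t'.g) :
    divisorRes D hV t.generator = r • divisorRes D hV' t'.generator :=
  Subtype.ext (funext fun y => hr.trans
    (ratFamily_smul_apply hη r (divisorRes D hV' t'.generator).1 y).symm)

theorem exists_eq_mul (t' : LocalEquation D) {V : X.Opens} (hV : V ≤ t.U) (hV' : V ≤ t'.U)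
    (hη : genericPoint X ∈ V) : ∃ r : Γ(X, V), t.g = X.presheaf.germ V _ hη r * t'.g := by
  obtain ⟨r, hr⟩ := exists_germ_eq_of_forall hη (t.g / t'.g) fun y hy => by
    rw [map_div₀, t.valuation_eq y (hV hy), t'.valuation_eq y (hV' hy),
      div_self WithZero.exp_ne_zero]
  exact ⟨r, by rw [hr, div_mul_cancel₀ _ t'.ne_zero]⟩

end LocalEquation

/-- `N` is locally isomorphic to `Q`, through isomorphisms that transform like `Q ≅ N(D)`. -/
structure TwistedIso (D : CurveDivisor X) (Q N : X.Modules) where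
  /-- the isomorphism given by a local equation -/
  iso : ∀ t : LocalEquation D, LocalIso t.U Q N
  smul_iso : ∀ (t t' : LocalEquation D) {V : X.Opens} (hV : V ≤ t.U) (hV' : V ≤ t'.U)
    (hη : genericPoint X ∈ V) (r : Γ(X, V)), t.g = X.presheaf.germ V _ hη r * t'.g →
    ∀ q : Γ(Q, V), (iso t').equiv V hV' q = r • (iso t).equiv V hV q

namespace TwistedIso

variable {D : CurveDivisor X} {Q N : X.Modules} (e : TwistedIso D Q N)

include e in
theorem exists_genericEquiv : ∃ T : genericStalk Q ≃ₗ[X.functionField] genericStalk N,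
    ∀ (t : LocalEquation D) (x : X), x ∈ t.U → ∃ E : stalk Q x ≃ₗ[X.presheaf.stalk x] stalk N x,
      ∀ m, T (toGenericStalk Q x m) = t.g • toGenericStalk N x (E m) := by
  obtain ⟨t₀, h₀⟩ := LocalEquation.exists_mem D (genericPoint X)
  obtain ⟨E₀, hE₀⟩ := (e.iso t₀).exists_stalkEquiv h₀
  refine ⟨LinearEquiv.trans E₀ (LinearEquiv.smulOfNeZero X.functionField _ t₀.g t₀.ne_zero),
    fun t x hx => ?_⟩
  obtain ⟨E, hE⟩ := (e.iso t).exists_stalkEquiv hx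
  refine ⟨E, fun m => ?_⟩
  obtain ⟨V, hxV, q, rfl⟩ := exists_germ_eq Q m
  have hη : genericPoint X ∈ V ⊓ t.U ⊓ t₀.U := ⟨⟨genericPoint_mem hxV, genericPoint_mem hx⟩, h₀⟩
  have hxVt : x ∈ V ⊓ t.U := ⟨hxV, hx⟩
  obtain ⟨r, hr⟩ := t.exists_eq_mul t₀ (V := V ⊓ t.U ⊓ t₀.U) (inf_le_left.trans inf_le_right)
    inf_le_right hη
  have h1 := e.smul_iso t t₀ (V := V ⊓ t.U ⊓ t₀.U) (inf_le_left.trans inf_le_right)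
    inf_le_right hη r hr
  change t₀.g • E₀ _ = _
  rw [← germ_res Q (Opens.infLELeft V t.U) hxVt, hE inf_le_right, toGenericStalk_germ,
    toGenericStalk_germ, ← germ_res Q (Opens.infLELeft (V ⊓ t.U) t₀.U) hη, hE₀ inf_le_right,
    ← germ_res N (Opens.infLELeft (V ⊓ t.U) t₀.U) hη, LocalIso.map_equiv, h1, germ_smul, smul_smul,
    mul_comm, hr]

include e in
theorem rank_eq : rank Q = rank N := by
  obtain ⟨T, -⟩ := e.exists_genericEquiv
  exact T.finrank_eq

include e in
theorem isQCoh (hQ : IsQCoh Q) : IsQCoh N := hQ.of_localIso fun x => by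
  obtain ⟨t, ht⟩ := LocalEquation.exists_mem D x
  exact ⟨t.U, ht, ⟨e.iso t⟩⟩

attribute [local instance 10] genericStalkModule

include e in
theorem degree_eq {k : Type u} [Field k] (f : X ⟶ Spec (.of k)) [IsProper f] (hQ : IsCoherent Q)
    (hN : IsCoherent N) : degree f Q = degree f N + divisorDegree f D * rank Q := by
  obtain ⟨T, hT⟩ := e.exists_genericEquiv
  have := hQ.finite_genericStalk
  let b := Module.Basis.ofVectorSpace X.functionField (genericStalk Q)
  have hfin := Module.Finite.finite_basis b
  have := Fintype.ofFinite (Module.Basis.ofVectorSpaceIndex X.functionField (genericStalk Q))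
  have key (x : ClosedPoint X) :
      localDegree Q b x.1 = localDegree N (b.map T) x.1 + rank Q * D x := by
    obtain ⟨t, ht⟩ := LocalEquation.exists_mem D x.1
    obtain ⟨E, hE⟩ := hT t x.1 ht
    have := isScalarTower_genericStalk Q x.1
    have := isScalarTower_genericStalk N x.1
    have := hQ.finite_stalk x.1
    have := hN.finite_stalk x.1
    have h1 := latticeDegree_map_smul (hQ.isQCoh.isGenericFibre x.1) (hN.isQCoh.isGenericFibre x.1)
      E T t.ne_zero hE b
    rw [ordK_eq_neg_log, t.valuation_eq x ht, WithZero.log_exp] at h1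
    rw [localDegree_eq_latticeDegree, localDegree_eq_latticeDegree, h1, rank,
      Module.finrank_eq_card_basis b]
    ring
  have h2 : divisorDegree f D * rank Q =
      ∑ᶠ x : ClosedPoint X, (f.residueDegree x.1 : ℤ) * (rank Q * D x) := by
    rw [divisorDegree, Finsupp.sum, finsum_eq_sum_of_support_subset (s := D.support),
      Finset.sum_mul]
    · exact Finset.sum_congr rfl fun x _ => by ring
    · intro x hx
      rw [Finset.mem_coe, Finsupp.mem_support_iff]
      rintro h
      exact hx (by simp [h])
  rw [QuiverSheaves.degree_eq f hQ b, QuiverSheaves.degree_eq f hN (b.map T), h2,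
    ← finsum_add_distrib]
  · exact finsum_congr fun x => by rw [key x, mul_add]
  · exact (finite_localDegree_ne_zero hN (b.map T)).subset fun x hx h => hx (by simp [h])
  · exact D.hasFiniteSupport.subset fun x hx h => hx (by simp [h])

end TwistedIso

end LocalEquation

end

section

section Submodule

/-- A family of submodules of the sections of `M`, forming a subsheaf. -/
structure SubmoduleSheaf (M : X.Modules) where
  /-- the sections of the subsheaf -/
  carrier : ∀ U : X.Opens, Submodule Γ(X, U) Γ(M, U)
  map_mem : ∀ {U V : X.Opens} (i : V ⟶ U) {s : Γ(M, U)}, s ∈ carrier U →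
    M.presheaf.map i.op s ∈ carrier V
  mem_of_locally : ∀ {U : X.Opens} {s : Γ(M, U)},
    (∀ x ∈ U, ∃ (V : X.Opens) (i : V ⟶ U), x ∈ V ∧ M.presheaf.map i.op s ∈ carrier V) →
      s ∈ carrier U

namespace SubmoduleSheaf

variable {M : X.Modules} (N : SubmoduleSheaf M)

/-- The underlying presheaf of abelian groups. -/
def ab : (Opens X)ᵒᵖ ⥤ Ab.{u} where
  obj U := AddCommGrpCat.of (N.carrier U.unop)
  map i := AddCommGrpCat.ofHom
    { toFun := fun s => ⟨M.presheaf.map i s.1, N.map_mem i.unop s.2⟩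
      map_zero' := Subtype.ext (map_zero _)
      map_add' := fun _ _ => Subtype.ext (map_add _ _ _) }
  map_id U := by
    ext s
    exact ConcreteCategory.congr_hom (M.presheaf.map_id U) s.1
  map_comp i j := by
    ext s
    exact ConcreteCategory.congr_hom (M.presheaf.map_comp i j) s.1

instance (U : (Opens X)ᵒᵖ) :
    Module ((X.presheaf ⋙ forget₂ CommRingCat RingCat).obj U) (N.ab.obj U) :=
  inferInstanceAs (Module Γ(X, U.unop) (N.carrier U.unop))

/-- The underlying presheaf of modules. -/
def presheafOfModules :
    PresheafOfModules.{u} (X.presheaf ⋙ forget₂ CommRingCat RingCat) :=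
  PresheafOfModules.ofPresheaf N.ab (by
    intro U V i r m
    exact Subtype.ext (M.map_smul i.unop r m.1))

theorem isSheaf_ab : TopCat.Presheaf.IsSheaf (C := Ab.{u}) N.ab := by
  rw [TopCat.Presheaf.isSheaf_iff_isSheafUniqueGluing]
  intro ι U s hs
  obtain ⟨t, ht, huniq⟩ := TopCat.Sheaf.existsUnique_gluing ⟨M.presheaf, M.isSheaf⟩ U
    (fun i => (s i).1) fun i j => congrArg Subtype.val (hs i j)
  refine ⟨⟨t, N.mem_of_locally fun x hx => ?_⟩, fun i => Subtype.ext (ht i), fun t' ht' =>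
    Subtype.ext (huniq _ fun i => congrArg Subtype.val (ht' i))⟩
  obtain ⟨i, hi⟩ := Opens.mem_iSup.1 hx
  refine ⟨U i, Opens.leSupr U i, hi, ?_⟩
  rw [ht i]
  exact (s i).2

/-- The subsheaf as a sheaf of modules. -/
def toModules : X.Modules := ⟨N.presheafOfModules, N.isSheaf_ab⟩

/-- The inclusion of the subsheaf. -/
def ι : N.toModules ⟶ M :=
  ⟨PresheafOfModules.homMk
    { app := fun U => AddCommGrpCat.ofHom (N.carrier U.unop).subtype.toAddMonoidHom
      naturality := fun _ _ _ => rfl } fun _ _ _ => rfl⟩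

instance : Mono N.ι := by
  refine (Scheme.Modules.toPresheaf X).mono_of_mono_map ?_
  have (U : (Opens X)ᵒᵖ) : Mono (((Scheme.Modules.toPresheaf X).map N.ι).app U) :=
    (AddCommGrpCat.mono_iff_injective _).2 Subtype.val_injective
  exact NatTrans.mono_of_mono_app _

end SubmoduleSheaf

end Submodule

theorem cokernel_π_app_eq_zero_iff {M N : X.Modules} (j : M ⟶ N) [Mono j] {U : X.Opens}
    (s : Γ(N, U)) :
    (cokernel.π j).app U s = 0 ↔ ∃ q, j.app U q = s := by
  constructor
  · exact exists_app_eq_of_exact (S := ShortComplex.mk j (cokernel.π j) (cokernel.condition j))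
      (ShortComplex.exact_cokernel j) s
  · rintro ⟨q, rfl⟩
    have : (j ≫ cokernel.π j).app U q = 0 := by rw [cokernel.condition]; rfl
    exact this

section Untwist

variable [IsIntegral X]

open TensorProduct

/-- The sections `g` of `G` such that `ψ` vanishes on `g ⊗ 𝒪_X(D)`. -/
def untwist (D : CurveDivisor X) {G R : X.Modules} (ψ : (twist D).obj G ⟶ R) :
    SubmoduleSheaf G where
  carrier U :=
    { carrier := {g | ∀ (V : X.Opens) (i : V ⟶ U) (a : divisorSections D V),
        ψ.app V (twistUnit D G V (G.presheaf.map i.op g ⊗ₜ a)) = 0}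
      zero_mem' := fun V i a => by rw [map_zero, zero_tmul, map_zero, map_zero]
      add_mem' := fun h h' V i a => by rw [map_add, add_tmul, map_add, map_add, h, h', add_zero]
      smul_mem' := fun r g h V i a => by
        rw [Scheme.Modules.map_smul, ← smul_tmul', map_smul, Scheme.Modules.Hom.app_smul, h,
          smul_zero] }
  map_mem {U V} i s hs W j a := by
    have h := hs W (j ≫ i) a
    rwa [op_comp, Functor.map_comp, ConcreteCategory.comp_apply] at h
  mem_of_locally {U s} h V i a := by
    refine TopCat.Presheaf.section_ext ⟨R.presheaf, R.isSheaf⟩ _ _ _ fun x hx => ?_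
    obtain ⟨W, j, hxW, hW⟩ := h x (i.le hx)
    have hxVW : x ∈ V ⊓ W := ⟨hx, hxW⟩
    have h1 := hW _ (Opens.infLERight V W) (divisorRes D inf_le_left a)
    have h2 : ψ.app (V ⊓ W) (((twist D).obj G).presheaf.map (Opens.infLELeft V W).op
        (twistUnit D G V (G.presheaf.map i.op s ⊗ₜ a))) = 0 := by
      rw [twistUnit_res, ← h1, ← ConcreteCategory.comp_apply, ← ConcreteCategory.comp_apply,
        ← Functor.map_comp, ← Functor.map_comp]
      rfl
    refine Eq.trans ?_ (map_zero (germ R hx)).symm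
    change germ R hx _ = _
    rw [← germ_res R (Opens.infLELeft V W) hxVW, app_map, h2, map_zero]

variable {D : CurveDivisor X} {G : X.Modules}

theorem IsLocalGenerator.mem_untwist_iff {U : X.Opens} {t : divisorSections D U}
    (ht : IsLocalGenerator D t) {R : X.Modules} (ψ : (twist D).obj G ⟶ R) {V : X.Opens}
    (hV : V ≤ U) (g : Γ(G, V)) :
    g ∈ (untwist D ψ).carrier V ↔ ψ.app V ((ht.localIso G).equiv V hV g) = 0 := by
  rw [ht.localIso_apply]
  constructor
  · intro h
    have h1 := h V (𝟙 V) (divisorRes D hV t)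
    rwa [op_id, CategoryTheory.Functor.map_id] at h1
  · intro h W i a
    obtain ⟨r, rfl⟩ := (ht.existsUnique W (i.le.trans hV) a).exists
    have h1 := congrArg (R.presheaf.map i.op) h
    rw [app_map, twistUnit_res, map_zero] at h1
    rw [tmul_smul, map_smul, Scheme.Modules.Hom.app_smul]
    refine (congrArg (r • ·) ?_).trans (smul_zero r)
    exact h1

variable [IsRegularCurve X] {Q : X.Modules} (j : Q ⟶ (twist D).obj G) [Mono j]

/-- The subsheaf `Q(-D)` of `G` for a subsheaf `Q` of `G(D)`. -/
def untwistSheaf : X.Modules := (untwist D (cokernel.π j)).toModules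

/-- The inclusion `Q(-D) ⟶ G`. -/
def untwistι : untwistSheaf j ⟶ G := (untwist D (cokernel.π j)).ι

instance : Mono (untwistι j) := inferInstanceAs (Mono (untwist D (cokernel.π j)).ι)

/-- The map `Q ⟶ Q(-D)` given by division by a local equation of `D`. -/
def divLinear (t : LocalEquation D) {V : X.Opens} (hV : V ≤ t.U) :
    Γ(Q, V) →ₗ[Γ(X, V)] (untwist D (cokernel.π j)).carrier V where
  toFun q := ⟨((t.isLocalGenerator.localIso G).equiv V hV).symm (j.app V q), by
    rw [t.isLocalGenerator.mem_untwist_iff _ hV, LinearEquiv.apply_symm_apply,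
      cokernel_π_app_eq_zero_iff]
    exact ⟨q, rfl⟩⟩
  map_add' q q' := Subtype.ext ((congrArg ((t.isLocalGenerator.localIso G).equiv V hV).symm
    (map_add _ q q')).trans (map_add _ _ _))
  map_smul' r q := Subtype.ext ((congrArg ((t.isLocalGenerator.localIso G).equiv V hV).symm
    (Scheme.Modules.Hom.app_smul j r q)).trans (map_smul _ _ _))

theorem divLinear_bijective (t : LocalEquation D) {V : X.Opens} (hV : V ≤ t.U) :
    Function.Bijective (divLinear j t hV) := by
  constructor
  · intro q q' h
    exact app_injective j V (((t.isLocalGenerator.localIso G).equiv V hV).symm.injective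
      (congrArg Subtype.val h))
  · rintro ⟨g, hg⟩
    rw [t.isLocalGenerator.mem_untwist_iff _ hV, cokernel_π_app_eq_zero_iff] at hg
    obtain ⟨q, hq⟩ := hg
    exact ⟨q, Subtype.ext ((LinearEquiv.symm_apply_eq _).2 hq)⟩

/-- `Q` and `Q(-D)` are twisted forms of each other. -/
def untwistIso : TwistedIso D Q (untwistSheaf j) where
  iso t :=
    { equiv := fun V hV => LinearEquiv.ofBijective (divLinear j t hV) (divLinear_bijective j t hV)
      map_equiv := fun {V W} hV i s => Subtype.ext (by
        change G.presheaf.map i.op (((t.isLocalGenerator.localIso G).equiv V hV).symm (j.app V s)) =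
          ((t.isLocalGenerator.localIso G).equiv W _).symm (j.app W _)
        rw [← app_map]
        exact (t.isLocalGenerator.localIso G).symm.map_equiv hV i _) }
  smul_iso t t' {V} hV hV' hη r hr q := Subtype.ext (by
    change ((t'.isLocalGenerator.localIso G).equiv V hV').symm (j.app V q) =
      r • ((t.isLocalGenerator.localIso G).equiv V hV).symm (j.app V q)
    obtain ⟨n, hn⟩ := ((t.isLocalGenerator.localIso G).equiv V hV).surjective (j.app V q)
    rw [← hn, LinearEquiv.symm_apply_apply, LinearEquiv.symm_apply_eq, map_smul,
      IsLocalGenerator.localIso_apply, IsLocalGenerator.localIso_apply,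
      t.divisorRes_generator t' hV hV' hη r hr, tmul_smul, map_smul])

theorem isCoherent_untwistSheaf (hQ : IsCoherent Q) (hG : IsCoherent G) :
    IsCoherent (untwistSheaf j) :=
  ((untwistIso j).isQCoh hQ.isQCoh).isCoherent_of_mono (untwistι j) hG

end Untwist

section TwistExact

variable [IsIntegral X] [IsRegularCurve X] (D : CurveDivisor X)

instance twist_map_mono {M N : X.Modules} (φ : M ⟶ N) [Mono φ] : Mono ((twist D).map φ) := by
  refine Preadditive.mono_of_isZero_kernel _ (isZero_of_forall_germ fun x m => ?_)
  obtain ⟨V, hxV, s, rfl⟩ := exists_germ_eq _ m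
  obtain ⟨t, hxt⟩ := LocalEquation.exists_mem D x
  have hx : x ∈ V ⊓ t.U := ⟨hxV, hxt⟩
  rw [← germ_res _ (Opens.infLELeft V t.U) hx]
  refine (congrArg _ (app_injective (kernel.ι _) _ ?_)).trans (map_zero _)
  rw [map_zero]
  generalize hs : (kernel ((twist D).map φ)).presheaf.map (Opens.infLELeft V t.U).op s = s'
  obtain ⟨n, hn⟩ := ((t.isLocalGenerator.localIso M).equiv _ inf_le_right).surjective
    ((kernel.ι ((twist D).map φ)).app _ s')
  have h1 : (kernel.ι ((twist D).map φ) ≫ (twist D).map φ).app _ s' = 0 := by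
    rw [kernel.condition]
    rfl
  have h2 : ((twist D).map φ).app _ ((kernel.ι ((twist D).map φ)).app _ s') = 0 := h1
  rw [← hn, IsLocalGenerator.localIso_naturality, LinearEquiv.map_eq_zero_iff,
    map_eq_zero_iff _ (app_injective φ _)] at h2
  rw [← hn, h2, map_zero]

theorem exists_lift_twist {S : ShortComplex X.Modules} (hS : S.Exact) [Mono S.f] {A : X.Modules}
    (a : A ⟶ (twist D).obj S.X₂) (ha : a ≫ (twist D).map S.g = 0) :
    ∃ b : A ⟶ (twist D).obj S.X₁, b ≫ (twist D).map S.f = a := by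
  let S' : ShortComplex X.Modules := ShortComplex.mk ((twist D).map S.f)
    (cokernel.π ((twist D).map S.f)) (cokernel.condition _)
  have hS' : S'.Exact := ShortComplex.exact_cokernel _
  have : Mono S'.f := twist_map_mono D S.f
  refine ⟨hS'.lift a ?_, hS'.lift_f a _⟩
  refine Scheme.Modules.hom_ext _ _ fun U => ?_
  ext s
  refine TopCat.Presheaf.section_ext ⟨S'.X₃.presheaf, S'.X₃.isSheaf⟩ _ _ _ fun x hx => ?_
  obtain ⟨t, hxt⟩ := LocalEquation.exists_mem D x
  have hxU : x ∈ U ⊓ t.U := ⟨hx, hxt⟩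
  refine Eq.trans ?_ (map_zero (germ S'.X₃ hx)).symm
  change germ S'.X₃ hx ((a ≫ S'.g).app U s) = _
  rw [← germ_res _ (Opens.infLELeft U t.U) hxU, app_map]
  generalize A.presheaf.map (Opens.infLELeft U t.U).op s = s'
  obtain ⟨n, hn⟩ := ((t.isLocalGenerator.localIso S.X₂).equiv _ inf_le_right).surjective
    (a.app (U ⊓ t.U) s')
  have h1 : ((twist D).map S.g).app _ (a.app (U ⊓ t.U) s') = 0 := by
    have : (a ≫ (twist D).map S.g).app (U ⊓ t.U) s' = 0 := by rw [ha]; rfl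
    exact this
  rw [← hn, IsLocalGenerator.localIso_naturality, LinearEquiv.map_eq_zero_iff] at h1
  obtain ⟨m, rfl⟩ := exists_app_eq_of_exact hS n h1
  have h2 : S'.g.app (U ⊓ t.U) (a.app (U ⊓ t.U) s') = 0 := by
    rw [← hn, ← IsLocalGenerator.localIso_naturality]
    have : ((twist D).map S.f ≫ cokernel.π ((twist D).map S.f)).app (U ⊓ t.U)
        ((t.isLocalGenerator.localIso S.X₁).equiv _ inf_le_right m) = 0 := by
      rw [cokernel.condition]
      rfl
    exact this
  exact (congrArg (germ S'.X₃ hxU) h2).trans (map_zero _)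

end TwistExact

end

section

section SlopeOf

/-- The slope of an object of rank `ρ` and degree `δ`. -/
def slopeOf (ρ : ℕ) (δ : ℤ) : WithTop ℚ := if ρ = 0 then ⊤ else ((δ / ρ : ℚ) : WithTop ℚ)

theorem slopeOf_zero (δ : ℤ) : slopeOf 0 δ = ⊤ := if_pos rfl

theorem slopeOf_of_pos {ρ : ℕ} (h : 0 < ρ) (δ : ℤ) : slopeOf ρ δ = ((δ / ρ : ℚ) : WithTop ℚ) :=
  if_neg h.ne'

theorem slopeOf_le_slopeOf {ρ σ : ℕ} (hρ : 0 < ρ) (hσ : 0 < σ) {δ ε : ℤ} :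
    slopeOf ρ δ ≤ slopeOf σ ε ↔ δ * σ ≤ ε * ρ := by
  rw [slopeOf_of_pos hρ, slopeOf_of_pos hσ, WithTop.coe_le_coe,
    div_le_div_iff₀ (by exact_mod_cast hρ) (by exact_mod_cast hσ)]
  exact_mod_cast Iff.rfl

theorem slopeOf_lt_slopeOf {ρ σ : ℕ} (hρ : 0 < ρ) (hσ : 0 < σ) {δ ε : ℤ} :
    slopeOf ρ δ < slopeOf σ ε ↔ δ * σ < ε * ρ := by
  rw [slopeOf_of_pos hρ, slopeOf_of_pos hσ, WithTop.coe_lt_coe,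
    div_lt_div_iff₀ (by exact_mod_cast hρ) (by exact_mod_cast hσ)]
  exact_mod_cast Iff.rfl

theorem slopeOf_lt_top {ρ : ℕ} {δ : ℤ} : slopeOf ρ δ < ⊤ ↔ 0 < ρ := by
  rcases Nat.eq_zero_or_pos ρ with rfl | h
  · simp [slopeOf_zero]
  · simp [slopeOf_of_pos h, h, WithTop.coe_lt_top]

end SlopeOf

section SlopeOrder

/-- A partial order with a rank and a degree behaving like those of the coherent subsheaves of a
coherent sheaf on a curve. -/
structure SlopeOrder (P : Type*) [PartialOrder P] [OrderBot P] where
  /-- the rank -/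
  rk : P → ℕ
  /-- the degree -/
  deg : P → ℤ
  rk_bot : rk ⊥ = 0
  rk_mono : ∀ {S T : P}, S ≤ T → rk S ≤ rk T
  deg_lt : ∀ {S T : P}, S < T → rk S = rk T → deg S < deg T
  bddAbove : ∃ B, ∀ S, deg S ≤ B

namespace SlopeOrder

variable {P : Type*} [PartialOrder P] [OrderBot P] (h : SlopeOrder P)

/-- The slope of the quotient `T / S`. -/
def μ (S T : P) : WithTop ℚ := slopeOf (h.rk T - h.rk S) (h.deg T - h.deg S)

variable {h} in
theorem μ_le_iff {S T S' T' : P} (hST : h.rk S < h.rk T) (hST' : h.rk S' < h.rk T') :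
    h.μ S T ≤ h.μ S' T' ↔ (h.deg T - h.deg S) * (h.rk T' - h.rk S') ≤
      (h.deg T' - h.deg S') * (h.rk T - h.rk S) := by
  rw [μ, μ, slopeOf_le_slopeOf (by omega) (by omega), Nat.cast_sub hST.le, Nat.cast_sub hST'.le]

variable {h} in
theorem μ_lt_iff {S T S' T' : P} (hST : h.rk S < h.rk T) (hST' : h.rk S' < h.rk T') :
    h.μ S T < h.μ S' T' ↔ (h.deg T - h.deg S) * (h.rk T' - h.rk S') <
      (h.deg T' - h.deg S') * (h.rk T - h.rk S) := by
  rw [μ, μ, slopeOf_lt_slopeOf (by omega) (by omega), Nat.cast_sub hST.le, Nat.cast_sub hST'.le]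

variable {h} in
theorem μ_of_rk_eq {S T : P} (hST : h.rk S = h.rk T) : h.μ S T = ⊤ := by
  rw [μ, hST, Nat.sub_self, slopeOf_zero]

variable {h} in
theorem μ_lt_top {S T : P} (hST : h.rk S < h.rk T) : h.μ S T < ⊤ :=
  slopeOf_lt_top.2 (by omega)

/-- There is a quotient of minimal slope, and of maximal rank among these. -/
theorem exists_min {T : P} (hT : 0 < h.rk T) : ∃ S < T, h.rk S < h.rk T ∧
    ∀ U ≤ T, h.rk U < h.rk T → h.μ S T ≤ h.μ U T ∧ (h.rk U < h.rk S → h.μ S T < h.μ U T) := by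
  obtain ⟨B, hB⟩ := h.bddAbove
  let r := h.rk T
  let N (U : P) : ℤ := (h.deg T - h.deg U) * ((r.factorial / (r - h.rk U) : ℕ) : ℤ)
  let Φ (U : P) : ℤ := N U * (r + 1) + h.rk U
  have hdvd {U : P} (hU : h.rk U < r) :
      ((h.rk T - h.rk U : ℤ)) * ((r.factorial / (r - h.rk U) : ℕ) : ℤ) = r.factorial := by
    rw [← Nat.cast_sub hU.le]
    exact_mod_cast Nat.mul_div_cancel' (Nat.dvd_factorial (Nat.sub_pos_of_lt hU) (Nat.sub_le _ _))
  have hfac : (0 : ℤ) < r.factorial := by exact_mod_cast r.factorial_pos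
  have hN {U V : P} (hU : h.rk U < r) (hV : h.rk V < r) : h.μ U T ≤ h.μ V T ↔ N U ≤ N V := by
    have hu : (0 : ℤ) < h.rk T - h.rk U := by omega
    have hv : (0 : ℤ) < h.rk T - h.rk V := by omega
    have e1 : N U * ((h.rk T - h.rk U) * (h.rk T - h.rk V)) =
        (h.deg T - h.deg U) * (h.rk T - h.rk V) * r.factorial := by
      rw [← hdvd hU]
      ring
    have e2 : N V * ((h.rk T - h.rk U) * (h.rk T - h.rk V)) =
        (h.deg T - h.deg V) * (h.rk T - h.rk U) * r.factorial := by
      rw [← hdvd hV]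
      ring
    rw [μ_le_iff hU hV, ← mul_le_mul_iff_of_pos_right (b := N U) (mul_pos hu hv), e1,
      e2, mul_le_mul_iff_of_pos_right hfac]
  obtain ⟨m, ⟨S, hST, hS, rfl⟩, hmin⟩ := Int.exists_least_of_bdd
    (P := fun m => ∃ S : P, S ≤ T ∧ h.rk S < r ∧ Φ S = m)
    ⟨min 0 ((h.deg T - B) * r.factorial) * (r + 1), by
      rintro m ⟨S, hST, hS, rfl⟩
      have h1 : min 0 ((h.deg T - B) * r.factorial) ≤ N S := by
        have hle : r.factorial / (r - h.rk S) ≤ r.factorial := Nat.div_le_self _ _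
        have h2 : h.deg T - B ≤ h.deg T - h.deg S := by linarith [hB S]
        rcases le_total 0 (h.deg T - h.deg S) with h3 | h3
        · exact (min_le_left _ _).trans (mul_nonneg h3 (by positivity))
        · refine (min_le_right _ _).trans ?_
          calc (h.deg T - B) * (r.factorial : ℤ) ≤ (h.deg T - h.deg S) * r.factorial :=
                mul_le_mul_of_nonneg_right h2 (by positivity)
            _ ≤ _ := mul_le_mul_of_nonpos_left (by exact_mod_cast hle) h3
      have h4 : (0 : ℤ) ≤ r + 1 := by positivity
      have := mul_le_mul_of_nonneg_right h1 h4
      have h5 : (0 : ℤ) ≤ h.rk S := by positivity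
      change _ ≤ N S * (r + 1) + h.rk S
      linarith⟩
    ⟨Φ ⊥, ⊥, bot_le, by rw [h.rk_bot]; exact hT, rfl⟩
  refine ⟨S, hST.lt_of_ne (by rintro rfl; exact hS.false), hS, fun U hUT hU => ?_⟩
  have h1 : N S * (r + 1) + h.rk S ≤ N U * (r + 1) + h.rk U := hmin _ ⟨U, hUT, hU, rfl⟩
  have hle : N S ≤ N U := by
    by_contra! h2
    have h3 : (N U + 1) * (r + 1 : ℤ) ≤ N S * (r + 1) :=
      mul_le_mul_of_nonneg_right (by omega) (by positivity)
    have h4 : (N U + 1) * (r + 1 : ℤ) = N U * (r + 1) + r + 1 := by ring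
    omega
  refine ⟨(hN hS hU).2 hle, fun hlt => lt_of_not_ge fun hge => ?_⟩
  have h2 : N U = N S := ((hN hU hS).1 hge).antisymm hle
  rw [h2] at h1
  omega

theorem exists_maximal_destabilizing_quotient {T : P} (hT : 0 < h.rk T) :
    ∃ S < T, h.rk S < h.rk T ∧ (∀ U < T, h.μ S T ≤ h.μ U T) ∧
      (∀ U, S < U → U ≤ T → h.μ S U ≤ h.μ S T) ∧ ∀ U < S, h.μ S T < h.μ U S := by
  obtain ⟨S, hST, hS, hmin⟩ := h.exists_min hT
  refine ⟨S, hST, hS, fun U hU => ?_, fun U hSU hUT => ?_, fun U hUS => ?_⟩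
  · rcases (h.rk_mono hU.le).eq_or_lt with h1 | h1
    · rw [μ_of_rk_eq h1]
      exact le_top
    · exact (hmin U hU.le h1).1
  · rcases hUT.eq_or_lt with rfl | hUT
    · exact le_rfl
    rcases (h.rk_mono hUT.le).eq_or_lt with h1 | h1
    · have := h.deg_lt hUT h1
      rw [μ_le_iff (by omega) hS, h1]
      exact mul_le_mul_of_nonneg_right (by omega) (by omega)
    · have h2 := (hmin U hUT.le h1).1
      rw [μ_le_iff hS h1] at h2
      rcases (h.rk_mono hSU.le).eq_or_lt with h3 | h3
      · have := h.deg_lt hSU h3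
        rw [h3] at h2
        have := le_of_mul_le_mul_right h2 (by omega)
        omega
      · rw [μ_le_iff h3 hS]
        linarith
  · rcases (h.rk_mono hUS.le).eq_or_lt with h1 | h1
    · rw [μ_of_rk_eq h1]
      exact μ_lt_top hS
    · have h2 := (hmin U (hUS.trans hST).le (h1.trans hS)).2 h1
      rw [μ_lt_iff hS (h1.trans hS)] at h2
      rw [μ_lt_iff hS h1]
      linarith

/-- The chain of subobjects in the Harder-Narasimhan filtration of `T`. -/
structure IsHNChain (T : P) (n : ℕ) (s : ℕ → P) : Prop where
  zero : s 0 = T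
  last : s n = ⊥
  lt : ∀ j < n, s (j + 1) < s j
  semistable : ∀ j < n, ∀ U, s (j + 1) < U → U ≤ s j → h.μ (s (j + 1)) U ≤ h.μ (s (j + 1)) (s j)
  le_quotient : ∀ j < n, ∀ U < s j, h.μ (s (j + 1)) (s j) ≤ h.μ U (s j)
  slope_lt : ∀ j, j + 1 < n → h.μ (s (j + 1)) (s j) < h.μ (s (j + 2)) (s (j + 1))

theorem exists_isHNChain (T : P) : ∃ n s, h.IsHNChain T n s := by
  induction hr : h.rk T using Nat.strong_induction_on generalizing T with
  | _ r ih =>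
    rcases Nat.eq_zero_or_pos r with h0 | h0
    · have hrk {U : P} (hU : U ≤ T) : h.rk U = 0 := by
        have := h.rk_mono hU
        omega
      rcases eq_or_ne T ⊥ with rfl | hT
      · exact ⟨0, fun _ => ⊥, rfl, rfl, by simp, by simp, by simp, by simp⟩
      · refine ⟨1, fun j => if j = 0 then T else ⊥, by simp, by simp, ?_, ?_, ?_, by simp⟩
        · intro j hj
          obtain rfl : j = 0 := by omega
          simpa using hT.bot_lt
        · intro j hj U hU hUT
          obtain rfl : j = 0 := by omega
          simp [μ_of_rk_eq (h.rk_bot.trans (hrk le_rfl).symm)]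
        · intro j hj U hU
          obtain rfl : j = 0 := by omega
          simp only [if_true] at hU ⊢
          rw [μ_of_rk_eq ((hrk hU.le).trans (hrk le_rfl).symm)]
          exact le_top
    · obtain ⟨S, hST, hS, h1, h2, h3⟩ := h.exists_maximal_destabilizing_quotient (hr ▸ h0)
      obtain ⟨n, s, hs⟩ := ih _ (hr ▸ hS) S rfl
      refine ⟨n + 1, fun j => Nat.casesOn j T s, rfl, hs.last, ?_, ?_, ?_, ?_⟩
      · rintro (_ | j) hj
        · simpa [hs.zero] using hST
        · exact hs.lt j (by omega)
      · rintro (_ | j) hj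
        · simpa [hs.zero] using h2
        · exact hs.semistable j (by omega)
      · rintro (_ | j) hj
        · simpa [hs.zero] using h1
        · exact hs.le_quotient j (by omega)
      · rintro (_ | j) hj
        · have := h3 (s 1) (hs.zero ▸ hs.lt 0 (by omega))
          simpa [hs.zero] using this
        · exact hs.slope_lt j (by omega)

end SlopeOrder

end SlopeOrder

end

section

section ZeroSheaf

theorem eq_zero_of_isZero {M : X.Modules} (hM : IsZero M) {U : X.Opens} (s : Γ(M, U)) : s = 0 := by
  have : (𝟙 M : M ⟶ M).app U s = (0 : M ⟶ M).app U s := by rw [hM.eq_of_src (𝟙 M) 0]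
  exact this

theorem isCoherent_of_isZero {M : X.Modules} (hM : IsZero M) : IsCoherent M where
  quasicoherent := IsQCoh.isQuasicoherent fun _ _ =>
    ⟨fun _ s => ⟨0, 0, by rw [eq_zero_of_isZero hM s]; simp⟩,
      fun _ t _ => ⟨0, by rw [eq_zero_of_isZero hM t, smul_zero]⟩⟩
  finite U _ :=
    have : Subsingleton Γ(M, U) := ⟨fun s t => by
      rw [eq_zero_of_isZero hM s, eq_zero_of_isZero hM t]⟩
    inferInstance

/-- The short exact sequence of a monomorphism and its cokernel. -/
theorem shortExact_cokernel {M N : X.Modules} (φ : M ⟶ N) [Mono φ] :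
    (ShortComplex.mk φ (cokernel.π φ) (cokernel.condition φ)).ShortExact where
  exact := ShortComplex.exact_cokernel φ
  mono_f := by assumption
  epi_g := inferInstanceAs (Epi (cokernel.π φ))

theorem rank_eq_zero_of_isZero [IsIntegral X] {M : X.Modules} (hM : IsZero M) : rank M = 0 := by
  have : Subsingleton (genericStalk M) := ⟨fun a b => by
    obtain ⟨U, hU, s, rfl⟩ := exists_germ_eq M a
    obtain ⟨V, hV, t, rfl⟩ := exists_germ_eq M b
    rw [eq_zero_of_isZero hM s, eq_zero_of_isZero hM t, map_zero, map_zero]⟩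
  exact Module.finrank_zero_of_subsingleton

end ZeroSheaf

section RankDegree

variable [IsIntegral X] [IsRegularCurve X] {k : Type u} [Field k] (f : X ⟶ Spec (.of k))
  [IsProper f]

theorem rank_add_cokernel {M N : X.Modules} (φ : M ⟶ N) [Mono φ] (hM : IsCoherent M)
    (hN : IsCoherent N) : rank N = rank M + rank (cokernel φ) :=
  rank_add (S := ShortComplex.mk φ (cokernel.π φ) (cokernel.condition φ)) (shortExact_cokernel φ)
     hM hN (IsCoherent.cokernel φ hM.isQCoh hN)

theorem degree_add_cokernel {M N : X.Modules} (φ : M ⟶ N) [Mono φ] (hM : IsCoherent M)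
    (hN : IsCoherent N) : degree f N = degree f M + degree f (cokernel φ) :=
  degree_add f (S := ShortComplex.mk φ (cokernel.π φ) (cokernel.condition φ))
    (shortExact_cokernel φ) hM hN (IsCoherent.cokernel φ hM.isQCoh hN)

theorem degree_eq_zero_of_isZero {M : X.Modules} (hM : IsZero M) : degree f M = 0 := by
  have h := degree_add f (S := ShortComplex.mk (0 : M ⟶ M) (0 : M ⟶ M) (by simp))
    { exact := ShortComplex.exact_of_isZero_X₂ _ hM
      mono_f := ⟨fun _ _ _ => hM.eq_of_tgt _ _⟩
      epi_g := ⟨fun _ _ _ => hM.eq_of_src _ _⟩ } (isCoherent_of_isZero hM) (isCoherent_of_isZero hM)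
    (isCoherent_of_isZero hM)
  change degree f M = degree f M + degree f M at h
  omega

theorem rank_congr {M N : X.Modules} (e : M ≅ N) (hM : IsCoherent M) : rank M = rank N := by
  have h := rank_add_cokernel e.hom hM (hM.of_iso e)
  rw [rank_eq_zero_of_isZero (isZero_cokernel_of_epi e.hom)] at h
  exact h.symm

theorem degree_congr {M N : X.Modules} (e : M ≅ N) (hM : IsCoherent M) :
    degree f M = degree f N := by
  have h := degree_add_cokernel f e.hom hM (hM.of_iso e)
  rw [degree_eq_zero_of_isZero f (isZero_cokernel_of_epi e.hom), add_zero] at h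
  exact h.symm

end RankDegree

section Extension

variable {C : Type*} [Category C] [Abelian C]

/-- The preimage of a subobject of a quotient. -/
theorem exists_preimage {S T F : C} (s : S ⟶ T) [Mono s] (j : F ⟶ cokernel s) [Mono j] :
    ∃ (v : S ⟶ kernel (cokernel.π s ≫ cokernel.π j)) (p : kernel (cokernel.π s ≫ cokernel.π j) ⟶ F)
      (hvp : v ≫ p = 0), v ≫ kernel.ι _ = s ∧ (ShortComplex.mk v p hvp).ShortExact := by
  let v : S ⟶ kernel (cokernel.π s ≫ cokernel.π j) := kernel.lift _ s (by simp)
  have hv : v ≫ kernel.ι _ = s := kernel.lift_ι _ _ _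
  have : Mono v := mono_of_mono_fac hv
  let p : kernel (cokernel.π s ≫ cokernel.π j) ⟶ F :=
    Abelian.monoLift j (kernel.ι _ ≫ cokernel.π s) (by simp)
  have hp : p ≫ j = kernel.ι _ ≫ cokernel.π s := Abelian.monoLift_comp _ _ _
  have hvp : v ≫ p = 0 := by
    rw [← cancel_mono j, Category.assoc, hp, reassoc_of% hv, cokernel.condition, zero_comp]
  have hepi : Epi p := by
    let q : pullback j (cokernel.π s) ⟶ kernel (cokernel.π s ≫ cokernel.π j) :=
      kernel.lift _ (pullback.snd j (cokernel.π s)) (by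
        rw [← Category.assoc, ← pullback.condition, Category.assoc, cokernel.condition, comp_zero])
    have hq : q ≫ p = pullback.fst j (cokernel.π s) := by
      rw [← cancel_mono j, Category.assoc, hp, kernel.lift_ι_assoc, pullback.condition]
    have : Epi (pullback.fst j (cokernel.π s)) := inferInstance
    exact epi_of_epi_fac hq
  refine ⟨v, p, hvp, hv, { exact := ?_, mono_f := ‹_›, epi_g := hepi }⟩
  refine ShortComplex.exact_of_f_is_kernel _ (KernelFork.IsLimit.ofι' _ _ fun {Z} k hk => ?_)
  have hk' : k ≫ kernel.ι _ ≫ cokernel.π s = 0 := by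
    rw [← hp, reassoc_of% hk, zero_comp]
  exact ⟨Abelian.monoLift s (k ≫ kernel.ι _) (by rw [Category.assoc, hk']), by
    rw [← cancel_mono (kernel.ι (cokernel.π s ≫ cokernel.π j)), Category.assoc, hv,
      Abelian.monoLift_comp]⟩

end Extension

end

section

section CoherentSubsheaves

variable {I : Type}

/-- The graded coherent subsheaves of a graded sheaf. -/
abbrev CoherentSub (E : I → X.Modules) : Type _ :=
  {S : ∀ i, Subobject (E i) // ∀ i, IsCoherent (S i : X.Modules)}

instance (E : I → X.Modules) : OrderBot (CoherentSub E) where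
  bot := ⟨fun _ => ⊥, fun _ => isCoherent_of_isZero
    (IsZero.of_iso (isZero_zero _) Subobject.botCoeIsoZero)⟩
  bot_le _ _ := bot_le

namespace CoherentSub

variable {E : I → X.Modules}

/-- The quotient `T / S` of graded coherent subsheaves. -/
def quotient {S T : CoherentSub E} (h : S ≤ T) : I → X.Modules :=
  fun i => cokernel (Subobject.ofLE (S.1 i) (T.1 i) (h i))

variable {S T : CoherentSub E} (h : S ≤ T)

theorem isCoherent_quotient (i : I) : IsCoherent (quotient h i) :=
  IsCoherent.cokernel _ (S.2 i).isQCoh (T.2 i)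

theorem le_of_isZero_quotient {i : I} (h0 : IsZero (quotient h i)) : T.1 i ≤ S.1 i := by
  have : Epi (Subobject.ofLE (S.1 i) (T.1 i) (h i)) := Preadditive.epi_of_isZero_cokernel _ h0
  have := isIso_of_mono_of_epi (Subobject.ofLE (S.1 i) (T.1 i) (h i))
  refine Subobject.le_of_comm (inv (Subobject.ofLE (S.1 i) (T.1 i) (h i))) ?_
  rw [IsIso.inv_comp_eq, Subobject.ofLE_arrow]

end CoherentSub

variable [Fintype I] [IsIntegral X] {k : Type u} [Field k] (f : X ⟶ Spec (.of k))

/-- The rank of a graded sheaf. -/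
def gradedRank (E : I → X.Modules) : ℕ := ∑ i, rank (E i)

/-- The degree of a graded sheaf. -/
def gradedDegree (E : I → X.Modules) : ℤ := ∑ i, degree f (E i)

theorem slope_eq_slopeOf (E : I → X.Modules) :
    slope f E = slopeOf (gradedRank E) (gradedDegree f E) := rfl

theorem gradedRank_eq_zero_of_isZero {E : I → X.Modules} (hE : ∀ i, IsZero (E i)) :
    gradedRank E = 0 := Finset.sum_eq_zero fun i _ => rank_eq_zero_of_isZero (hE i)

variable [IsRegularCurve X]

theorem gradedDegree_nonneg_of_gradedRank_eq_zero {E : I → X.Modules}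
    (hE : ∀ i, IsCoherent (E i)) (h0 : gradedRank E = 0) : 0 ≤ gradedDegree f E :=
  Finset.sum_nonneg fun i hi =>
    degree_nonneg_of_rank_eq_zero (hE i) ((Finset.sum_eq_zero_iff.1 h0) i hi) f

variable [IsProper f]

section Mono

variable {E F : I → X.Modules} (φ : ∀ i, E i ⟶ F i) [∀ i, Mono (φ i)]
  (hE : ∀ i, IsCoherent (E i)) (hF : ∀ i, IsCoherent (F i))

include hE hF

theorem gradedRank_add_cokernel :
    gradedRank F = gradedRank E + gradedRank fun i => cokernel (φ i) := by
  rw [gradedRank, gradedRank, gradedRank, ← Finset.sum_add_distrib]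
  exact Finset.sum_congr rfl fun i _ => rank_add_cokernel (φ i) (hE i) (hF i)

theorem gradedDegree_add_cokernel :
    gradedDegree f F = gradedDegree f E + gradedDegree f fun i => cokernel (φ i) := by
  rw [gradedDegree, gradedDegree, gradedDegree, ← Finset.sum_add_distrib]
  exact Finset.sum_congr rfl fun i _ => degree_add_cokernel f (φ i) (hE i) (hF i)

end Mono

theorem isZero_of_gradedDegree_eq_zero {E : I → X.Modules}
    (hE : ∀ i, IsCoherent (E i)) (h0 : gradedRank E = 0) (h : gradedDegree f E = 0) (i : I) :
    IsZero (E i) := by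
  have h1 (i : I) : rank (E i) = 0 := (Finset.sum_eq_zero_iff.1 h0) i (Finset.mem_univ i)
  exact isZero_of_degree_eq_zero f (hE i) (h1 i) ((Finset.sum_eq_zero_iff_of_nonneg fun i _ =>
    degree_nonneg_of_rank_eq_zero (hE i) (h1 i) f).1 h i (Finset.mem_univ i))

theorem gradedRank_congr {E F : I → X.Modules} (e : ∀ i, E i ≅ F i)
    (hE : ∀ i, IsCoherent (E i)) : gradedRank E = gradedRank F :=
  Finset.sum_congr rfl fun i _ => rank_congr (e i) (hE i)

theorem gradedDegree_congr {E F : I → X.Modules} (e : ∀ i, E i ≅ F i)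
    (hE : ∀ i, IsCoherent (E i)) : gradedDegree f E = gradedDegree f F :=
  Finset.sum_congr rfl fun i _ => degree_congr f (e i) (hE i)

theorem gradedDegree_eq_zero_of_isZero {E : I → X.Modules} (hE : ∀ i, IsZero (E i)) :
    gradedDegree f E = 0 := Finset.sum_eq_zero fun i _ => degree_eq_zero_of_isZero f (hE i)

namespace CoherentSub

variable {E : I → X.Modules} {S T : CoherentSub E} (h : S ≤ T)

theorem gradedRank_eq_add : gradedRank (fun i => (T.1 i : X.Modules)) =
    gradedRank (fun i => (S.1 i : X.Modules)) + gradedRank (quotient h) :=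
  gradedRank_add_cokernel (fun i => Subobject.ofLE (S.1 i) (T.1 i) (h i)) S.2 T.2

theorem gradedDegree_eq_add : gradedDegree f (fun i => (T.1 i : X.Modules)) =
    gradedDegree f (fun i => (S.1 i : X.Modules)) + gradedDegree f (quotient h) :=
  gradedDegree_add_cokernel f (fun i => Subobject.ofLE (S.1 i) (T.1 i) (h i)) S.2 T.2

/-- Ranks and degrees of graded coherent subsheaves. -/
def slopeOrder (hB : ∃ B, ∀ S : CoherentSub E, gradedDegree f (fun i => (S.1 i : X.Modules)) ≤ B) :
    SlopeOrder (CoherentSub E) where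
  rk S := gradedRank fun i => (S.1 i : X.Modules)
  deg S := gradedDegree f fun i => (S.1 i : X.Modules)
  rk_bot := gradedRank_eq_zero_of_isZero fun _ =>
    IsZero.of_iso (isZero_zero _) Subobject.botCoeIsoZero
  rk_mono {S T} h := by
    rw [gradedRank_eq_add h]
    exact Nat.le_add_right _ _
  deg_lt {S T} h hr := by
    rw [gradedRank_eq_add h.le] at hr
    have h0 : gradedRank (quotient h.le) = 0 := by omega
    have h1 := gradedDegree_nonneg_of_gradedRank_eq_zero f (isCoherent_quotient h.le) h0
    rw [gradedDegree_eq_add f h.le]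
    rcases h1.eq_or_lt with h2 | h2
    · exact (h.not_ge fun i => le_of_isZero_quotient h.le
        (isZero_of_gradedDegree_eq_zero f (isCoherent_quotient h.le) h0 h2.symm i)).elim
    · omega
  bddAbove := hB

variable (hB : ∃ B, ∀ S : CoherentSub E, gradedDegree f (fun i => (S.1 i : X.Modules)) ≤ B)

theorem slope_quotient : slope f (quotient h) = (slopeOrder f hB).μ S T := by
  rw [slope_eq_slopeOf]
  change _ = slopeOf (gradedRank _ - gradedRank _) (gradedDegree f _ - gradedDegree f _)
  rw [gradedRank_eq_add h, gradedDegree_eq_add f h]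
  congr 1 <;> omega

theorem exists_extension {F : I → X.Modules} (j : ∀ i, F i ⟶ quotient h i)
    (hF : ∀ i, IsCoherent (F i)) (hj : ∀ i, Mono (j i)) :
    ∃ (U : CoherentSub E) (hSU : S ≤ U), U ≤ T ∧ gradedRank F = gradedRank (quotient hSU) ∧
      gradedDegree f F = gradedDegree f (quotient hSU) ∧ (S = U → ∀ i, IsZero (F i)) := by
  have key (i : I) : ∃ U : Subobject (E i), IsCoherent (U : X.Modules) ∧ U ≤ T.1 i ∧
      ∃ hSU : S.1 i ≤ U, Nonempty (cokernel (Subobject.ofLE (S.1 i) U hSU) ≅ F i) := by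
    let j' : F i ⟶ cokernel (Subobject.ofLE (S.1 i) (T.1 i) (h i)) := j i
    have : Mono j' := hj i
    obtain ⟨v, p, hvp, hv, hS⟩ := exists_preimage (Subobject.ofLE (S.1 i) (T.1 i) (h i)) j'
    let K := kernel (cokernel.π (Subobject.ofLE (S.1 i) (T.1 i) (h i)) ≫ cokernel.π j')
    let u : K ⟶ E i := kernel.ι _ ≫ (T.1 i).arrow
    have hK : IsCoherent K := IsCoherent.kernel _ (T.2 i)
      ((IsCoherent.cokernel _ (hF i).isQCoh (isCoherent_quotient h i)).isQCoh)
    let e : (Subobject.mk u : X.Modules) ≅ K := Subobject.underlyingIso u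
    have hSU : S.1 i ≤ Subobject.mk u := Subobject.le_mk_of_comm v (by
      change v ≫ kernel.ι _ ≫ (T.1 i).arrow = _
      rw [reassoc_of% hv, Subobject.ofLE_arrow])
    refine ⟨Subobject.mk u, hK.of_iso e.symm,
      Subobject.mk_le_of_comm (kernel.ι _) rfl, hSU, ⟨?_⟩⟩
    have hve : Subobject.ofLE (S.1 i) (Subobject.mk u) hSU ≫ e.hom = 𝟙 _ ≫ v := by
      rw [← cancel_mono u, Category.assoc, Subobject.underlyingIso_hom_comp_eq_mk,
        Subobject.ofLE_arrow, Category.id_comp]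
      change _ = v ≫ kernel.ι _ ≫ (T.1 i).arrow
      rw [reassoc_of% hv, Subobject.ofLE_arrow]
    have := hS.epi_g
    exact cokernel.mapIso _ _ (Iso.refl _) e hve ≪≫
      (cokernelIsCokernel v).coconePointUniqueUpToIso hS.exact.gIsCokernel
  choose U hU hUT hSU e using key
  refine ⟨⟨U, hU⟩, hSU, hUT, ?_, ?_, ?_⟩
  · exact (gradedRank_congr (fun i => (e i).some.symm) hF)
  · exact (gradedDegree_congr f (fun i => (e i).some.symm) hF)
  · rintro h1 i
    refine IsZero.of_iso ?_ (e i).some.symm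
    have : S.1 i = U i := congrFun (congrArg Subtype.val h1) i
    have : IsIso (Subobject.ofLE (S.1 i) (U i) (hSU i)) :=
      ⟨Subobject.ofLE (U i) (S.1 i) this.ge, by simp, by simp⟩
    exact isZero_cokernel_of_epi _

theorem isSemistableGraded_quotient
    (hs : ∀ U, S < U → U ≤ T → (slopeOrder f hB).μ S U ≤ (slopeOrder f hB).μ S T) :
    IsSemistableGraded f (quotient h) := by
  intro F j hF hj hne
  obtain ⟨U, hSU, hUT, h1, h2, h3⟩ := exists_extension f h j hF hj
  have hlt : S < U := hSU.lt_of_ne fun h0 => hne.elim fun i hi => hi (h3 h0 i)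
  have h4 := hs U hlt hUT
  rwa [← slope_quotient f h, ← slope_quotient f hSU, slope_eq_slopeOf f (quotient hSU), ← h1, ← h2,
    ← slope_eq_slopeOf] at h4

/-- The Harder-Narasimhan filtration given by a chain of coherent subsheaves. -/
theorem exists_hnFiltration {T : CoherentSub E}
    (hT : ∀ i, T.1 i = ⊤) {n : ℕ} {s : ℕ → CoherentSub E}
    (hs : (slopeOrder f hB).IsHNChain T n s) :
    ∃ H : HNFiltration f E, H.length = n ∧ ∀ j : Fin H.length,
      slope f (H.factor j) = (slopeOrder f hB).μ (s (j + 1)) (s j) := by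
  have hle (j : Fin n) : s (j.succ : Fin (n + 1)) ≤ s (j.castSucc : Fin (n + 1)) := (hs.lt j j.2).le
  have hmono : StrictMono fun j : Fin n => (slopeOrder f hB).μ (s (j + 1)) (s j) := by
    cases n with
    | zero => exact fun i => i.elim0
    | succ n => exact Fin.strictMono_iff_lt_succ.2 fun j => hs.slope_lt j (by omega)
  refine ⟨{
    length := n
    step := fun j => (s j).1
    step_zero := fun i => by
      rw [Fin.val_zero, hs.zero, hT]
    step_last := fun i => by
      rw [Fin.val_last, hs.last]
      rfl
    step_coherent := fun j => (s j).2
    step_lt := fun j => hs.lt j j.2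
    factor_semistable := fun j => isSemistableGraded_quotient f (hle j) hB (hs.semistable j j.2)
    slope_strictMono := fun i j hij => by
      have h := hmono hij
      dsimp only at h
      erw [← slope_quotient f (hle i) hB, ← slope_quotient f (hle j) hB] at h
      exact h }, rfl, fun j => slope_quotient f (hle j) hB⟩

end CoherentSub

end CoherentSubsheaves

end

section

namespace SlopeOrder.IsHNChain

variable {P : Type*} [PartialOrder P] [OrderBot P] {h : SlopeOrder P} {T : P} {n : ℕ} {s : ℕ → P}
  (hs : h.IsHNChain T n s)

include hs

theorem slope_mono {i j : ℕ} (hij : i ≤ j) (hj : j < n) :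
    h.μ (s (i + 1)) (s i) ≤ h.μ (s (j + 1)) (s j) := by
  induction hij with
  | refl => exact le_rfl
  | step _ ih => exact (ih (by omega)).trans (hs.slope_lt _ hj).le

theorem rk_lt {j : ℕ} (hj : j + 1 < n) : h.rk (s (j + 1)) < h.rk (s j) := by
  refine (h.rk_mono (hs.lt j (by omega)).le).lt_of_ne fun heq => ?_
  have := hs.slope_lt j hj
  rw [μ_of_rk_eq heq] at this
  exact not_top_lt this

theorem le_zero {j : ℕ} (hj : j ≤ n) : s j ≤ T := by
  induction j with
  | zero => exact hs.zero.le
  | succ j ih => exact (hs.lt j (by omega)).le.trans (ih (by omega))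

theorem rk_lt_rk {j : ℕ} (hj : 0 < j) (hjn : j < n) : h.rk (s j) < h.rk T := by
  obtain ⟨j, rfl⟩ := Nat.exists_eq_add_one.2 hj
  exact (hs.rk_lt hjn).trans_le (h.rk_mono (hs.le_zero (by omega)))

theorem μ_lt_μ {j : ℕ} (hj : 0 < j) (hjn : j < n) : h.μ ⊥ T < h.μ ⊥ (s j) := by
  obtain ⟨j, rfl⟩ := Nat.exists_eq_add_one.2 hj
  have hrk := hs.rk_lt_rk hj hjn
  rcases Nat.eq_zero_or_pos (h.rk (s (j + 1))) with h0 | h0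
  · rw [μ_of_rk_eq (h.rk_bot.trans h0.symm)]
    exact μ_lt_top (by rw [h.rk_bot]; omega)
  have hlt := hs.rk_lt hjn
  have key (i : ℕ) (hi : i ≤ j + 1) :
      (h.deg T - h.deg (s i)) * (h.rk (s j) - h.rk (s (j + 1)) : ℤ) ≤
        (h.deg (s j) - h.deg (s (j + 1))) * (h.rk T - h.rk (s i)) := by
    induction i with
    | zero => simp [hs.zero]
    | succ i ih =>
      have h1 := hs.slope_mono (i := i) (j := j) (by omega) (by omega)
      rw [μ_le_iff (hs.rk_lt (by omega)) hlt] at h1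
      have h2 := ih (by omega)
      linarith
  have h1 := (hs.slope_lt j hjn).trans_le
    (hs.le_quotient (j + 1) hjn ⊥ ((hs.lt (j + 1) hjn).bot_lt))
  rw [μ_lt_iff hlt (by rwa [h.rk_bot])] at h1
  rw [μ_lt_iff (by rw [h.rk_bot]; omega) (by rwa [h.rk_bot])]
  have h2 := key (j + 1) le_rfl
  rw [h.rk_bot] at h1 ⊢
  have hρ : (0 : ℤ) < h.rk (s j) - h.rk (s (j + 1)) := by omega
  have hR : (0 : ℤ) < h.rk T - h.rk (s (j + 1)) := by omega
  have hr : (0 : ℤ) < h.rk (s (j + 1)) := by omega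
  push_cast at h1 ⊢
  have h3 := mul_le_mul_of_nonneg_right h2 hr.le
  have h4 := mul_lt_mul_of_pos_right h1 hR
  refine lt_of_mul_lt_mul_right ?_ hρ.le
  linarith

theorem μ_le_of_slope_le {l : ℤ} (hn : 1 < n) (h0 : h.μ (s 1) (s 0) < 0)
    (hl : ∀ j, j + 1 < n →
      h.μ (s (j + 2)) (s (j + 1)) ≤ h.μ (s (j + 1)) (s j) + ((l : ℚ) : WithTop ℚ)) :
    h.μ ⊥ T ≤ ((l * ((h.rk T : ℚ) - 1) / 2 : ℚ) : WithTop ℚ) ∧ 0 < l ∧ 0 < h.rk T := by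
  have hrk {j : ℕ} (hj : j < n) : h.rk (s (j + 1)) < h.rk (s j) := by
    rcases j with _ | j
    · exact hs.rk_lt hn
    · refine (h.rk_mono (hs.lt (j + 1) hj).le).lt_of_ne fun heq => ?_
      have h1 := hl j hj
      rw [μ_of_rk_eq heq, top_le_iff, WithTop.add_eq_top] at h1
      exact h1.elim (μ_lt_top (hs.rk_lt hj)).ne (by simp)
  let q (j : ℕ) : ℚ := ((h.deg (s j) - h.deg (s (j + 1)) : ℤ) : ℚ) /
    ((h.rk (s j) - h.rk (s (j + 1)) : ℕ) : ℚ)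
  have hq {j : ℕ} (hj : j < n) : h.μ (s (j + 1)) (s j) = ((q j : ℚ) : WithTop ℚ) :=
    slopeOf_of_pos (Nat.sub_pos_of_lt (hrk hj)) _
  have hq0 : q 0 < 0 := by
    rw [hq (by omega : 0 < n)] at h0
    exact_mod_cast h0
  have hql {j : ℕ} (hj : j + 1 < n) : q (j + 1) ≤ q j + l := by
    have h1 := hl j hj
    rw [hq hj, hq (by omega)] at h1
    exact_mod_cast h1
  have hlt : q 0 < q 1 := by
    have h1 := hs.slope_lt 0 hn
    rw [hq (by omega), hq hn] at h1
    exact_mod_cast h1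
  have hl0 : (0 : ℚ) < l := by linarith [hql hn]
  have hqj {j : ℕ} (hj : j < n) : q j ≤ l * j := by
    induction j with
    | zero => simpa using hq0.le
    | succ j ih =>
      have h1 := ih (by omega)
      have h2 := hql hj
      push_cast
      linarith
  have key (j : ℕ) (hj : j ≤ n) : h.rk (s j) + j ≤ h.rk T ∧
      ((h.deg T : ℚ) - h.deg (s j)) ≤ l * ((h.rk T : ℚ) - h.rk (s j)) *
        ((h.rk T : ℚ) - h.rk (s j) - 1) / 2 := by
    induction j with
    | zero => simp [hs.zero]
    | succ j ih =>
      obtain ⟨h1, h2⟩ := ih (by omega)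
      have h3 := hrk hj
      refine ⟨by omega, ?_⟩
      have h4 : (h.deg (s j) : ℚ) - h.deg (s (j + 1)) =
          q j * ((h.rk (s j) : ℚ) - h.rk (s (j + 1))) := by
        have h5 : ((h.rk (s j) - h.rk (s (j + 1)) : ℕ) : ℚ) ≠ 0 := by
          exact_mod_cast (Nat.sub_pos_of_lt h3).ne'
        rw [← Nat.cast_sub h3.le, div_mul_cancel₀ _ h5]
        push_cast
        rfl
      have h6 : (1 : ℚ) ≤ (h.rk (s j) : ℚ) - h.rk (s (j + 1)) := by
        rw [← Nat.cast_sub h3.le]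
        exact_mod_cast Nat.sub_pos_of_lt h3
      have h7 : (h.rk (s j) : ℚ) + j ≤ h.rk T := by exact_mod_cast h1
      have h8 : q j * ((h.rk (s j) : ℚ) - h.rk (s (j + 1))) ≤
          l * ((h.rk T : ℚ) - h.rk (s j)) * ((h.rk (s j) : ℚ) - h.rk (s (j + 1))) :=
        mul_le_mul_of_nonneg_right ((hqj hj).trans
          (mul_le_mul_of_nonneg_left (by linarith) hl0.le)) (by linarith)
      have h9 : 0 ≤ l * (((h.rk (s j) : ℚ) - h.rk (s (j + 1))) *
          ((h.rk (s j) : ℚ) - h.rk (s (j + 1)) - 1)) :=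
        mul_nonneg hl0.le (mul_nonneg (by linarith) (by linarith))
      linarith
  have hR : 0 < h.rk T := (Nat.zero_le _).trans_lt (hs.zero ▸ hrk (by omega : 0 < n))
  refine ⟨?_, by exact_mod_cast hl0, hR⟩
  have h1 := (key n le_rfl).2
  rw [hs.last, h.rk_bot] at h1
  rw [μ, h.rk_bot, Nat.sub_zero, slopeOf_of_pos hR, WithTop.coe_le_coe,
    div_le_iff₀ (by exact_mod_cast hR)]
  push_cast at h1 ⊢
  linarith

end SlopeOrder.IsHNChain

end

section

section Bounded

variable {I : Type} [Fintype I] [IsIntegral X] {k : Type u} [Field k]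

theorem HNFiltration.isCoherent_factor {f : X ⟶ Spec (.of k)}
    {E : I → X.Modules} (H : HNFiltration f E) (j : Fin H.length) (i : I) :
    IsCoherent (H.factor j i) :=
  IsCoherent.cokernel _ (H.step_coherent _ i).isQCoh (H.step_coherent _ i)

/-- The first step of a Harder-Narasimhan filtration is everything. -/
def HNFiltration.stepZeroIso {f : X ⟶ Spec (.of k)} {E : I → X.Modules} (H : HNFiltration f E)
    (i : I) : (H.step 0 i : X.Modules) ≅ E i :=
  have := (Subobject.isIso_arrow_iff_eq_top (H.step 0 i)).2 (H.step_zero i)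
  asIso (H.step 0 i).arrow

variable [IsRegularCurve X] (f : X ⟶ Spec (.of k)) [IsProper f]

theorem gradedDegree_le_of_isSemistableGraded {Q G : I → X.Modules}
    (hQs : IsSemistableGraded f Q) (hQ : ∀ i, IsCoherent (Q i)) (hG : ∀ i, IsCoherent (G i))
    (φ : ∀ i, G i ⟶ Q i) (hφ : ∀ i, Mono (φ i)) :
    gradedDegree f G ≤ max 0 (gradedDegree f Q) := by
  by_cases hz : ∀ i, IsZero (G i)
  · rw [gradedDegree_eq_zero_of_isZero f hz]
    exact le_max_left _ _
  push Not at hz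
  have h1 := hQs G φ hG hφ hz
  have h2 := gradedRank_add_cokernel φ hG hQ
  have h3 := gradedDegree_add_cokernel f φ hG hQ
  rw [slope_eq_slopeOf, slope_eq_slopeOf] at h1
  rcases Nat.eq_zero_or_pos (gradedRank Q) with h0 | h0
  · have h4 := gradedDegree_nonneg_of_gradedRank_eq_zero f (E := fun i => cokernel (φ i))
      (fun i => IsCoherent.cokernel (φ i) (hG i).isQCoh (hQ i)) (by omega)
    exact le_max_of_le_right (by omega)
  · have hpos : 0 < gradedRank G := slopeOf_lt_top.1 (h1.trans_lt (slopeOf_lt_top.2 h0))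
    rw [slopeOf_le_slopeOf hpos h0] at h1
    refine le_of_mul_le_mul_right (h1.trans ?_) (by exact_mod_cast h0 : (0 : ℤ) < gradedRank Q)
    exact (mul_le_mul_of_nonneg_right (le_max_right _ _) (by positivity)).trans
      (mul_le_mul_of_nonneg_left (by omega) (le_max_left _ _))

variable {f} {E : I → X.Modules}

theorem HNFiltration.exists_gradedDegree_le (H : HNFiltration f E) :
    ∃ B, ∀ (G : I → X.Modules) (φ : ∀ i, G i ⟶ E i), (∀ i, IsCoherent (G i)) →
      (∀ i, Mono (φ i)) → gradedDegree f G ≤ B := by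
  have key (j : Fin (H.length + 1)) : ∃ B, ∀ (G : I → X.Modules)
      (φ : ∀ i, G i ⟶ (H.step j i : X.Modules)), (∀ i, IsCoherent (G i)) →
      (∀ i, Mono (φ i)) → gradedDegree f G ≤ B := by
    induction j using Fin.reverseInduction with
    | last =>
      refine ⟨0, fun G φ hG hφ => (gradedDegree_eq_zero_of_isZero f fun i => ?_).le⟩
      have h0 : IsZero (H.step (Fin.last H.length) i : X.Modules) := by
        rw [H.step_last]
        exact IsZero.of_iso (isZero_zero _) Subobject.botCoeIsoZero
      have := hφ i
      exact h0.of_mono (φ i)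
    | cast j ih =>
      obtain ⟨B, hB⟩ := ih
      refine ⟨B + max 0 (gradedDegree f (H.factor j)), fun G φ hG hφ => ?_⟩
      let ι (i : I) := Subobject.ofLE (H.step j.succ i) (H.step j.castSucc i) ((H.step_lt j).le i)
      let ψ (i : I) : G i ⟶ H.factor j i := φ i ≫ cokernel.π (ι i)
      have hK (i : I) : IsCoherent (kernel (ψ i)) :=
        IsCoherent.kernel _ (hG i) (H.isCoherent_factor j i).isQCoh
      have h1 := gradedDegree_add_cokernel f (fun i => kernel.ι (ψ i)) hK hG
      have h2 := hB _ (fun i => Abelian.monoLift (ι i) (kernel.ι (ψ i) ≫ φ i)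
        (by rw [Category.assoc]; exact kernel.condition (ψ i))) hK fun i => by
          have := hφ i
          exact mono_of_mono_fac (Abelian.monoLift_comp (ι i) _ _)
      have h3 := gradedDegree_le_of_isSemistableGraded f (H.factor_semistable j)
        (H.isCoherent_factor j) (G := fun i => cokernel (kernel.ι (ψ i)))
        (fun i => IsCoherent.cokernel _ (hK i).isQCoh (hG i))
        (fun i => Abelian.factorThruCoimage (ψ i)) fun i =>
          inferInstanceAs (Mono (Abelian.factorThruCoimage (ψ i)))
      change _ ≤ max 0 (gradedDegree f (H.factor j)) at h3
      linarith
  obtain ⟨B, hB⟩ := key 0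
  refine ⟨B, fun G φ hG hφ => hB G (fun i => φ i ≫ (H.stepZeroIso i).inv) hG fun i => ?_⟩
  have := hφ i
  exact mono_comp _ _

theorem HNFiltration.gradedDegree_nonneg (H : HNFiltration f E)
    (h0 : ∀ j, 0 ≤ slope f (H.factor j)) : 0 ≤ gradedDegree f E := by
  have key (j : Fin (H.length + 1)) :
      0 ≤ gradedDegree f fun i => (H.step j i : X.Modules) := by
    induction j using Fin.reverseInduction with
    | last =>
      refine (gradedDegree_eq_zero_of_isZero f fun i => ?_).ge
      rw [H.step_last]
      exact IsZero.of_iso (isZero_zero _) Subobject.botCoeIsoZero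
    | cast j ih =>
      have h1 := gradedDegree_add_cokernel f (fun i => Subobject.ofLE (H.step j.succ i)
        (H.step j.castSucc i) ((H.step_lt j).le i)) (H.step_coherent _) (H.step_coherent _)
      have h2 := h0 j
      rw [slope_eq_slopeOf] at h2
      have h3 : 0 ≤ gradedDegree f (H.factor j) := by
        rcases Nat.eq_zero_or_pos (gradedRank (H.factor j)) with hr | hr
        · exact gradedDegree_nonneg_of_gradedRank_eq_zero f (H.isCoherent_factor j) hr
        · rw [slopeOf_of_pos hr] at h2
          have h4 : (0 : ℚ) ≤ gradedDegree f (H.factor j) / gradedRank (H.factor j) := by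
            exact_mod_cast h2
          rw [le_div_iff₀ (by exact_mod_cast hr), zero_mul] at h4
          exact_mod_cast h4
      rw [h1]
      exact add_nonneg ih h3
  rw [← gradedDegree_congr f H.stepZeroIso (H.step_coherent 0)]
  exact key 0

end Bounded

end

section

section SlopeInequality

open ZeroObject

variable {I : Type} [Fintype I] [IsIntegral X] [IsRegularCurve X] {k : Type u} [Field k]
  (f : X ⟶ Spec (.of k)) [IsProper f]

theorem IsSemistableGraded.slopeOf_le {f : X ⟶ Spec (.of k)} [IsProper f] {Q : I → X.Modules}
    (hQ : IsSemistableGraded f Q) {i₀ : I} {N : X.Modules} (hN : IsCoherent N) (φ : N ⟶ Q i₀)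
    (hφ : Mono φ) (h0 : ¬ IsZero N) : slopeOf (rank N) (degree f N) ≤ slope f Q := by
  classical
  have key (i : I) : ∃ (F : X.Modules) (j : F ⟶ Q i), IsCoherent F ∧ Mono j ∧
      rank F = (if i = i₀ then rank N else 0) ∧ degree f F = (if i = i₀ then degree f N else 0) ∧
      (i = i₀ → ¬ IsZero F) := by
    by_cases hi : i = i₀
    · subst hi
      exact ⟨N, φ, hN, hφ, by simp, by simp, fun _ => h0⟩
    · have hz : IsZero (0 : X.Modules) := isZero_zero _
      exact ⟨0, 0, isCoherent_of_isZero hz, ⟨fun _ _ _ => hz.eq_of_tgt _ _⟩,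
        by simp [hi, rank_eq_zero_of_isZero hz], by simp [hi, degree_eq_zero_of_isZero f hz],
        fun h => (hi h).elim⟩
  choose F j hF hj hr hd hne using key
  have h1 := hQ F j hF hj ⟨i₀, hne i₀ rfl⟩
  rwa [slope_eq_slopeOf, gradedRank, gradedDegree, Finset.sum_congr rfl fun i _ => hr i,
    Finset.sum_congr rfl fun i _ => hd i, Finset.sum_ite_eq', Finset.sum_ite_eq',
    if_pos (Finset.mem_univ _), if_pos (Finset.mem_univ _)] at h1

theorem exists_mono_of_twist {D : CurveDivisor X} {A G : X.Modules} (hA : IsCoherent A)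
    (hG : IsCoherent G) (ψ : A ⟶ (twist D).obj G) (hψ : ψ ≠ 0) :
    ∃ (N : X.Modules) (φ : N ⟶ G), IsCoherent N ∧ Mono φ ∧ ¬ IsZero N ∧
      rank (Abelian.coimage ψ) = rank N ∧
      degree f (Abelian.coimage ψ) = degree f N + divisorDegree f D * rank N := by
  have hK : IsCoherent (kernel ψ) := IsCoherent.kernel ψ hA (hG.isQCoh.twist D)
  have hQ : IsCoherent (Abelian.coimage ψ) := IsCoherent.cokernel (kernel.ι ψ) hK.isQCoh hA
  let j := Abelian.factorThruCoimage ψ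
  have hN : IsCoherent (untwistSheaf j) := isCoherent_untwistSheaf j hQ hG
  have hr : rank (Abelian.coimage ψ) = rank (untwistSheaf j) := (untwistIso j).rank_eq
  have hd := (untwistIso j).degree_eq f hQ hN
  rw [hr] at hd
  refine ⟨untwistSheaf j, untwistι j, hN, inferInstance, fun h0 => hψ ?_, hr, hd⟩
  have hr0 := rank_eq_zero_of_isZero h0
  rw [degree_eq_zero_of_isZero f h0, hr0] at hd
  have hz := isZero_of_degree_eq_zero f hQ (hr.trans hr0) (by simpa using hd)
  rw [← Abelian.coimage.fac ψ, hz.eq_of_tgt (Abelian.coimage.π ψ) 0, zero_comp]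

namespace CoherentSub

variable {E : I → X.Modules}
  (hB : ∃ B, ∀ S : CoherentSub E, gradedDegree f (fun i => (S.1 i : X.Modules)) ≤ B)

theorem exists_lt_of_hom (S : CoherentSub E) (i₀ : I) {B : X.Modules} (hBq : IsQCoh B)
    (ψ : (S.1 i₀ : X.Modules) ⟶ B) (hψ : ψ ≠ 0) : ∃ U < S, (slopeOrder f hB).μ U S =
      slopeOf (rank (Abelian.coimage ψ)) (degree f (Abelian.coimage ψ)) := by
  classical
  have hK : IsCoherent (kernel ψ) := IsCoherent.kernel ψ (S.2 i₀) hBq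
  have hr := rank_add_cokernel (kernel.ι ψ) hK (S.2 i₀)
  have hd := degree_add_cokernel f (kernel.ι ψ) hK (S.2 i₀)
  have key (i : I) : ∃ U : Subobject (E i), IsCoherent (U : X.Modules) ∧ U ≤ S.1 i ∧
      rank (S.1 i : X.Modules) = rank (U : X.Modules) +
        (if i = i₀ then rank (Abelian.coimage ψ) else 0) ∧
      degree f (S.1 i : X.Modules) = degree f (U : X.Modules) +
        (if i = i₀ then degree f (Abelian.coimage ψ) else 0) ∧ (i = i₀ → ¬ S.1 i ≤ U) := by
    by_cases hi : i = i₀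
    · subst hi
      let e := Subobject.underlyingIso (kernel.ι ψ ≫ (S.1 i).arrow)
      refine ⟨Subobject.mk (kernel.ι ψ ≫ (S.1 i).arrow), hK.of_iso e.symm,
        Subobject.mk_le_of_comm (kernel.ι ψ) rfl, ?_, ?_, fun _ hle => hψ ?_⟩
      · rw [if_pos rfl, ← rank_congr e.symm hK]
        exact hr
      · rw [if_pos rfl, ← degree_congr f e.symm hK]
        exact hd
      · have h1 : (Subobject.ofLE _ _ hle ≫ e.hom) ≫ kernel.ι ψ = 𝟙 _ := by
          rw [← cancel_mono (S.1 i).arrow, Category.assoc, Category.assoc,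
            Subobject.underlyingIso_hom_comp_eq_mk, Subobject.ofLE_arrow, Category.id_comp]
        rw [← Category.id_comp ψ, ← h1, Category.assoc, kernel.condition, comp_zero]
    · exact ⟨S.1 i, S.2 i, le_rfl, by simp [hi], by simp [hi], fun h => (hi h).elim⟩
  choose U hU hle hUr hUd hne using key
  have h1 : (slopeOrder f hB).rk S = (slopeOrder f hB).rk ⟨U, hU⟩ + rank (Abelian.coimage ψ) := by
    change ∑ i, _ = ∑ i, _ + _
    rw [Finset.sum_congr rfl fun i _ => hUr i, Finset.sum_add_distrib, Finset.sum_ite_eq',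
      if_pos (Finset.mem_univ _)]
  have h2 : (slopeOrder f hB).deg S =
      (slopeOrder f hB).deg ⟨U, hU⟩ + degree f (Abelian.coimage ψ) := by
    change ∑ i, _ = ∑ i, _ + _
    rw [Finset.sum_congr rfl fun i _ => hUd i, Finset.sum_add_distrib, Finset.sum_ite_eq',
      if_pos (Finset.mem_univ _)]
  refine ⟨⟨U, hU⟩, lt_of_le_of_ne hle fun h => ?_, ?_⟩
  · exact hne i₀ rfl (congrFun (congrArg Subtype.val h) i₀).ge
  · rw [SlopeOrder.μ, h1, h2, Nat.add_sub_cancel_left, add_sub_cancel_left]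

end CoherentSub

end SlopeInequality

section Quiver

variable [IsIntegral X] [IsRegularCurve X] {D : CurveDivisor X} {n : ℕ}

/-- The maps of `G` send the graded subsheaf `S` to `T(D)`. -/
def QuiverSheaf.MapsTo (G : QuiverSheaf D n) (S T : CoherentSub G.obj) : Prop :=
  ∀ i, ∃ b : (S.1 i : X.Modules) ⟶ (twist D).obj (T.1 (i + 1) : X.Modules),
    b ≫ (twist D).map (T.1 (i + 1)).arrow = (S.1 i).arrow ≫ G.θ i

/-- The quiver subsheaf given by an invariant graded subsheaf. -/
def QuiverSubsheaf.restrict {E : QuiverSheaf D n} (F : QuiverSubsheaf E)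
    (S : CoherentSub F.sheaf.obj) (hS : F.sheaf.MapsTo S S) : QuiverSubsheaf E where
  sheaf :=
    { obj := fun i => S.1 i
      coherent := S.2
      θ := fun i => (hS i).choose }
  incl i := (S.1 i).arrow ≫ F.incl i
  mono i := have := F.mono i; mono_comp _ _
  comm i := by
    rw [Functor.map_comp, ← Category.assoc, (hS i).choose_spec, Category.assoc, F.comm,
      Category.assoc]

variable {k : Type u} [Field k] (f : X ⟶ Spec (.of k)) [IsProper f] [NeZero n]
  (G : QuiverSheaf D n)
  (hB : ∃ B, ∀ S : CoherentSub G.obj, gradedDegree f (fun i => (S.1 i : X.Modules)) ≤ B)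

theorem QuiverSheaf.slope_le_of_not_mapsTo {T : CoherentSub G.obj} (hT : ∀ i, T.1 i = ⊤) {N : ℕ}
    {s : ℕ → CoherentSub G.obj} (hs : (CoherentSub.slopeOrder f hB).IsHNChain T N s) {j : ℕ}
    (hj : j + 1 < N) (hinv : ¬ G.MapsTo (s (j + 1)) (s (j + 1))) :
    (CoherentSub.slopeOrder f hB).μ (s (j + 2)) (s (j + 1)) ≤
      (CoherentSub.slopeOrder f hB).μ (s (j + 1)) (s j) +
        ((divisorDegree f D : ℚ) : WithTop ℚ) := by
  obtain ⟨m, hmj, h1, h2⟩ : ∃ m ≤ j, G.MapsTo (s (j + 1)) (s m) ∧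
      ¬ G.MapsTo (s (j + 1)) (s (m + 1)) := by
    by_contra! hcon
    have key (m : ℕ) (hm : m ≤ j + 1) : G.MapsTo (s (j + 1)) (s m) := by
      induction m with
      | zero =>
        intro i
        have : IsIso ((s 0).1 (i + 1)).arrow := by
          rw [Subobject.isIso_arrow_iff_eq_top, hs.zero, hT]
        exact ⟨((s (j + 1)).1 i).arrow ≫ G.θ i ≫ inv ((twist D).map ((s 0).1 (i + 1)).arrow),
          by simp⟩
      | succ m ih => exact hcon m (by omega) (ih (by omega))
    exact hinv (key _ le_rfl)
  rw [QuiverSheaf.MapsTo, not_forall] at h2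
  obtain ⟨i, hi⟩ := h2
  obtain ⟨b, hb⟩ := h1 i
  have hle : s (m + 1) ≤ s m := (hs.lt m (by omega)).le
  let ι := Subobject.ofLE ((s (m + 1)).1 (i + 1)) ((s m).1 (i + 1)) (hle (i + 1))
  let ψ : ((s (j + 1)).1 i : X.Modules) ⟶ (twist D).obj (cokernel ι) :=
    b ≫ (twist D).map (cokernel.π ι)
  have hψ : ψ ≠ 0 := fun h0 => by
    obtain ⟨b', hb'⟩ := exists_lift_twist D
      (S := ShortComplex.mk ι (cokernel.π ι) (cokernel.condition ι))
        (ShortComplex.exact_cokernel ι) b h0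
    refine hi ⟨b', ?_⟩
    rw [← hb, ← hb', Category.assoc, ← Functor.map_comp]
    congr 2
    exact (Subobject.ofLE_arrow (hle (i + 1))).symm
  have hQ : IsCoherent (cokernel ι) := CoherentSub.isCoherent_quotient hle (i + 1)
  obtain ⟨Q, φ, hQc, hφ, hQ0, hr, hd⟩ := exists_mono_of_twist f ((s (j + 1)).2 i) hQ ψ hψ
  obtain ⟨U, hU, hUμ⟩ := CoherentSub.exists_lt_of_hom f hB (s (j + 1)) i (hQ.isQCoh.twist D) ψ hψ
  have h3 := hs.le_quotient (j + 1) hj U hU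
  have h4 := (CoherentSub.isSemistableGraded_quotient f hle hB
    (hs.semistable m (by omega))).slopeOf_le (i₀ := i + 1) hQc φ hφ hQ0
  rw [CoherentSub.slope_quotient f hle hB] at h4
  have h5 := h4.trans (hs.slope_mono hmj (by omega))
  have hpos : 0 < rank Q :=
    slopeOf_lt_top.1 (h5.trans_lt (SlopeOrder.μ_lt_top (hs.rk_lt hj)))
  refine (h3.trans_eq hUμ).trans ?_
  refine le_trans ?_ (add_le_add_left h5 _)
  rw [hr, hd, slopeOf_of_pos hpos, slopeOf_of_pos hpos, ← WithTop.coe_add, WithTop.coe_le_coe]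
  push_cast
  rw [add_div, mul_div_cancel_right₀]
  exact_mod_cast hpos.ne'

end Quiver

end

section

section Main

namespace CoherentSub

variable {I : Type}

/-- A graded coherent sheaf as a subsheaf of itself. -/
def top {E : I → X.Modules} (hE : ∀ i, IsCoherent (E i)) : CoherentSub E :=
  ⟨fun _ => ⊤, fun i => (hE i).of_iso (asIso (⊤ : Subobject (E i)).arrow).symm⟩

/-- The isomorphism of the largest subsheaf with the whole sheaf. -/
def topIso {E : I → X.Modules} (hE : ∀ i, IsCoherent (E i)) (i : I) :
    ((top hE).1 i : X.Modules) ≅ E i :=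
  (asIso (⊤ : Subobject (E i)).arrow :)

theorem exists_not_isZero {E : I → X.Modules} {S : CoherentSub E} (hS : ⊥ < S) :
    ∃ i, ¬ IsZero (S.1 i : X.Modules) := by
  by_contra! h
  refine hS.not_ge fun i => Subobject.le_of_comm ((h i).to_ _) ((h i).eq_of_src _ _)

variable [Fintype I] [IsIntegral X] [IsRegularCurve X] {k : Type u} [Field k]
  (f : X ⟶ Spec (.of k)) [IsProper f] {E : I → X.Modules}
  (hB : ∃ B, ∀ S : CoherentSub E, gradedDegree f (fun i => (S.1 i : X.Modules)) ≤ B)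

theorem slope_eq_μ (S : CoherentSub E) :
    slope f (fun i => (S.1 i : X.Modules)) = (slopeOrder f hB).μ ⊥ S := by
  have hd : (slopeOrder f hB).deg ⊥ = 0 := gradedDegree_eq_zero_of_isZero f fun _ =>
    IsZero.of_iso (isZero_zero _) Subobject.botCoeIsoZero
  rw [SlopeOrder.μ, hd, (slopeOrder f hB).rk_bot, Nat.sub_zero, sub_zero]
  rfl

theorem slope_eq_μ_top (hE : ∀ i, IsCoherent (E i)) :
    slope f E = (slopeOrder f hB).μ ⊥ (top hE) := by
  rw [← slope_eq_μ, slope_eq_slopeOf, slope_eq_slopeOf,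
    gradedRank_congr (topIso hE) (top hE).2, gradedDegree_congr f (topIso hE) (top hE).2]

end CoherentSub

variable [IsIntegral X] [IsRegularCurve X] {k : Type u} [Field k] (f : X ⟶ Spec (.of k))
  [IsProper f] {D : CurveDivisor X} {n : ℕ} [NeZero n] {E : QuiverSheaf D n}

theorem slope_nonneg_of_isPositive {I : Type} [Fintype I] {E : I → X.Modules}
    (hE : IsPositive f E) : 0 ≤ slope f E := by
  obtain ⟨H, hH⟩ := hE
  have h := H.gradedDegree_nonneg hH
  rw [slope_eq_slopeOf]
  rcases Nat.eq_zero_or_pos (gradedRank E) with h0 | h0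
  · rw [h0, slopeOf_zero]
    exact le_top
  · rw [slopeOf_of_pos h0]
    have : (0 : ℚ) ≤ gradedDegree f E / gradedRank E :=
      div_nonneg (by exact_mod_cast h) (by positivity)
    exact_mod_cast this

theorem QuiverSubsheaf.slope_le_of_isPositiveSemistable {ν : WithTop ℚ}
    (hν : (((divisorDegree f D : ℚ) * ((E.totalRank : ℚ) - 1) / 2 : ℚ) : WithTop ℚ) ≤ ν)
    (hE : E.IsPositiveSemistableOfSlope f ν) (F : QuiverSubsheaf E) (hF : F.sheaf.IsNonzero) :
    F.sheaf.μ f ≤ E.μ f := by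
  obtain ⟨hpos, hμ, hss⟩ := hE
  induction hm : F.sheaf.totalRank using Nat.strong_induction_on generalizing F with
  | _ m ih =>
    by_contra! hlt
    have hB : ∃ B, ∀ S : CoherentSub F.sheaf.obj,
        gradedDegree f (fun i => (S.1 i : X.Modules)) ≤ B := by
      obtain ⟨H, -⟩ := hpos
      obtain ⟨B, hB⟩ := H.exists_gradedDegree_le
      exact ⟨B, fun S => hB _ (fun i => (S.1 i).arrow ≫ F.incl i) S.2 fun i =>
        have := F.mono i; mono_comp _ _⟩
    let T := CoherentSub.top F.sheaf.coherent
    have hT : F.sheaf.μ f = (CoherentSub.slopeOrder f hB).μ ⊥ T :=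
      CoherentSub.slope_eq_μ_top f hB F.sheaf.coherent
    have hrkT : (CoherentSub.slopeOrder f hB).rk T = F.sheaf.totalRank :=
      gradedRank_congr (CoherentSub.topIso F.sheaf.coherent) T.2
    have hE0 : 0 ≤ E.μ f := slope_nonneg_of_isPositive f hpos
    obtain ⟨N, s, hs⟩ := (CoherentSub.slopeOrder f hB).exists_isHNChain T
    by_cases h0 : 0 < N → 0 ≤ (CoherentSub.slopeOrder f hB).μ (s 1) (s 0)
    · obtain ⟨H, rfl, hH⟩ := CoherentSub.exists_hnFiltration f hB (fun _ => rfl) hs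
      refine hlt.not_ge (hss F hF ⟨H, fun j => ?_⟩)
      rw [hH]
      exact (h0 (Nat.zero_lt_of_lt j.2)).trans (hs.slope_mono (Nat.zero_le _) j.2)
    · push Not at h0
      obtain ⟨hN, h0⟩ := h0
      rcases (Nat.succ_le_of_lt hN).eq_or_lt with rfl | hN
      · rw [hs.last, hs.zero, ← hT] at h0
        exact (hE0.trans_lt hlt).not_gt h0
      · obtain ⟨h1, hl, hR⟩ := hs.μ_le_of_slope_le (l := divisorDegree f D) hN h0 fun j hj => by
          refine F.sheaf.slope_le_of_not_mapsTo f hB (fun _ => rfl) hs hj fun hinv => ?_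
          have h1 := ih _ (hm ▸ hrkT ▸ hs.rk_lt_rk (Nat.succ_pos j) hj) (F.restrict _ hinv)
            (CoherentSub.exists_not_isZero ((hs.lt (j + 1) hj).bot_lt)) rfl
          refine (hlt.trans ?_).not_ge h1
          rw [hT]
          exact (hs.μ_lt_μ (Nat.succ_pos j) hj).trans_eq
            (CoherentSub.slope_eq_μ f hB (s (j + 1))).symm
        rw [← hT, hrkT] at h1
        refine (hlt.trans_le (h1.trans ?_)).not_ge (hν.trans_eq hμ.symm)
        have hle : F.sheaf.totalRank ≤ E.totalRank := by
          have := F.mono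
          exact (Nat.le_add_right _ _).trans_eq
            (gradedRank_add_cokernel F.incl F.sheaf.coherent E.coherent).symm
        rw [WithTop.coe_le_coe]
        have hle' : (F.sheaf.totalRank : ℚ) ≤ E.totalRank := by exact_mod_cast hle
        have hl' : (0 : ℚ) ≤ divisorDegree f D := by exact_mod_cast hl.le
        have := mul_le_mul_of_nonneg_left hle' hl'
        linarith

end Main

end

end QuiverSheaves

end

theorem propositionP {k : Type u} [Field k] (X : Scheme.{u}) [IsIntegral X]
    (f : X ⟶ Spec (.of k)) [IsProper f] [SmoothOfRelativeDimension 1 f] [GeometricallyConnected f]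
    (D : QuiverSheaves.CurveDivisor X) (n : ℕ) [NeZero n] (r : ℕ) (hr : 1 ≤ r) (ν : WithTop ℚ)
    (hν : (((QuiverSheaves.divisorDegree f D : ℚ) * ((r : ℚ) - 1) / 2 : ℚ) : WithTop ℚ) ≤ ν)
    (E : QuiverSheaves.QuiverSheaf D n) (hE : E.IsPositiveSemistableOfSlope f ν)
    (hrk : E.totalRank = r) :
    E.IsSemistableOfSlope f ν := by
  have := QuiverSheaves.isRegularCurve f
  subst hrk
  exact ⟨hE.2.1, fun F hF => F.slope_le_of_isPositiveSemistable f hν hE hF⟩
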